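/- Let $\tilde\Omega\subset\mathbb C$ be a domain and let $\rho:\tilde\Omega\to(0,\infty)$ be $C^\infty$; put $\lambda=(\log\rho)_w$. A $C^2$ map $f:\Omega\to\tilde\Omega$ of a domain $\Omega\subset\mathbb C$ is called harmonic with respect to $\rho(w)|dw|$ if $$f_{z\bar z}+\lambda(f)\,f_z\,f_{\bar z}=0\quad\text{on }\Omega .$$ Let $g:\tilde\Omega\to\Omega=g(\tilde\Omega)\subset\mathbb C$ be a quasiconformal homeomorphism, that is, $g\in W^{1,2}_{loc}(\tilde\Omega)$ and $|g_{\bar w}|\le k_0|g_w|$ almost everywhere for some constant $k_0<1$. Let $\mu=\mu^g$ be its Beltrami coefficient, so $g_{\bar w}=\mu\,g_w$ almost everywhere. (1) If $f=g^{-1}:\Omega\to\tilde\Omega$ is harmonic with respect to $\rho(w)|dw|$, then $\mu$ is (after modification on a null set) of class $C^1$ on $\tilde\Omega$ and at every point of $\tilde\Omega$ $$\mu_w-\bar\mu\,\mu_{\bar w}=-\mu\,\bigl(\lambda+\bar\mu\,\bar\lambda\bigr).\qquad(*)$$ (2) Conversely, if $\mu\in W^{1,1}_{loc}(\tilde\Omega)$,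 $\|\mu\|_\infty<1$ and the weak derivatives of $\mu$ satisfy $(*)$ almost everywhere in $\tilde\Omega$, then $f=g^{-1}$ is harmonic with respect to $\rho(w)|dw|$ (in particular it is of class $C^2$). -/

import Mathlib

open MeasureTheory Set
open scoped ContDiff ComplexConjugate

noncomputable section

/-- The Wirtinger derivative `h_w = (h_x - i h_y) / 2`. -/
def wirt (h : ℂ → ℂ) (w : ℂ) : ℂ :=
  (fderiv ℝ h w 1 - Complex.I * fderiv ℝ h w Complex.I) / 2

/-- The Wirtinger derivative `h_{w̄} = (h_x + i h_y) / 2`. -/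
def wirtBar (h : ℂ → ℂ) (w : ℂ) : ℂ :=
  (fderiv ℝ h w 1 + Complex.I * fderiv ℝ h w Complex.I) / 2

/-- `u` belongs to `L^p_loc(U)`: it is in `L^p(K)` for every compact `K ⊆ U`. -/
def MemLpLoc (p : ENNReal) (U : Set ℂ) (u : ℂ → ℂ) : Prop :=
  ∀ K : Set ℂ, K ⊆ U → IsCompact K → MemLp u p (volume.restrict K)

/-- The locally integrable functions `a` and `b` are the weak (distributional) derivatives
`u_w` and `u_{w̄}` of the locally integrable function `u` on the open set `U`. Since
`u_x = u_w + u_{w̄}` and `u_y = i (u_w - u_{w̄})`, this is the same as having the weak partial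
derivatives `u_x = a + b` and `u_y = i (a - b)`. -/
structure HasWeakWirt (U : Set ℂ) (u a b : ℂ → ℂ) : Prop where
  memLpLoc : MemLpLoc 1 U u
  memLpLoc_wirt : MemLpLoc 1 U a
  memLpLoc_wirtBar : MemLpLoc 1 U b
  integral_wirt : ∀ φ : ℂ → ℂ, ContDiff ℝ ∞ φ → HasCompactSupport φ → tsupport φ ⊆ U →
    ∫ w, u w * wirt φ w = - ∫ w, a w * φ w
  integral_wirtBar : ∀ φ : ℂ → ℂ, ContDiff ℝ ∞ φ → HasCompactSupport φ → tsupport φ ⊆ U →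
    ∫ w, u w * wirtBar φ w = - ∫ w, b w * φ w

/-- `u` belongs to `W^{1,p}_loc(U)`. -/
def MemSobolevLoc (p : ENNReal) (U : Set ℂ) (u : ℂ → ℂ) : Prop :=
  MemLpLoc p U u ∧ ∃ a b : ℂ → ℂ, HasWeakWirt U u a b ∧ MemLpLoc p U a ∧ MemLpLoc p U b

/-- The homeomorphism `g` from the open set `g.source` onto the open set `g.target` is
(orientation preserving) quasiconformal: `g ∈ W^{1,2}_loc` and, for some constant `k < 1`,
`|g_{w̄}| ≤ k |g_w|` almost everywhere. -/
def IsQuasiconformal (g : OpenPartialHomeomorph ℂ ℂ) : Prop :=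
  MemSobolevLoc 2 g.source g ∧
    ∃ a b : ℂ → ℂ, HasWeakWirt g.source g a b ∧
      ∃ k : ℝ, k < 1 ∧ ∀ᵐ w ∂(volume.restrict g.source), ‖b w‖ ≤ k * ‖a w‖

/-- `μ` is the Beltrami coefficient of `g`: it is measurable and `g_{w̄} = μ g_w` almost
everywhere. -/
def IsBeltramiCoefficient (g : OpenPartialHomeomorph ℂ ℂ) (μ : ℂ → ℂ) : Prop :=
  AEStronglyMeasurable μ (volume.restrict g.source) ∧
    ∃ a b : ℂ → ℂ, HasWeakWirt g.source g a b ∧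
      ∀ᵐ w ∂(volume.restrict g.source), b w = μ w * a w

/-- `λ = (log ρ)_w`. -/
def logDensityDeriv (ρ : ℂ → ℝ) (w : ℂ) : ℂ :=
  wirt (fun ζ => (Real.log (ρ ζ) : ℂ)) w

/-- `f : Ω → (Ω', ρ)` is harmonic: it is `C²` and solves the tension equation
`f_{z z̄} + (log ρ)_w(f) f_z f_{z̄} = 0`. -/
structure IsHarmonicInto (Ω Ω' : Set ℂ) (ρ : ℂ → ℝ) (f : ℂ → ℂ) : Prop where
  mapsTo : MapsTo f Ω Ω'
  contDiffOn : ContDiffOn ℝ 2 f Ω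
  tension : ∀ z ∈ Ω,
    wirtBar (wirt f) z + logDensityDeriv ρ (f z) * wirt f z * wirtBar f z = 0

/-- The first order equation `m_w - m̄ m_{w̄} = -m (λ + m̄ λ̄)` at a point, as a relation between
the values `m`, `a = m_w`, `b = m_{w̄}` and `l = λ`. -/
def InverseDilatationEq (m a b l : ℂ) : Prop :=
  a - conj m * b = -(m * (l + conj m * conj l))

end

noncomputable section

open MeasureTheory Set Filter Topology
open scoped ContDiff ComplexConjugate

/-- The real linear map `v ↦ α v + β v̄`. -/
def wirtL (α β : ℂ) : ℂ →L[ℝ] ℂ :=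
  ContinuousLinearMap.mul ℝ ℂ α +
    (ContinuousLinearMap.mul ℝ ℂ β).comp (Complex.conjCLE : ℂ →L[ℝ] ℂ)

@[simp] theorem wirtL_apply (α β v : ℂ) : wirtL α β v = α * v + β * conj v := by
  simp [wirtL]

theorem wirtL_ext {L : ℂ →L[ℝ] ℂ} {α β : ℂ} (h1 : L 1 = α + β)
    (hI : L Complex.I = Complex.I * (α - β)) : L = wirtL α β := by
  refine ContinuousLinearMap.ext fun v => ?_
  have hv : v = v.re • (1 : ℂ) + v.im • Complex.I := by
    simp [Complex.re_add_im]
  have h : L v = v.re * (α + β) + v.im * (Complex.I * (α - β)) := by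
    conv_lhs => rw [hv, map_add, map_smul, map_smul, h1, hI]
    rw [Complex.real_smul, Complex.real_smul]
  have hc : conj v = v.re - v.im * Complex.I := by
    apply Complex.ext <;> simp
  rw [h, wirtL_apply, hc]
  linear_combination α * Complex.re_add_im v

theorem fderiv_eq_wirtL (h : ℂ → ℂ) (z : ℂ) : fderiv ℝ h z = wirtL (wirt h z) (wirtBar h z) := by
  apply wirtL_ext
  · simp only [wirt, wirtBar]; ring
  · simp only [wirt, wirtBar]
    linear_combination (fderiv ℝ h z Complex.I) * Complex.I_sq

theorem fderiv_apply_wirt (h : ℂ → ℂ) (z v : ℂ) :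
    fderiv ℝ h z v = wirt h z * v + wirtBar h z * conj v := by
  rw [fderiv_eq_wirtL, wirtL_apply]

theorem DifferentiableAt.hasFDerivAt_wirtL {h : ℂ → ℂ} {z : ℂ} (hd : DifferentiableAt ℝ h z) :
    HasFDerivAt h (wirtL (wirt h z) (wirtBar h z)) z := by
  rw [← fderiv_eq_wirtL]; exact hd.hasFDerivAt

theorem HasFDerivAt.wirt_eq {h : ℂ → ℂ} {z α β : ℂ} (hd : HasFDerivAt h (wirtL α β) z) :
    wirt h z = α := by
  rw [wirt, hd.fderiv, wirtL_apply, wirtL_apply]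
  simp
  linear_combination (-(α - β) / 2) * Complex.I_sq

theorem HasFDerivAt.wirtBar_eq {h : ℂ → ℂ} {z α β : ℂ} (hd : HasFDerivAt h (wirtL α β) z) :
    wirtBar h z = β := by
  rw [wirtBar, hd.fderiv, wirtL_apply, wirtL_apply]
  simp
  linear_combination ((α - β) / 2) * Complex.I_sq

theorem norm_wirtL_le (α β : ℂ) : ‖wirtL α β‖ ≤ ‖α‖ + ‖β‖ := by
  apply ContinuousLinearMap.opNorm_le_bound _ (by positivity)
  intro v
  rw [wirtL_apply]
  refine (norm_add_le _ _).trans ?_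
  simp [add_mul]

theorem HasFDerivAt.wirtL_conj {h : ℂ → ℂ} {z α β : ℂ} (hd : HasFDerivAt h (wirtL α β) z) :
    HasFDerivAt (fun w => conj (h w)) (wirtL (conj β) (conj α)) z := by
  refine ((Complex.conjCLE : ℂ →L[ℝ] ℂ).hasFDerivAt.comp z hd).congr_fderiv
    (ContinuousLinearMap.ext fun v => ?_)
  simp; ring

theorem HasFDerivAt.wirtL_add {h k : ℂ → ℂ} {z α β α' β' : ℂ} (hd : HasFDerivAt h (wirtL α β) z)
    (kd : HasFDerivAt k (wirtL α' β') z) :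
    HasFDerivAt (fun w => h w + k w) (wirtL (α + α') (β + β')) z := by
  refine (hd.add kd).congr_fderiv (ContinuousLinearMap.ext fun v => ?_)
  simp; ring

theorem HasFDerivAt.wirtL_mul {h k : ℂ → ℂ} {z α β α' β' : ℂ} (hd : HasFDerivAt h (wirtL α β) z)
    (kd : HasFDerivAt k (wirtL α' β') z) :
    HasFDerivAt (fun w => h w * k w)
      (wirtL (α * k z + h z * α') (β * k z + h z * β')) z := by
  refine (hd.mul kd).congr_fderiv (ContinuousLinearMap.ext fun v => ?_)
  simp; ring

theorem HasFDerivAt.wirtL_comp {h k : ℂ → ℂ} {z α β α' β' : ℂ}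
    (hd : HasFDerivAt h (wirtL α β) (k z)) (kd : HasFDerivAt k (wirtL α' β') z) :
    HasFDerivAt (fun w => h (k w))
      (wirtL (α * α' + β * conj β') (α * β' + β * conj α')) z := by
  refine (hd.comp z kd).congr_fderiv (ContinuousLinearMap.ext fun v => ?_)
  simp; ring

theorem hasFDerivAt_wirtL_const (c z : ℂ) : HasFDerivAt (fun _ : ℂ => c) (wirtL 0 0) z := by
  refine (hasFDerivAt_const (𝕜 := ℝ) c z).congr_fderiv (ContinuousLinearMap.ext fun v => ?_)
  simp

theorem hasFDerivAt_wirtL_id (z : ℂ) : HasFDerivAt (fun w : ℂ => w) (wirtL 1 0) z := by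
  refine (hasFDerivAt_id (𝕜 := ℝ) z).congr_fderiv (ContinuousLinearMap.ext fun v => ?_)
  simp

theorem HasDerivAt.hasFDerivAt_wirtL {h : ℂ → ℂ} {z a : ℂ} (hd : HasDerivAt h a z) :
    HasFDerivAt h (wirtL a 0) z := by
  refine (hd.hasFDerivAt.restrictScalars ℝ).congr_fderiv (ContinuousLinearMap.ext fun v => ?_)
  simp [mul_comm]

theorem det_wirtL (α β : ℂ) : (wirtL α β).det = ‖α‖ ^ 2 - ‖β‖ ^ 2 := by
  have : (wirtL α β).det = LinearMap.det (wirtL α β : ℂ →ₗ[ℝ] ℂ) := rfl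
  rw [this, ← LinearMap.det_toMatrix Complex.basisOneI, Matrix.det_fin_two]
  simp [LinearMap.toMatrix_apply, ← Complex.normSq_eq_norm_sq, Complex.normSq_apply]
  ring

theorem ContDiffOn.wirt {U : Set ℂ} (hU : IsOpen U) {h : ℂ → ℂ} {m n : WithTop ℕ∞}
    (hh : ContDiffOn ℝ n h U) (hmn : m + 1 ≤ n) :
    ContDiffOn ℝ m (wirt h) U := by
  have := hh.fderiv_of_isOpen hU hmn
  exact ((this.clm_apply contDiffOn_const).sub
    (contDiffOn_const.mul (this.clm_apply contDiffOn_const))).div_const 2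

theorem ContDiffOn.wirtBar {U : Set ℂ} (hU : IsOpen U) {h : ℂ → ℂ} {m n : WithTop ℕ∞}
    (hh : ContDiffOn ℝ n h U) (hmn : m + 1 ≤ n) :
    ContDiffOn ℝ m (wirtBar h) U := by
  have := hh.fderiv_of_isOpen hU hmn
  exact ((this.clm_apply contDiffOn_const).add
    (contDiffOn_const.mul (this.clm_apply contDiffOn_const))).div_const 2

theorem ContDiff.wirt {h : ℂ → ℂ} {m n : WithTop ℕ∞} (hh : ContDiff ℝ n h) (hmn : m + 1 ≤ n) :
    ContDiff ℝ m (wirt h) :=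
  contDiffOn_univ.1 (hh.contDiffOn.wirt isOpen_univ hmn)

theorem ContDiff.wirtBar {h : ℂ → ℂ} {m n : WithTop ℕ∞} (hh : ContDiff ℝ n h) (hmn : m + 1 ≤ n) :
    ContDiff ℝ m (wirtBar h) :=
  contDiffOn_univ.1 (hh.contDiffOn.wirtBar isOpen_univ hmn)

theorem wirt_eq_zero_of_fderiv {h : ℂ → ℂ} {z : ℂ} (hz : fderiv ℝ h z = 0) : wirt h z = 0 := by
  simp [wirt, hz]

theorem wirtBar_eq_zero_of_fderiv {h : ℂ → ℂ} {z : ℂ} (hz : fderiv ℝ h z = 0) :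
    wirtBar h z = 0 := by
  simp [wirtBar, hz]

theorem tsupport_wirt_subset (h : ℂ → ℂ) : tsupport (wirt h) ⊆ tsupport h := by
  refine closure_minimal (fun z hz => ?_) (isClosed_tsupport h)
  by_contra hn
  exact hz (wirt_eq_zero_of_fderiv (image_eq_zero_of_notMem_tsupport
    fun hh => hn (tsupport_fderiv_subset ℝ hh)))

theorem tsupport_wirtBar_subset (h : ℂ → ℂ) : tsupport (wirtBar h) ⊆ tsupport h := by
  refine closure_minimal (fun z hz => ?_) (isClosed_tsupport h)
  by_contra hn
  exact hz (wirtBar_eq_zero_of_fderiv (image_eq_zero_of_notMem_tsupport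
    fun hh => hn (tsupport_fderiv_subset ℝ hh)))

/-- `φ` is a complex valued test function on `U`. -/
structure IsTest (U : Set ℂ) (φ : ℂ → ℂ) : Prop where
  contDiff : ContDiff ℝ ∞ φ
  compact : HasCompactSupport φ
  subset : tsupport φ ⊆ U

namespace IsTest
variable {U : Set ℂ} {φ ψ : ℂ → ℂ}

theorem continuous (h : IsTest U φ) : Continuous φ := h.contDiff.continuous

theorem differentiable (h : IsTest U φ) : Differentiable ℝ φ := h.contDiff.differentiable (by simp)

theorem hasFDerivAt (h : IsTest U φ) (z : ℂ) : HasFDerivAt φ (wirtL (wirt φ z) (wirtBar φ z)) z :=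
  (h.differentiable z).hasFDerivAt_wirtL

theorem wirt (h : IsTest U φ) : IsTest U (wirt φ) :=
  ⟨h.contDiff.wirt (by simp), h.compact.mono' ((subset_tsupport _).trans (tsupport_wirt_subset φ)),
    (tsupport_wirt_subset φ).trans h.subset⟩

theorem wirtBar (h : IsTest U φ) : IsTest U (wirtBar φ) :=
  ⟨h.contDiff.wirtBar (by simp),
    h.compact.mono' ((subset_tsupport _).trans (tsupport_wirtBar_subset φ)),
    (tsupport_wirtBar_subset φ).trans h.subset⟩

theorem mono {V : Set ℂ} (h : IsTest U φ) (hUV : U ⊆ V) : IsTest V φ :=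
  ⟨h.contDiff, h.compact, h.subset.trans hUV⟩

theorem star (h : IsTest U φ) : IsTest U (fun w => (starRingEnd ℂ) (φ w)) := by
  have hs : tsupport (fun w => (starRingEnd ℂ) (φ w)) ⊆ tsupport φ :=
    closure_mono fun z hz => by simpa using hz
  exact ⟨Complex.conjCLE.contDiff.comp h.contDiff,
    h.compact.mono' ((subset_tsupport _).trans hs), hs.trans h.subset⟩

theorem mul_left {χ : ℂ → ℂ} (h : IsTest U φ) (hχ : ContDiff ℝ ∞ χ) :
    IsTest U (fun w => χ w * φ w) := by
  have hs : tsupport (fun w => χ w * φ w) ⊆ tsupport φ :=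
    closure_mono fun z hz => fun hn => hz (by simp [hn])
  exact ⟨hχ.mul h.contDiff, h.compact.mono' ((subset_tsupport _).trans hs), hs.trans h.subset⟩

end IsTest

theorem exists_cutoff {K U : Set ℂ} (hK : IsCompact K) (hU : IsOpen U) (hKU : K ⊆ U) :
    ∃ χ : ℂ → ℝ, IsTest U (fun w => (χ w : ℂ)) ∧ (∀ z, 0 ≤ χ z) ∧ (∀ z, χ z ≤ 1) ∧
      ∃ V, IsOpen V ∧ K ⊆ V ∧ V ⊆ U ∧ ∀ z ∈ V, χ z = 1 := by
  obtain ⟨L, hL, hKL, hLU⟩ := exists_compact_between hK hU hKU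
  obtain ⟨M, hM, hLM, hMU⟩ := exists_compact_between hL hU hLU
  obtain ⟨χ, hχs, hχt, hχS, hχ1⟩ := exists_contMDiff_support_eq_eq_one_iff (modelWithCornersSelf ℝ ℂ)
    isOpen_interior hL.isClosed hLM
  have hts : tsupport χ ⊆ M := by
    rw [tsupport, hχS]
    exact closure_minimal interior_subset hM.isClosed
  have hts' : tsupport (fun w => (χ w : ℂ)) ⊆ tsupport χ :=
    closure_mono fun z hz => by simpa using hz
  refine ⟨χ, ⟨Complex.ofRealCLM.contDiff.comp hχs.contDiff, ?_, hts'.trans (hts.trans hMU)⟩,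
    fun z => (hχt (mem_range_self z)).1, fun z => (hχt (mem_range_self z)).2,
    interior L, isOpen_interior, hKL, interior_subset.trans hLU,
    fun z hz => (hχ1 z).1 (interior_subset hz)⟩
  exact HasCompactSupport.of_support_subset_isCompact hM
    ((subset_tsupport _).trans (hts'.trans hts))

end

noncomputable section

open MeasureTheory Set Filter Topology
open scoped ContDiff ComplexConjugate ENNReal

namespace MemLpLoc
variable {p q r : ℝ≥0∞} {U V : Set ℂ} {u v : ℂ → ℂ}

theorem mono_set (h : MemLpLoc p U u) (hVU : V ⊆ U) : MemLpLoc p V u :=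
  fun K hK hc => h K (hK.trans hVU) hc

theorem mono_exponent (h : MemLpLoc q U u) (hpq : p ≤ q) : MemLpLoc p U u := fun K hK hc =>
  have : IsFiniteMeasure (volume.restrict K) := ⟨by simpa using hc.measure_lt_top⟩
  (h K hK hc).mono_exponent hpq

theorem congr (h : MemLpLoc p U u) (huv : u =ᵐ[volume.restrict U] v) : MemLpLoc p U v :=
  fun K hK hc => (memLp_congr_ae (ae_restrict_of_ae_restrict_of_subset hK huv)).1 (h K hK hc)

theorem mul (hu : MemLpLoc p U u) (hv : MemLpLoc q U v) [ENNReal.HolderTriple p q r] :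
    MemLpLoc r U (fun w => u w * v w) := fun K hK hc => (hv K hK hc).mul' (hu K hK hc)

theorem add (hu : MemLpLoc p U u) (hv : MemLpLoc p U v) : MemLpLoc p U (fun w => u w + v w) :=
  fun K hK hc => (hu K hK hc).add (hv K hK hc)

theorem sub (hu : MemLpLoc p U u) (hv : MemLpLoc p U v) : MemLpLoc p U (fun w => u w - v w) :=
  fun K hK hc => (hu K hK hc).sub (hv K hK hc)

theorem neg (hu : MemLpLoc p U u) : MemLpLoc p U (fun w => -u w) :=
  fun K hK hc => (hu K hK hc).neg

theorem const_mul (hu : MemLpLoc p U u) (c : ℂ) : MemLpLoc p U (fun w => c * u w) :=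
  fun K hK hc => (hu K hK hc).const_mul c

theorem star (hu : MemLpLoc p U u) : MemLpLoc p U (fun w => conj (u w)) :=
  fun K hK hc => (hu K hK hc).star

theorem of_continuousOn (hu : ContinuousOn u U) : MemLpLoc p U u := fun K hK hc => by
  have : IsFiniteMeasure (volume.restrict K) := ⟨by simpa using hc.measure_lt_top⟩
  obtain ⟨C, hC⟩ := hc.exists_bound_of_continuousOn (hu.mono hK)
  exact MemLp.of_bound ((hu.mono hK).aestronglyMeasurable hc.measurableSet) C
    ((ae_restrict_iff' hc.measurableSet).2 (Eventually.of_forall hC))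

theorem locallyIntegrableOn (hU : IsOpen U) (hu : MemLpLoc 1 U u) :
    LocallyIntegrableOn u U volume :=
  (locallyIntegrableOn_iff hU.isLocallyClosed).2 fun K hK hc =>
    memLp_one_iff_integrable.1 (hu K hK hc)

theorem aestronglyMeasurable (hU : IsOpen U) (hu : MemLpLoc 1 U u) :
    AEStronglyMeasurable u (volume.restrict U) :=
  (hu.locallyIntegrableOn hU).aestronglyMeasurable

theorem integrable_mul (hu : MemLpLoc 1 U u) (hv : Continuous v) (hc : HasCompactSupport v)
    (hs : tsupport v ⊆ U) : Integrable (fun w => u w * v w) := by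
  have hK : IsCompact (tsupport v) := hc
  obtain ⟨C, hC⟩ := hv.bounded_above_of_compact_support hc
  have h1 : IntegrableOn (fun w => u w * v w) (tsupport v) :=
    (memLp_one_iff_integrable.1 (hu _ hs hK)).mul_bdd hv.aestronglyMeasurable
      (Eventually.of_forall hC)
  refine (integrableOn_iff_integrable_of_support_subset fun w hw => ?_).1 h1
  exact subset_tsupport _ fun h => hw (by simp [h])

theorem integrable_mul_test (hu : MemLpLoc 1 U u) (hv : IsTest U v) :
    Integrable (fun w => u w * v w) := hu.integrable_mul hv.continuous hv.compact hv.subset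

end MemLpLoc

theorem MeasureTheory.MemLp.memLpLoc {p : ℝ≥0∞} {u : ℂ → ℂ} (hu : MemLp u p volume) (U : Set ℂ) :
    MemLpLoc p U u := fun K _ _ => hu.restrict K

theorem MemLpLoc.of_memLp_restrict {p : ℝ≥0∞} {U : Set ℂ} {u : ℂ → ℂ}
    (hu : MemLp u p (volume.restrict U)) :
    MemLpLoc p U u := fun _ hK _ => hu.mono_measure (Measure.restrict_mono hK le_rfl)

/-- `b` is the weak derivative `u_{w̄}` of `u` on `U`. -/
structure HasWeakBar (U : Set ℂ) (u b : ℂ → ℂ) : Prop where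
  memLpLoc : MemLpLoc 1 U u
  memLpLoc_bar : MemLpLoc 1 U b
  integral_bar : ∀ φ : ℂ → ℂ, IsTest U φ → ∫ w, u w * wirtBar φ w = - ∫ w, b w * φ w

theorem IsTest.wirt_star {U : Set ℂ} {φ : ℂ → ℂ} (h : IsTest U φ) (w : ℂ) :
    _root_.wirt (fun w => conj (φ w)) w = conj (_root_.wirtBar φ w) := (h.hasFDerivAt w).wirtL_conj.wirt_eq

theorem IsTest.wirtBar_star {U : Set ℂ} {φ : ℂ → ℂ} (h : IsTest U φ) (w : ℂ) :
    _root_.wirtBar (fun w => conj (φ w)) w = conj (_root_.wirt φ w) := (h.hasFDerivAt w).wirtL_conj.wirtBar_eq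

theorem hasWeakWirt_iff {U : Set ℂ} {u a b : ℂ → ℂ} : HasWeakWirt U u a b ↔
    HasWeakBar U u b ∧ HasWeakBar U (fun w => conj (u w)) (fun w => conj (a w)) := by
  constructor
  · intro h
    refine ⟨⟨h.memLpLoc, h.memLpLoc_wirtBar, fun φ hφ =>
      h.integral_wirtBar φ hφ.contDiff hφ.compact hφ.subset⟩,
      ⟨h.memLpLoc.star, h.memLpLoc_wirt.star, fun φ hφ => ?_⟩⟩
    have := congrArg conj (h.integral_wirt _ hφ.star.contDiff hφ.star.compact hφ.star.subset)
    simp only [map_neg, ← integral_conj, map_mul, hφ.wirt_star, Complex.conj_conj] at this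
    exact this
  · rintro ⟨h1, h2⟩
    refine ⟨h1.memLpLoc, by simpa using h2.memLpLoc_bar.star, h1.memLpLoc_bar, fun φ hs hc hU => ?_,
      fun φ hs hc hU => h1.integral_bar φ ⟨hs, hc, hU⟩⟩
    have hφ : IsTest U φ := ⟨hs, hc, hU⟩
    have := congrArg conj (h2.integral_bar _ hφ.star)
    simp only [map_neg, ← integral_conj, map_mul, hφ.wirtBar_star, Complex.conj_conj] at this
    exact this

theorem ae_eq_zero_of_test {U : Set ℂ} (hU : IsOpen U) {u : ℂ → ℂ} (hu : MemLpLoc 1 U u)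
    (h : ∀ φ, IsTest U φ → ∫ w, u w * φ w = 0) : u =ᵐ[volume.restrict U] 0 := by
  refine (ae_restrict_iff' hU.measurableSet).2
    (hU.ae_eq_zero_of_integral_contDiff_smul_eq_zero (hu.locallyIntegrableOn hU) fun g hg hc hs => ?_)
  have hts : tsupport (fun w => (g w : ℂ)) ⊆ tsupport g :=
    closure_mono fun z hz => by simpa using hz
  have := h (fun w => g w) ⟨Complex.ofRealCLM.contDiff.comp hg,
    hc.mono' ((subset_tsupport _).trans hts), hts.trans hs⟩
  simpa [mul_comm] using this

theorem ae_eq_of_test {U : Set ℂ} (hU : IsOpen U) {u v : ℂ → ℂ} (hu : MemLpLoc 1 U u)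
    (hv : MemLpLoc 1 U v) (h : ∀ φ, IsTest U φ → ∫ w, u w * φ w = ∫ w, v w * φ w) :
    u =ᵐ[volume.restrict U] v := by
  have := ae_eq_zero_of_test hU (hu.sub hv) fun φ hφ => by
    simp_rw [sub_mul]
    rw [integral_sub (hu.integrable_mul_test hφ) (hv.integrable_mul_test hφ), h φ hφ, sub_self]
  filter_upwards [this] with w hw
  exact sub_eq_zero.1 hw

theorem integral_congr_of_test {U : Set ℂ} (hU : IsOpen U) {u v φ : ℂ → ℂ}
    (huv : u =ᵐ[volume.restrict U] v) (hφ : ∀ w, w ∉ U → φ w = 0) :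
    ∫ w, u w * φ w = ∫ w, v w * φ w := by
  refine integral_congr_ae ?_
  filter_upwards [(ae_restrict_iff' hU.measurableSet).1 huv] with w hw
  by_cases h : w ∈ U
  · simp [hw h]
  · simp [hφ w h]

theorem IsTest.eq_zero {U : Set ℂ} {φ : ℂ → ℂ} (h : IsTest U φ) {w : ℂ} (hw : w ∉ U) : φ w = 0 :=
  image_eq_zero_of_notMem_tsupport fun hh => hw (h.subset hh)

namespace HasWeakBar
variable {U V : Set ℂ} {u v b c : ℂ → ℂ}

theorem mono (h : HasWeakBar U u b) (hVU : V ⊆ U) : HasWeakBar V u b :=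
  ⟨h.memLpLoc.mono_set hVU, h.memLpLoc_bar.mono_set hVU,
    fun φ hφ => h.integral_bar φ (hφ.mono hVU)⟩

theorem congr (hU : IsOpen U) (h : HasWeakBar U u b) (huv : u =ᵐ[volume.restrict U] v)
    (hbc : b =ᵐ[volume.restrict U] c) : HasWeakBar U v c :=
  ⟨h.memLpLoc.congr huv, h.memLpLoc_bar.congr hbc, fun φ hφ => by
    rw [← integral_congr_of_test hU huv fun w hw => hφ.wirtBar.eq_zero hw, h.integral_bar φ hφ,
      integral_congr_of_test hU hbc fun w hw => hφ.eq_zero hw]⟩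

theorem unique (hU : IsOpen U) (h : HasWeakBar U u b) (h' : HasWeakBar U u c) :
    b =ᵐ[volume.restrict U] c :=
  ae_eq_of_test hU h.memLpLoc_bar h'.memLpLoc_bar fun φ hφ =>
    neg_injective ((h.integral_bar φ hφ).symm.trans (h'.integral_bar φ hφ))

theorem add (h : HasWeakBar U u b) (h' : HasWeakBar U v c) :
    HasWeakBar U (fun w => u w + v w) (fun w => b w + c w) :=
  ⟨h.memLpLoc.add h'.memLpLoc, h.memLpLoc_bar.add h'.memLpLoc_bar, fun φ hφ => by
    simp_rw [add_mul]
    rw [integral_add (h.memLpLoc.integrable_mul_test hφ.wirtBar)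
      (h'.memLpLoc.integrable_mul_test hφ.wirtBar),
      integral_add (h.memLpLoc_bar.integrable_mul_test hφ)
      (h'.memLpLoc_bar.integrable_mul_test hφ), h.integral_bar φ hφ, h'.integral_bar φ hφ]
    ring⟩

theorem const_mul (h : HasWeakBar U u b) (k : ℂ) :
    HasWeakBar U (fun w => k * u w) (fun w => k * b w) :=
  ⟨h.memLpLoc.const_mul k, h.memLpLoc_bar.const_mul k, fun φ hφ => by
    simp_rw [mul_assoc]
    rw [integral_const_mul, integral_const_mul, h.integral_bar φ hφ]
    ring⟩

/-- Cutting off turns a local weak derivative into a global one. -/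
theorem cutoff (h : HasWeakBar U u b) {χ : ℂ → ℂ} (hχ : IsTest U χ) :
    HasWeakBar univ (fun w => u w * χ w) (fun w => u w * wirtBar χ w + b w * χ w) := by
  have i1 := h.memLpLoc.integrable_mul_test hχ
  have i2 := h.memLpLoc.integrable_mul_test hχ.wirtBar
  have i3 := h.memLpLoc_bar.integrable_mul_test hχ
  refine ⟨(memLp_one_iff_integrable.2 i1).memLpLoc _,
    (memLp_one_iff_integrable.2 (i2.add i3)).memLpLoc _, fun φ hφ => ?_⟩
  have hχφ : IsTest U (fun w => φ w * χ w) := hχ.mul_left hφ.contDiff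
  have hd : ∀ w, wirtBar (fun w => φ w * χ w) w = wirtBar φ w * χ w + φ w * wirtBar χ w := fun w =>
    ((hφ.hasFDerivAt w).wirtL_mul (hχ.hasFDerivAt w)).wirtBar_eq
  have hχ'φ : IsTest U (fun w => φ w * wirtBar χ w) := hχ.wirtBar.mul_left hφ.contDiff
  have e1 : ∫ w, u w * χ w * wirtBar φ w =
      (∫ w, u w * wirtBar (fun w => φ w * χ w) w) - ∫ w, u w * (φ w * wirtBar χ w) := by
    rw [← integral_sub (h.memLpLoc.integrable_mul_test hχφ.wirtBar)
      (h.memLpLoc.integrable_mul_test hχ'φ)]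
    congr 1; ext w
    rw [hd]; ring
  have e2 : ∫ w, (u w * wirtBar χ w + b w * χ w) * φ w =
      (∫ w, u w * (φ w * wirtBar χ w)) + ∫ w, b w * (φ w * χ w) := by
    rw [← integral_add (h.memLpLoc.integrable_mul_test hχ'φ)
      (h.memLpLoc_bar.integrable_mul_test hχφ)]
    congr 1; ext w; ring
  rw [e1, e2, h.integral_bar _ hχφ]
  ring

/-- The classical derivative is a weak derivative. -/
theorem of_contDiffOn (hU : IsOpen U) (hu : ContDiffOn ℝ 1 u U) :
    HasWeakBar U u (wirtBar u) := by
  have hd : ∀ w ∈ U, DifferentiableAt ℝ u w := fun w hw =>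
    (hu.differentiableOn (by simp)).differentiableAt (hU.mem_nhds hw)
  have m1 : MemLpLoc 1 U u := .of_continuousOn hu.continuousOn
  have hcf : ContinuousOn (fderiv ℝ u) U := hu.continuousOn_fderiv_of_isOpen hU le_rfl
  have m2 : ∀ v, MemLpLoc 1 U (fun w => fderiv ℝ u w v) := fun v =>
    .of_continuousOn (hcf.clm_apply continuousOn_const)
  refine ⟨m1, .of_continuousOn (hu.wirtBar hU (by simp) (m := 0)).continuousOn, fun φ hφ => ?_⟩
  have hφd : ∀ v, IsTest U (fun w => fderiv ℝ φ w v) := fun v => by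
    have : (fun w => fderiv ℝ φ w v) = fun w => wirt φ w * v + wirtBar φ w * conj v :=
      funext fun w => fderiv_apply_wirt φ w v
    have hs : tsupport (fun w => fderiv ℝ φ w v) ⊆ tsupport φ :=
      tsupport_fderiv_apply_subset ℝ v
    refine ⟨?_, hφ.compact.mono' ((subset_tsupport _).trans hs), hs.trans hφ.subset⟩
    rw [this]
    exact (hφ.wirt.contDiff.mul contDiff_const).add (hφ.wirtBar.contDiff.mul contDiff_const)
  have key : ∀ v, ∫ w, u w * fderiv ℝ φ w v = - ∫ w, fderiv ℝ u w v * φ w := fun v =>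
    integral_mul_fderiv_eq_neg_fderiv_mul_of_integrable
      ((m2 v).integrable_mul_test hφ) (m1.integrable_mul_test (hφd v))
      (m1.integrable_mul_test hφ) (fun w hw => hd w (hφ.subset hw))
      fun w _ => hφ.differentiable w
  have e1 : ∫ w, u w * wirtBar φ w = ((∫ w, u w * fderiv ℝ φ w 1) +
      Complex.I * ∫ w, u w * fderiv ℝ φ w Complex.I) / 2 := by
    rw [← integral_const_mul, ← integral_add (m1.integrable_mul_test (hφd 1))
      ((m1.integrable_mul_test (hφd Complex.I)).const_mul _), ← integral_div]
    congr 1; ext w; simp only [wirtBar]; ring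
  have e2 : ∫ w, wirtBar u w * φ w = ((∫ w, fderiv ℝ u w 1 * φ w) +
      Complex.I * ∫ w, fderiv ℝ u w Complex.I * φ w) / 2 := by
    rw [← integral_const_mul, ← integral_add ((m2 1).integrable_mul_test hφ)
      (((m2 Complex.I).integrable_mul_test hφ).const_mul _), ← integral_div]
    congr 1; ext w; simp only [wirtBar]; ring
  rw [e1, e2, key, key]
  ring

end HasWeakBar

namespace HasWeakWirt
variable {U V : Set ℂ} {u v a b a' b' : ℂ → ℂ}

theorem bar (h : HasWeakWirt U u a b) : HasWeakBar U u b := (hasWeakWirt_iff.1 h).1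

theorem star (h : HasWeakWirt U u a b) :
    HasWeakWirt U (fun w => conj (u w)) (fun w => conj (b w)) (fun w => conj (a w)) := by
  rw [hasWeakWirt_iff] at h ⊢
  exact ⟨h.2, by simpa using h.1⟩

theorem mono (h : HasWeakWirt U u a b) (hVU : V ⊆ U) : HasWeakWirt V u a b :=
  hasWeakWirt_iff.2 ⟨h.bar.mono hVU, h.star.bar.mono hVU⟩

theorem congr (hU : IsOpen U) (h : HasWeakWirt U u a b) (huv : u =ᵐ[volume.restrict U] v)
    (ha : a =ᵐ[volume.restrict U] a') (hb : b =ᵐ[volume.restrict U] b') :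
    HasWeakWirt U v a' b' :=
  hasWeakWirt_iff.2 ⟨h.bar.congr hU huv hb, h.star.bar.congr hU
    (huv.fun_comp conj) (ha.fun_comp conj)⟩

theorem unique (hU : IsOpen U) (h : HasWeakWirt U u a b) (h' : HasWeakWirt U u a' b') :
    a =ᵐ[volume.restrict U] a' ∧ b =ᵐ[volume.restrict U] b' := by
  refine ⟨?_, h.bar.unique hU h'.bar⟩
  filter_upwards [h.star.bar.unique hU h'.star.bar] with w hw
  exact (starRingEnd ℂ).injective hw

theorem add (h : HasWeakWirt U u a b) (h' : HasWeakWirt U v a' b') :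
    HasWeakWirt U (fun w => u w + v w) (fun w => a w + a' w) (fun w => b w + b' w) :=
  hasWeakWirt_iff.2 ⟨h.bar.add h'.bar, by simpa using h.star.bar.add h'.star.bar⟩

theorem const_mul (h : HasWeakWirt U u a b) (k : ℂ) :
    HasWeakWirt U (fun w => k * u w) (fun w => k * a w) (fun w => k * b w) :=
  hasWeakWirt_iff.2 ⟨h.bar.const_mul k, by simpa using h.star.bar.const_mul (conj k)⟩

theorem cutoff (h : HasWeakWirt U u a b) {χ : ℂ → ℂ} (hχ : IsTest U χ) :
    HasWeakWirt univ (fun w => u w * χ w) (fun w => u w * wirt χ w + a w * χ w)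
      (fun w => u w * wirtBar χ w + b w * χ w) :=
  hasWeakWirt_iff.2 ⟨h.bar.cutoff hχ, by
    have := h.star.bar.cutoff hχ.star
    simpa [hχ.wirtBar_star] using this⟩

theorem of_contDiffOn (hU : IsOpen U) (hu : ContDiffOn ℝ 1 u U) :
    HasWeakWirt U u (wirt u) (wirtBar u) := by
  refine hasWeakWirt_iff.2 ⟨.of_contDiffOn hU hu, ?_⟩
  refine (HasWeakBar.of_contDiffOn hU (Complex.conjCLE.contDiff.comp_contDiffOn hu)).congr hU
    (ae_eq_refl _) ((ae_restrict_iff' hU.measurableSet).2 (Eventually.of_forall fun w hw => ?_))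
  exact (((hu.differentiableOn (by simp)).differentiableAt
    (hU.mem_nhds hw)).hasFDerivAt_wirtL.wirtL_conj).wirtBar_eq

end HasWeakWirt
end

noncomputable section

open MeasureTheory Set Filter Topology
open scoped ContDiff ComplexConjugate ENNReal Convolution

/-- A sequence of smooth bumps shrinking to the origin. -/
def mollBump (n : ℕ) : ContDiffBump (0 : ℂ) where
  rIn := 1 / (2 * ((n : ℝ) + 1))
  rOut := 1 / ((n : ℝ) + 1)
  rIn_pos := by positivity
  rIn_lt_rOut := by
    rw [div_lt_div_iff_of_pos_left one_pos (by positivity) (by positivity)]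
    linarith [(Nat.cast_nonneg n : (0 : ℝ) ≤ n)]

/-- The mollifying kernels. -/
def mollKer (n : ℕ) : ℂ → ℝ := (mollBump n).normed volume

/-- The mollification of a function. -/
def moll (n : ℕ) (u : ℂ → ℂ) : ℂ → ℂ := mollKer n ⋆[ContinuousLinearMap.lsmul ℝ ℝ, volume] u

theorem tendsto_mollBump_rOut : Tendsto (fun n => (mollBump n).rOut) atTop (𝓝 0) :=
  tendsto_one_div_add_atTop_nhds_zero_nat

theorem mollKer_nonneg (n : ℕ) (z : ℂ) : 0 ≤ mollKer n z := (mollBump n).nonneg_normed z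

theorem integral_mollKer (n : ℕ) : ∫ z, mollKer n z = 1 := (mollBump n).integral_normed

theorem contDiff_mollKer (n : ℕ) : ContDiff ℝ ∞ (mollKer n) := (mollBump n).contDiff_normed

theorem hasCompactSupport_mollKer (n : ℕ) : HasCompactSupport (mollKer n) :=
  (mollBump n).hasCompactSupport_normed

theorem integrable_mollKer (n : ℕ) : Integrable (mollKer n) :=
  (contDiff_mollKer n).continuous.integrable_of_hasCompactSupport (hasCompactSupport_mollKer n)

theorem isTest_mollKer (n : ℕ) (z : ℂ) : IsTest univ (fun t => (mollKer n (z - t) : ℂ)) := by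
  refine ⟨Complex.ofRealCLM.contDiff.comp ((contDiff_mollKer n).comp
    (contDiff_const.sub contDiff_id)), ?_, subset_univ _⟩
  have h : HasCompactSupport (fun t => mollKer n (z - t)) :=
    (hasCompactSupport_mollKer n).comp_homeomorph (Homeomorph.subLeft z)
  exact h.comp_left (g := fun x : ℝ => (x : ℂ)) (by simp)

theorem moll_apply (n : ℕ) (u : ℂ → ℂ) (z : ℂ) :
    moll n u z = ∫ t, u t * (mollKer n (z - t) : ℂ) := by
  rw [moll, convolution_eq_swap]
  congr 1; ext t
  simp [mul_comm]

theorem moll_congr {u v : ℂ → ℂ} (h : u =ᵐ[volume] v) (n : ℕ) : moll n u = moll n v :=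
  convolution_congr _ (ae_eq_refl _) h

theorem contDiff_moll {u : ℂ → ℂ} (hu : LocallyIntegrable u) (n : ℕ) : ContDiff ℝ ∞ (moll n u) :=
  (hasCompactSupport_mollKer n).contDiff_convolution_left _ (contDiff_mollKer n) hu

theorem hasCompactSupport_moll {u : ℂ → ℂ} (hu : HasCompactSupport u) (n : ℕ) :
    HasCompactSupport (moll n u) :=
  (hasCompactSupport_mollKer n).convolution _ hu

theorem isTest_moll {u : ℂ → ℂ} (hu : Integrable u) (hc : HasCompactSupport u) (n : ℕ) :
    IsTest univ (moll n u) :=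
  ⟨contDiff_moll hu.locallyIntegrable n, hasCompactSupport_moll hc n, subset_univ _⟩

theorem norm_moll_le {u : ℂ → ℂ} {R : ℝ} (hu : ∀ᵐ w, ‖u w‖ ≤ R) (n : ℕ) (z : ℂ) :
    ‖moll n u z‖ ≤ R := by
  have h1 : ∀ᵐ t : ℂ, ‖u (z - t)‖ ≤ R :=
    (quasiMeasurePreserving_sub_left_of_right_invariant volume z).tendsto_ae hu
  rw [moll, convolution_def]
  calc _ ≤ ∫ t, mollKer n t * R := by
        refine norm_integral_le_of_norm_le ((integrable_mollKer n).mul_const R) ?_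
        filter_upwards [h1] with t ht
        simp only [ContinuousLinearMap.lsmul_apply, norm_smul, Real.norm_eq_abs,
          abs_of_nonneg (mollKer_nonneg n t)]
        exact mul_le_mul_of_nonneg_left ht (mollKer_nonneg n t)
    _ = R := by rw [integral_mul_const, integral_mollKer, one_mul]

theorem fderiv_moll {u : ℂ → ℂ} (hu : LocallyIntegrable u) (n : ℕ) (z v : ℂ) :
    fderiv ℝ (moll n u) z v = ∫ t, u t * ((fderiv ℝ (mollKer n) (z - t) v : ℝ) : ℂ) := by
  have h1 : moll n u = u ⋆[(ContinuousLinearMap.lsmul ℝ ℝ : ℝ →L[ℝ] ℂ →L[ℝ] ℂ).flip, volume]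
      mollKer n := (convolution_flip _).symm
  have hk1 : ContDiff ℝ 1 (mollKer n) := (contDiff_mollKer n).of_le (by simp)
  have := (hasCompactSupport_mollKer n).hasFDerivAt_convolution_right
    (ContinuousLinearMap.lsmul ℝ ℝ : ℝ →L[ℝ] ℂ →L[ℝ] ℂ).flip hu hk1 z
  rw [h1, this.fderiv, convolution_precompR_apply _ hu
    ((hasCompactSupport_mollKer n).fderiv ℝ) (hk1.continuous_fderiv one_ne_zero), convolution_def]
  congr 1; ext t
  simp [mul_comm]

theorem wirtBar_moll {u b : ℂ → ℂ} (h : HasWeakBar univ u b) (n : ℕ) :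
    wirtBar (moll n u) = moll n b := by
  ext z
  have hu : LocallyIntegrable u :=
    locallyIntegrableOn_univ.1 (h.memLpLoc.locallyIntegrableOn isOpen_univ)
  set φ : ℂ → ℂ := fun t => (mollKer n (z - t) : ℂ) with hφdef
  have hφ : IsTest univ φ := isTest_mollKer n z
  have hd : ∀ t v, fderiv ℝ φ t v = -((fderiv ℝ (mollKer n) (z - t) v : ℝ) : ℂ) := fun t v => by
    have h1 : HasFDerivAt (mollKer n) (fderiv ℝ (mollKer n) (z - t)) (z - t) :=
      ((contDiff_mollKer n).differentiable (by simp) _).hasFDerivAt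
    have h2 : HasFDerivAt (fun t : ℂ => z - t) (-ContinuousLinearMap.id ℝ ℂ) t :=
      (hasFDerivAt_id t).const_sub z
    have h3 := (Complex.ofRealCLM.hasFDerivAt).comp t (h1.comp t h2)
    have h4 : fderiv ℝ φ t = _ := h3.fderiv
    rw [h4]
    simp
  have i : ∀ v, Integrable (fun t => u t * ((fderiv ℝ (mollKer n) (z - t) v : ℝ) : ℂ)) := fun v => by
    have hi := ((h.memLpLoc.integrable_mul_test hφ.wirt).mul_const v).add
      ((h.memLpLoc.integrable_mul_test hφ.wirtBar).mul_const (conj v))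
    refine hi.neg.congr (Eventually.of_forall fun t => ?_)
    have := fderiv_apply_wirt φ t v
    rw [hd] at this
    simp only [Pi.neg_apply, Pi.add_apply]
    linear_combination (u t) * this
  rw [moll_apply, ← neg_eq_iff_eq_neg.2 (h.integral_bar φ hφ), wirtBar, fderiv_moll hu,
    fderiv_moll hu, ← integral_const_mul, ← integral_add (i 1) ((i Complex.I).const_mul _),
    ← integral_div, ← integral_neg]
  congr 1; ext t
  rw [wirtBar, hd, hd]
  ring

theorem moll_star (n : ℕ) (u : ℂ → ℂ) : moll n (fun w => conj (u w)) = fun w => conj (moll n u w) := by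
  ext z
  rw [moll_apply, moll_apply, ← integral_conj]
  simp

theorem wirt_moll {u a b : ℂ → ℂ} (h : HasWeakWirt univ u a b) (n : ℕ) :
    wirt (moll n u) = moll n a := by
  have h1 := wirtBar_moll h.star.bar n
  have hu : LocallyIntegrable u :=
    locallyIntegrableOn_univ.1 (h.memLpLoc.locallyIntegrableOn isOpen_univ)
  have hd : Differentiable ℝ (moll n u) := (contDiff_moll hu n).differentiable (by simp)
  ext z
  have := congrFun h1 z
  rw [moll_star, moll_star, ((hd z).hasFDerivAt_wirtL.wirtL_conj).wirtBar_eq] at this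
  exact (starRingEnd ℂ).injective this

theorem ae_tendsto_moll {u : ℂ → ℂ} (hu : LocallyIntegrable u) :
    ∀ᵐ z, Tendsto (fun n => moll n u z) atTop (𝓝 (u z)) := by
  refine ContDiffBump.ae_convolution_tendsto_right_of_locallyIntegrable (K := 2)
    tendsto_mollBump_rOut (Eventually.of_forall fun n => le_of_eq ?_) hu
  simp only [mollBump]
  field_simp

theorem tendstoUniformly_moll {u : ℂ → ℂ} (hu : Continuous u) (hc : HasCompactSupport u) :
    TendstoUniformly (fun n => moll n u) u atTop := by
  have huc := hc.uniformContinuous_of_continuous hu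
  rw [Metric.tendstoUniformly_iff]
  intro ε hε
  obtain ⟨δ, hδ, h⟩ := Metric.uniformContinuous_iff.1 huc (ε / 2) (half_pos hε)
  filter_upwards [tendsto_mollBump_rOut.eventually (gt_mem_nhds hδ)] with n hn z
  rw [dist_comm]
  refine lt_of_le_of_lt ((mollBump n).dist_normed_convolution_le hu.aestronglyMeasurable
    fun x hx => (h ?_).le) (half_lt_self hε)
  exact (Metric.mem_ball.1 hx).trans hn

theorem eLpNorm_moll_le {u : ℂ → ℂ} {p : ℝ≥0∞} (h1 : 1 ≤ p) (hp : p ≠ ⊤)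
    (hu : AEStronglyMeasurable u) (n : ℕ) : eLpNorm (moll n u) p ≤ eLpNorm u p := by
  obtain ⟨u', hu', huu⟩ := hu
  rw [moll_congr huu, eLpNorm_congr_ae huu]
  clear huu u
  have hp0 : p ≠ 0 := (one_pos.trans_le h1).ne'
  have hpr : 0 < p.toReal := ENNReal.toReal_pos hp0 hp
  set κ : ℂ → ℝ≥0∞ := fun t => ENNReal.ofReal (mollKer n t) with hκ
  have hκm : Measurable κ := (contDiff_mollKer n).continuous.measurable.ennreal_ofReal
  have hκ1 : ∫⁻ t, κ t = 1 := by
    rw [← ofReal_integral_eq_lintegral_ofReal (integrable_mollKer n)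
      (Eventually.of_forall (mollKer_nonneg n)), integral_mollKer, ENNReal.ofReal_one]
  set P := volume.withDensity κ with hP
  have hPp : IsProbabilityMeasure P := ⟨by rw [hP, withDensity_apply _ MeasurableSet.univ]; simpa⟩
  have hmeas : Measurable u' := hu'.measurable
  have hpt : ∀ z, ‖moll n u' z‖ₑ ^ p.toReal ≤ ∫⁻ t, κ t * ‖u' (z - t)‖ₑ ^ p.toReal := fun z => by
    have hm : AEStronglyMeasurable (fun t => u' (z - t)) P :=
      (hu'.comp_measurable (measurable_const.sub measurable_id)).aestronglyMeasurable
    have e1 : ‖moll n u' z‖ₑ ≤ eLpNorm (fun t => u' (z - t)) 1 P := by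
      rw [moll, convolution_def, eLpNorm_one_eq_lintegral_enorm, hP,
        lintegral_withDensity_eq_lintegral_mul _ hκm (by fun_prop)]
      refine (enorm_integral_le_lintegral_enorm _).trans (lintegral_mono fun t => ?_)
      simp only [ContinuousLinearMap.lsmul_apply, Pi.mul_apply, enorm_smul, hκ]
      rw [Real.enorm_of_nonneg (mollKer_nonneg n t)]
    have e2 := e1.trans (eLpNorm_le_eLpNorm_of_exponent_le h1 hm)
    calc _ ≤ (eLpNorm (fun t => u' (z - t)) p P) ^ p.toReal := by gcongr
      _ = _ := by
        rw [eLpNorm_eq_lintegral_rpow_enorm_toReal hp0 hp, ← ENNReal.rpow_mul,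
          one_div_mul_cancel hpr.ne', ENNReal.rpow_one, hP,
          lintegral_withDensity_eq_lintegral_mul _ hκm (by fun_prop)]
        rfl
  rw [eLpNorm_eq_lintegral_rpow_enorm_toReal hp0 hp, eLpNorm_eq_lintegral_rpow_enorm_toReal hp0 hp]
  gcongr ?_ ^ _
  calc _ ≤ ∫⁻ z, ∫⁻ t, κ t * ‖u' (z - t)‖ₑ ^ p.toReal := lintegral_mono hpt
    _ = ∫⁻ t, ∫⁻ z, κ t * ‖u' (z - t)‖ₑ ^ p.toReal := by
        refine lintegral_lintegral_swap ?_
        exact ((hκm.comp measurable_snd).mul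
          ((hmeas.comp (measurable_fst.sub measurable_snd)).enorm.pow_const _)).aemeasurable
    _ = ∫⁻ t, κ t * ∫⁻ z, ‖u' z‖ₑ ^ p.toReal := by
        refine lintegral_congr fun t => ?_
        rw [lintegral_const_mul _ (by fun_prop),
          lintegral_sub_right_eq_self (fun z => ‖u' z‖ₑ ^ p.toReal) t]
    _ = _ := by rw [lintegral_mul_const _ hκm, hκ1, one_mul]

theorem moll_sub {u v : ℂ → ℂ} (hu : LocallyIntegrable u) (hv : LocallyIntegrable v) (n : ℕ) (z : ℂ) :
    moll n (fun w => u w - v w) z = moll n u z - moll n v z := by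
  have i : ∀ {w : ℂ → ℂ}, LocallyIntegrable w →
      Integrable (fun t => w t * (mollKer n (z - t) : ℂ)) := fun hw => by
    have := hw.integrable_smul_left_of_hasCompactSupport (isTest_mollKer n z).continuous
      (isTest_mollKer n z).compact
    simpa [mul_comm] using this
  rw [moll_apply, moll_apply, moll_apply, ← integral_sub (i hu) (i hv)]
  simp_rw [sub_mul]

theorem tendsto_eLpNorm_moll_of_continuous {u : ℂ → ℂ} {p : ℝ≥0∞} (h1 : 1 ≤ p)
    (hu : Continuous u) (hc : HasCompactSupport u) :
    Tendsto (fun n => eLpNorm (fun z => moll n u z - u z) p) atTop (𝓝 0) := by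
  have hp0 : p ≠ 0 := (one_pos.trans_le h1).ne'
  set K := Metric.cthickening 1 (tsupport u) with hK
  have hKc : IsCompact K := IsCompact.cthickening hc
  have hKm := hKc.measurableSet
  have hz : ∀ n z, z ∉ K → moll n u z - u z = 0 := fun n z hz => by
    have hu0 : u z = 0 := image_eq_zero_of_notMem_tsupport fun h =>
      hz (Metric.self_subset_cthickening _ h)
    rw [hu0, sub_zero, moll_apply]
    refine integral_eq_zero_of_ae (Eventually.of_forall fun t => ?_)
    by_cases ht : t ∈ tsupport u
    · have : mollKer n (z - t) = 0 := by
        by_contra hne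
        have hmem : z - t ∈ Function.support (mollKer n) := hne
        rw [mollKer, (mollBump n).support_normed_eq, mem_ball_zero_iff] at hmem
        refine hz (Metric.mem_cthickening_of_dist_le z t 1 _ ht ?_)
        rw [dist_eq_norm]
        refine hmem.le.trans ?_
        simp only [mollBump]
        rw [div_le_one (by positivity)]
        linarith [(Nat.cast_nonneg n : (0 : ℝ) ≤ n)]
      simp [this]
    · simp [image_eq_zero_of_notMem_tsupport ht]
  rw [ENNReal.tendsto_nhds_zero]
  intro ε hε
  have hM : volume K ^ (1 / p.toReal) ≠ ⊤ :=
    ENNReal.rpow_ne_top_of_nonneg (by positivity) hKc.measure_lt_top.ne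
  obtain ⟨δ, hδ, hδε⟩ : ∃ δ : ℝ, 0 < δ ∧ volume K ^ (1 / p.toReal) * ENNReal.ofReal δ ≤ ε := by
    have : Tendsto (fun δ : ℝ => volume K ^ (1 / p.toReal) * ENNReal.ofReal δ) (𝓝[>] 0) (𝓝 0) := by
      have h2 : Tendsto (fun δ : ℝ => ENNReal.ofReal δ) (𝓝[>] 0) (𝓝 0) := by
        simpa using (ENNReal.continuous_ofReal.tendsto 0).mono_left nhdsWithin_le_nhds
      simpa using ENNReal.Tendsto.const_mul h2 (Or.inr hM)
    obtain ⟨δ, h1, h2⟩ := ((ENNReal.tendsto_nhds_zero.1 this ε hε).and self_mem_nhdsWithin).exists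
    exact ⟨δ, h2, h1⟩
  filter_upwards [Metric.tendstoUniformly_iff.1 (tendstoUniformly_moll hu hc) δ hδ] with n hn
  have hm : AEStronglyMeasurable (fun z => moll n u z - u z) :=
    ((contDiff_moll hu.locallyIntegrable n).continuous.sub hu).aestronglyMeasurable
  have hsupp : eLpNorm (fun z => moll n u z - u z) p =
      eLpNorm (fun z => moll n u z - u z) p (volume.restrict K) := by
    rw [← eLpNorm_indicator_eq_eLpNorm_restrict hKm]
    congr 1
    ext z
    by_cases h : z ∈ K
    · simp [h]
    · simp [h, hz n z h]
  rw [hsupp]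
  refine (eLpNorm_le_of_ae_bound (C := δ) (Eventually.of_forall fun z => ?_)).trans ?_
  · have := hn z
    rw [dist_comm, dist_eq_norm] at this
    exact this.le
  · simpa [one_div] using hδε

theorem tendsto_eLpNorm_moll {u : ℂ → ℂ} {p : ℝ≥0∞} (h1 : 1 ≤ p) (hp : p ≠ ⊤) (hu : MemLp u p) :
    Tendsto (fun n => eLpNorm (fun z => moll n u z - u z) p) atTop (𝓝 0) := by
  rw [ENNReal.tendsto_nhds_zero]
  intro ε hε
  obtain ⟨v, hvc, hv, hvcont, hvm⟩ := hu.exists_hasCompactSupport_eLpNorm_sub_le hp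
    (ε := ε / 3) (ENNReal.div_pos hε.ne' (by simp)).ne'
  filter_upwards [ENNReal.tendsto_nhds_zero.1 (tendsto_eLpNorm_moll_of_continuous h1 hvcont hvc)
    (ε / 3) (ENNReal.div_pos hε.ne' (by simp))] with n hn
  have lu := hu.locallyIntegrable h1
  have lv := hvm.locallyIntegrable h1
  have mu : AEStronglyMeasurable (moll n (fun z => u z - v z)) :=
    (contDiff_moll (lu.sub lv) n).continuous.aestronglyMeasurable
  have mv : AEStronglyMeasurable (fun z => moll n v z - v z) :=
    ((contDiff_moll lv n).continuous.sub hvcont).aestronglyMeasurable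
  have e : (fun z => moll n u z - u z) =
      (moll n (fun z => u z - v z) + fun z => moll n v z - v z) - (u - v) := by
    ext z
    simp only [Pi.add_apply, Pi.sub_apply, moll_sub lu lv]
    ring
  rw [e]
  refine (eLpNorm_sub_le (mu.add mv) (hu.1.sub hvm.1) h1).trans ?_
  calc _ ≤ (ε / 3 + ε / 3) + ε / 3 := by
        gcongr
        refine (eLpNorm_add_le mu mv h1).trans ?_
        gcongr
        exact (eLpNorm_moll_le h1 hp (hu.1.sub hvm.1) n).trans hv
    _ = ε := ENNReal.add_thirds ε
end

noncomputable section

open MeasureTheory Set Filter Topology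
open scoped ContDiff ComplexConjugate ENNReal

theorem wirtBar_wirt_comm {U : Set ℂ} (hU : IsOpen U) {φ : ℂ → ℂ} (hφ : ContDiffOn ℝ 2 φ U)
    {w : ℂ} (hw : w ∈ U) : wirtBar (wirt φ) w = wirt (wirtBar φ) w := by
  have hat : ContDiffAt ℝ 2 φ w := hφ.contDiffAt (hU.mem_nhds hw)
  have hd : DifferentiableAt ℝ (fderiv ℝ φ) w :=
    (hat.fderiv_right (m := 1) (by norm_num)).differentiableAt (by simp)
  have hs : IsSymmSndFDerivAt ℝ φ w := hat.isSymmSndFDerivAt (by simp)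
  have h1 : ∀ v, HasFDerivAt (fun x => fderiv ℝ φ x v)
      ((fderiv ℝ (fderiv ℝ φ) w).flip v) w := fun v =>
    (hd.hasFDerivAt.clm_apply (hasFDerivAt_const v w)).congr_fderiv (by ext; simp)
  have e1 := (((h1 1).sub ((h1 Complex.I).const_mul Complex.I)).mul_const (2⁻¹ : ℂ)).fderiv
  have e2 := (((h1 1).add ((h1 Complex.I).const_mul Complex.I)).mul_const (2⁻¹ : ℂ)).fderiv
  have f1 : fderiv ℝ (wirt φ) w = _ := e1
  have f2 : fderiv ℝ (wirtBar φ) w = _ := e2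
  have := hs.eq 1 Complex.I
  rw [wirtBar, wirt, f1, f2]
  simp [this]
  ring

theorem integral_add₃ {f g k : ℂ → ℂ} (hf : Integrable f) (hg : Integrable g) (hk : Integrable k) :
    ∫ w, (f w + g w + k w) = (∫ w, f w) + (∫ w, g w) + ∫ w, k w := by
  have hfg : Integrable (fun w => f w + g w) := hf.add hg
  rw [integral_add hfg hk, integral_add hf hg]

theorem tendsto_integral_mul_of_eLpNorm {p q : ℝ≥0∞} [ENNReal.HolderTriple p q 1] {f a : ℂ → ℂ}
    {s : ℕ → ℂ → ℂ} (hf : MemLp f p) (hs : ∀ n, MemLp (s n) q) (ha : MemLp a q)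
    (h : Tendsto (fun n => eLpNorm (fun z => s n z - a z) q) atTop (𝓝 0)) :
    Tendsto (fun n => ∫ z, f z * s n z) atTop (𝓝 (∫ z, f z * a z)) := by
  refine tendsto_integral_of_L1' _ (memLp_one_iff_integrable.1 (ha.mul' hf)).1 (Eventually.of_forall
    fun n => memLp_one_iff_integrable.1 ((hs n).mul' hf)) ?_
  have hb : Tendsto (fun n => eLpNorm f p * eLpNorm (fun z => s n z - a z) q) atTop (𝓝 0) := by
    simpa using ENNReal.Tendsto.const_mul h (Or.inr hf.2.ne)
  refine tendsto_of_tendsto_of_tendsto_of_le_of_le tendsto_const_nhds hb (fun n => zero_le)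
    fun n => ?_
  have := eLpNorm_smul_le_mul_eLpNorm (p := p) (q := q) (r := 1) ((hs n).sub ha).1 hf.1
  refine le_trans (le_of_eq ?_) this
  congr 1
  ext z
  simp [mul_sub]

theorem tendsto_integral_mul_of_bounded {c : ℂ → ℂ} {a : ℂ → ℂ} {s t : ℕ → ℂ → ℂ} {M : ℝ}
    (hc : ∀ᵐ z, Tendsto (fun n => t n z) atTop (𝓝 (c z)))
    (htm : ∀ n, AEStronglyMeasurable (t n)) (ht : ∀ n, ∀ᵐ z, ‖t n z‖ ≤ M)
    (hs : ∀ n, Integrable (s n)) (ha : Integrable a)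
    (h : Tendsto (fun n => eLpNorm (fun z => s n z - a z) 1) atTop (𝓝 0)) :
    Tendsto (fun n => ∫ z, t n z * s n z) atTop (𝓝 (∫ z, c z * a z)) := by
  have h1 : Tendsto (fun n => ∫ z, t n z * a z) atTop (𝓝 (∫ z, c z * a z)) := by
    refine tendsto_integral_of_dominated_convergence (fun z => M * ‖a z‖)
      (fun n => (htm n).mul ha.1) (ha.norm.const_mul M) (fun n => ?_) ?_
    · filter_upwards [ht n] with z hz
      rw [norm_mul]; gcongr
    · filter_upwards [hc] with z hz using hz.mul_const _
  have h2 : Tendsto (fun n => ∫ z, t n z * (s n z - a z)) atTop (𝓝 0) := by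
    rw [tendsto_zero_iff_norm_tendsto_zero]
    have hb : Tendsto (fun n => M * (eLpNorm (fun z => s n z - a z) 1).toReal) atTop (𝓝 0) := by
      have := (ENNReal.tendsto_toReal ENNReal.zero_ne_top).comp h
      simpa using this.const_mul M
    refine squeeze_zero (fun _ => norm_nonneg _) (fun n => ?_) hb
    have hi : Integrable (fun z => s n z - a z) := (hs n).sub ha
    rw [eLpNorm_one_eq_lintegral_enorm, ← integral_norm_eq_lintegral_enorm hi.1,
      ← integral_const_mul]
    refine norm_integral_le_of_norm_le (hi.norm.const_mul M) ?_
    filter_upwards [ht n] with z hz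
    rw [norm_mul]; gcongr
  refine (h1.add h2).congr' (Eventually.of_forall fun n => ?_) |>.trans (by rw [add_zero])
  have hsa : Integrable (fun z => s n z - a z) := (hs n).sub ha
  rw [← integral_add (ha.bdd_mul (htm n) (ht n)) (hsa.bdd_mul (htm n) (ht n))]
  congr 1; ext z; ring

theorem HasWeakWirt.of_local {U : Set ℂ} {u a b : ℂ → ℂ}
    (h : ∀ K, IsCompact K → K ⊆ U → ∃ V, K ⊆ V ∧ HasWeakWirt V u a b) : HasWeakWirt U u a b := by
  refine ⟨fun K hK hc => ?_, fun K hK hc => ?_, fun K hK hc => ?_, fun φ hφ hc hs => ?_,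
    fun φ hφ hc hs => ?_⟩
  · obtain ⟨V, hV, hw⟩ := h K hc hK
    exact hw.memLpLoc K hV hc
  · obtain ⟨V, hV, hw⟩ := h K hc hK
    exact hw.memLpLoc_wirt K hV hc
  · obtain ⟨V, hV, hw⟩ := h K hc hK
    exact hw.memLpLoc_wirtBar K hV hc
  · obtain ⟨V, hV, hw⟩ := h _ hc hs
    exact hw.integral_wirt φ hφ hc hV
  · obtain ⟨V, hV, hw⟩ := h _ hc hs
    exact hw.integral_wirtBar φ hφ hc hV

theorem memLpLoc_top_comp {U : Set ℂ} {u : ℂ → ℂ} (hu : AEStronglyMeasurable u (volume.restrict U))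
    {R : ℝ} (hR : ∀ᵐ w ∂volume.restrict U, ‖u w‖ ≤ R) {c : ℂ → ℂ}
    (hc : ContinuousOn c (Metric.closedBall 0 R)) : MemLpLoc ⊤ U (fun w => c (u w)) := by
  obtain ⟨C, hC⟩ := (isCompact_closedBall (0 : ℂ) R).exists_bound_of_continuousOn hc
  classical
  have hm : Measurable ((Metric.closedBall (0 : ℂ) R).piecewise c 0) :=
    hc.measurable_piecewise continuousOn_const measurableSet_closedBall
  refine MemLpLoc.of_memLp_restrict (memLp_top_of_bound (C := C) ?_ ?_)
  · refine (hm.comp_aemeasurable hu.aemeasurable).aestronglyMeasurable.congr ?_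
    filter_upwards [hR] with w hw
    simp [hw]
  · filter_upwards [hR] with w hw
    exact hC _ (by simpa using hw)

section Chain
variable {U : Set ℂ} {u a b β : ℂ → ℂ} {R : ℝ}

theorem continuousOn_wirt_of_contDiffAt {S : Set ℂ} (hβ : ∀ m ∈ S, ContDiffAt ℝ 1 β m) :
    ContinuousOn (wirt β) S ∧ ContinuousOn (wirtBar β) S := by
  have hf : ∀ m ∈ S, ContinuousAt (fderiv ℝ β) m := fun m hm =>
    ((hβ m hm).fderiv_right (m := 0) (by simp)).continuousAt
  constructor
  · intro m hm
    exact ((((hf m hm).clm_apply continuousAt_const).sub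
      (continuousAt_const.mul ((hf m hm).clm_apply continuousAt_const))).div_const 2).continuousWithinAt
  · intro m hm
    exact ((((hf m hm).clm_apply continuousAt_const).add
      (continuousAt_const.mul ((hf m hm).clm_apply continuousAt_const))).div_const 2).continuousWithinAt

theorem HasWeakWirt.bar_comp (hU : IsOpen U) (h : HasWeakWirt U u a b) (hR0 : 0 ≤ R)
    (hR : ∀ᵐ w ∂volume.restrict U, ‖u w‖ ≤ R)
    (hβ : ∀ m ∈ Metric.closedBall 0 R, ContDiffAt ℝ 1 β m) :
    HasWeakBar U (fun w => β (u w))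
      (fun w => wirt β (u w) * b w + wirtBar β (u w) * conj (a w)) := by
  have hβc : ContinuousOn β (Metric.closedBall 0 R) := fun m hm =>
    (hβ m hm).continuousAt.continuousWithinAt
  obtain ⟨hPc, hQc⟩ := continuousOn_wirt_of_contDiffAt hβ
  have hum := h.memLpLoc.aestronglyMeasurable hU
  refine ⟨(memLpLoc_top_comp hum hR hβc).mono_exponent le_top,
    ((memLpLoc_top_comp hum hR hPc).mul h.memLpLoc_wirtBar).add
      ((memLpLoc_top_comp hum hR hQc).mul h.memLpLoc_wirt.star), fun φ hφ => ?_⟩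
  obtain ⟨χ, hχ, hχ0, hχ1, V, hV, hKV, hVU, hχV⟩ := exists_cutoff hφ.compact hU hφ.subset
  have hg := h.cutoff hχ
  set v : ℂ → ℂ := fun w => u w * χ w with hv
  set A : ℂ → ℂ := fun w => u w * wirt (fun w => (χ w : ℂ)) w + a w * χ w with hA
  set B : ℂ → ℂ := fun w => u w * wirtBar (fun w => (χ w : ℂ)) w + b w * χ w with hB
  have hχd : ∀ w ∈ V, fderiv ℝ (fun w => (χ w : ℂ)) w = 0 := fun w hw => by
    have : (fun w => (χ w : ℂ)) =ᶠ[𝓝 w] fun _ => 1 := by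
      filter_upwards [hV.mem_nhds hw] with x hx
      rw [hχV x hx]; simp
    rw [this.fderiv_eq, fderiv_const_apply]
  have vi : Integrable v := h.memLpLoc.integrable_mul_test hχ
  have Ai : Integrable A := (h.memLpLoc.integrable_mul_test hχ.wirt).add
    (h.memLpLoc_wirt.integrable_mul_test hχ)
  have Bi : Integrable B := (h.memLpLoc.integrable_mul_test hχ.wirtBar).add
    (h.memLpLoc_wirtBar.integrable_mul_test hχ)
  have hvR : ∀ᵐ w, ‖v w‖ ≤ R := by
    filter_upwards [(ae_restrict_iff' hU.measurableSet).1 hR] with w hw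
    by_cases hwU : w ∈ U
    · simp only [hv, norm_mul, Complex.norm_real, Real.norm_eq_abs, abs_of_nonneg (hχ0 w)]
      exact (mul_le_mul (hw hwU) (hχ1 w) (hχ0 w) hR0).trans (by simp)
    · have := hχ.eq_zero hwU
      simp [hv, this, hR0]
  have hnR : ∀ n z, moll n v z ∈ Metric.closedBall (0 : ℂ) R := fun n z => by
    simpa using norm_moll_le hvR n z
  have hcn : ∀ n, Continuous (moll n v) := fun n => (contDiff_moll vi.locallyIntegrable n).continuous
  have hconv : ∀ᵐ z, Tendsto (fun n => moll n v z) atTop (𝓝 (v z)) :=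
    ae_tendsto_moll vi.locallyIntegrable
  obtain ⟨C0, hC0⟩ := (isCompact_closedBall (0 : ℂ) R).exists_bound_of_continuousOn hβc
  obtain ⟨C1, hC1⟩ := (isCompact_closedBall (0 : ℂ) R).exists_bound_of_continuousOn hPc
  obtain ⟨C2, hC2⟩ := (isCompact_closedBall (0 : ℂ) R).exists_bound_of_continuousOn hQc
  obtain ⟨Cφ, hCφ⟩ := hφ.continuous.bounded_above_of_compact_support hφ.compact
  have hid : ∀ n, ∫ w, β (moll n v w) * wirtBar φ w =
      -((∫ w, (wirt β (moll n v w) * φ w) * moll n B w) +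
        ∫ w, (wirtBar β (moll n v w) * φ w) * conj (moll n A w)) := fun n => by
    have hcd : ContDiff ℝ 1 (fun w => β (moll n v w)) := contDiff_iff_contDiffAt.2 fun w =>
      (hβ _ (hnR n w)).comp w
        (((contDiff_moll vi.locallyIntegrable n).of_le (by simp)).contDiffAt)
    have := (HasWeakBar.of_contDiffOn isOpen_univ hcd.contDiffOn).integral_bar φ (hφ.mono (subset_univ _))
    have hder : ∀ w, wirtBar (fun w => β (moll n v w)) w =
        wirt β (moll n v w) * moll n B w + wirtBar β (moll n v w) * conj (moll n A w) := fun w => by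
      have d1 := ((hβ _ (hnR n w)).differentiableAt (by simp)).hasFDerivAt_wirtL
      have d2 := (((contDiff_moll vi.locallyIntegrable n).differentiable
        (by simp)) w).hasFDerivAt_wirtL
      rw [(d1.wirtL_comp d2).wirtBar_eq, wirtBar_moll hg.bar, wirt_moll hg]
    rw [this]
    congr 1
    have hAn : LocallyIntegrable A := Ai.locallyIntegrable
    have hBn : LocallyIntegrable B := Bi.locallyIntegrable
    have cP : Continuous fun w => wirt β (moll n v w) :=
      hPc.comp_continuous (hcn n) (hnR n)
    have cQ : Continuous fun w => wirtBar β (moll n v w) :=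
      hQc.comp_continuous (hcn n) (hnR n)
    rw [← integral_add]
    · congr 1; ext w; rw [hder]; ring
    · exact ((cP.mul hφ.continuous).mul (contDiff_moll hBn n).continuous).integrable_of_hasCompactSupport
        ((hφ.compact.mul_left).mul_right)
    · exact ((cQ.mul hφ.continuous).mul
        (Complex.continuous_conj.comp (contDiff_moll hAn n).continuous)).integrable_of_hasCompactSupport
        ((hφ.compact.mul_left).mul_right)
  have hcont : ∀ {c : ℂ → ℂ}, ContinuousOn c (Metric.closedBall 0 R) →
      (∀ m ∈ Metric.closedBall (0 : ℂ) R, ContinuousAt c m) →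
      ∀ᵐ z, Tendsto (fun n => c (moll n v z)) atTop (𝓝 (c (v z))) := fun _ hc => by
    filter_upwards [hconv, hvR] with z hz hzR
    exact (hc _ (by simpa using hzR)).tendsto.comp hz
  have hfd : ∀ m ∈ Metric.closedBall (0 : ℂ) R, ContinuousAt (fderiv ℝ β) m := fun m hm =>
    ((hβ m hm).fderiv_right (m := 0) (by simp)).continuousAt
  have hPat : ∀ m ∈ Metric.closedBall (0 : ℂ) R, ContinuousAt (wirt β) m := fun m hm =>
    (((hfd m hm).clm_apply continuousAt_const).sub
      (continuousAt_const.mul ((hfd m hm).clm_apply continuousAt_const))).div_const 2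
  have hQat : ∀ m ∈ Metric.closedBall (0 : ℂ) R, ContinuousAt (wirtBar β) m := fun m hm =>
    (((hfd m hm).clm_apply continuousAt_const).add
      (continuousAt_const.mul ((hfd m hm).clm_apply continuousAt_const))).div_const 2
  have hL : Tendsto (fun n => ∫ w, β (moll n v w) * wirtBar φ w) atTop
      (𝓝 (∫ w, β (v w) * wirtBar φ w)) := by
    refine tendsto_integral_of_dominated_convergence (fun w => C0 * ‖wirtBar φ w‖)
      (fun n => ((hβc.comp_continuous (hcn n) (hnR n)).mul
        hφ.wirtBar.continuous).aestronglyMeasurable)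
      ((hφ.wirtBar.continuous.integrable_of_hasCompactSupport hφ.wirtBar.compact).norm.const_mul _)
      (fun n => Eventually.of_forall fun w => ?_) ?_
    · rw [norm_mul]
      exact mul_le_mul_of_nonneg_right (hC0 _ (hnR n w)) (norm_nonneg _)
    · filter_upwards [hcont hβc fun m hm => (hβ m hm).continuousAt] with w hw using hw.mul_const _
  have hint : ∀ {F : ℂ → ℂ}, Integrable F → Function.support F ⊆ tsupport (fun w => (χ w : ℂ)) →
      ∀ n, Integrable (moll n F) := fun {F} hF hs n =>
    (contDiff_moll hF.locallyIntegrable n).continuous.integrable_of_hasCompactSupport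
      (hasCompactSupport_moll (hχ.compact.mono' hs) n)
  have hsA : Function.support A ⊆ tsupport (fun w => (χ w : ℂ)) := fun w hw => by
    by_contra hn
    refine hw ?_
    have h1 : (χ w : ℂ) = 0 :=
      image_eq_zero_of_notMem_tsupport (f := fun w => (χ w : ℂ)) hn
    have h2 : wirt (fun w => (χ w : ℂ)) w = 0 := image_eq_zero_of_notMem_tsupport
      fun hh => hn (tsupport_wirt_subset _ hh)
    simp only [hA, h2, h1]; simp
  have hsB : Function.support B ⊆ tsupport (fun w => (χ w : ℂ)) := fun w hw => by
    by_contra hn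
    refine hw ?_
    have h1 : (χ w : ℂ) = 0 :=
      image_eq_zero_of_notMem_tsupport (f := fun w => (χ w : ℂ)) hn
    have h2 : wirtBar (fun w => (χ w : ℂ)) w = 0 := image_eq_zero_of_notMem_tsupport
      fun hh => hn (tsupport_wirtBar_subset _ hh)
    simp only [hB, h2, h1]; simp
  have hR1 : Tendsto (fun n => ∫ w, (wirt β (moll n v w) * φ w) * moll n B w) atTop
      (𝓝 (∫ w, (wirt β (v w) * φ w) * B w)) := by
    refine tendsto_integral_mul_of_bounded (M := C1 * Cφ) ?_ (fun n =>
      ((hPc.comp_continuous (hcn n) (hnR n)).mul hφ.continuous).aestronglyMeasurable)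
      (fun n => Eventually.of_forall fun w => ?_) (hint Bi hsB) Bi
      (tendsto_eLpNorm_moll le_rfl ENNReal.one_ne_top (memLp_one_iff_integrable.2 Bi))
    · filter_upwards [hcont hPc hPat] with w hw using hw.mul_const _
    · rw [norm_mul]
      have := hC1 _ (hnR n w)
      exact mul_le_mul this (hCφ w) (norm_nonneg _) ((norm_nonneg _).trans this)
  have hR2 : Tendsto (fun n => ∫ w, (wirtBar β (moll n v w) * φ w) * conj (moll n A w)) atTop
      (𝓝 (∫ w, (wirtBar β (v w) * φ w) * conj (A w))) := by
    have hnorm : ∀ n, eLpNorm (fun z => conj (moll n A z) - conj (A z)) 1 volume =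
        eLpNorm (fun z => moll n A z - A z) 1 volume := fun n =>
      eLpNorm_congr_norm_ae (Eventually.of_forall fun z => by
        rw [← map_sub, Complex.norm_conj])
    refine tendsto_integral_mul_of_bounded (M := C2 * Cφ) ?_ (fun n =>
      ((hQc.comp_continuous (hcn n) (hnR n)).mul hφ.continuous).aestronglyMeasurable)
      (fun n => Eventually.of_forall fun w => ?_)
      (fun n => memLp_one_iff_integrable.1 (memLp_one_iff_integrable.2 (hint Ai hsA n)).star)
      (memLp_one_iff_integrable.1 (memLp_one_iff_integrable.2 Ai).star) ?_
    · filter_upwards [hcont hQc hQat] with w hw using hw.mul_const _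
    · rw [norm_mul]
      have := hC2 _ (hnR n w)
      exact mul_le_mul this (hCφ w) (norm_nonneg _) ((norm_nonneg _).trans this)
    · exact (tendsto_eLpNorm_moll le_rfl ENNReal.one_ne_top
        (memLp_one_iff_integrable.2 Ai)).congr fun n => (hnorm n).symm
  have hfin := tendsto_nhds_unique (hL.congr hid) (hR1.add hR2).neg
  have hkey : ∀ w, φ w ≠ 0 → v w = u w ∧ A w = a w ∧ B w = b w := fun w hw => by
    have hwV : w ∈ V := hKV (subset_tsupport _ hw)
    simp [hv, hA, hB, hχV w hwV, wirt_eq_zero_of_fderiv (hχd w hwV),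
      wirtBar_eq_zero_of_fderiv (hχd w hwV)]
  have hkey' : ∀ w, wirtBar φ w ≠ 0 → v w = u w := fun w hw => by
    have hwV : w ∈ V := hKV (tsupport_wirtBar_subset _ (subset_tsupport _ hw))
    simp [hv, hχV w hwV]
  have e1 : ∫ w, β (v w) * wirtBar φ w = ∫ w, β (u w) * wirtBar φ w := by
    congr 1; ext w
    by_cases hw : wirtBar φ w = 0
    · simp [hw]
    · rw [hkey' w hw]
  have i1 := ((memLpLoc_top_comp hum hR hPc).mul (r := 1) h.memLpLoc_wirtBar).integrable_mul_test hφ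
  have i2 := ((memLpLoc_top_comp hum hR hQc).mul (r := 1) h.memLpLoc_wirt.star).integrable_mul_test hφ
  rw [← e1, hfin]
  congr 1
  have e2 : ∫ w, (wirt β (v w) * φ w) * B w = ∫ w, wirt β (u w) * b w * φ w := by
    congr 1; ext w
    by_cases hw : φ w = 0
    · simp [hw]
    · obtain ⟨h1, h2, h3⟩ := hkey w hw
      rw [h1, h3]; ring
  have e3 : ∫ w, (wirtBar β (v w) * φ w) * conj (A w) =
      ∫ w, wirtBar β (u w) * conj (a w) * φ w := by
    congr 1; ext w
    by_cases hw : φ w = 0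
    · simp [hw]
    · obtain ⟨h1, h2, h3⟩ := hkey w hw
      rw [h1, h2]; ring
  rw [e2, e3, ← integral_add i1 i2]
  congr 1; ext w; ring

/-- The chain rule for a bounded Sobolev function. -/
theorem HasWeakWirt.comp (hU : IsOpen U) (h : HasWeakWirt U u a b) (hR0 : 0 ≤ R)
    (hR : ∀ᵐ w ∂volume.restrict U, ‖u w‖ ≤ R)
    (hβ : ∀ m ∈ Metric.closedBall 0 R, ContDiffAt ℝ 1 β m) :
    HasWeakWirt U (fun w => β (u w))
      (fun w => wirt β (u w) * a w + wirtBar β (u w) * conj (b w))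
      (fun w => wirt β (u w) * b w + wirtBar β (u w) * conj (a w)) := by
  refine hasWeakWirt_iff.2 ⟨h.bar_comp hU hR0 hR hβ, ?_⟩
  refine (h.bar_comp hU hR0 hR (β := fun m => conj (β m)) fun m hm =>
    Complex.conjCLE.contDiff.contDiffAt.comp m (hβ m hm)).congr hU (ae_eq_refl _) ?_
  filter_upwards [hR] with w hw
  have := ((hβ (u w) (by simpa using hw)).differentiableAt (by simp)).hasFDerivAt_wirtL.wirtL_conj
  rw [this.wirt_eq, this.wirtBar_eq]
  simp
  ring

/-- The chain rule for a locally bounded Sobolev function. -/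
theorem HasWeakWirt.comp_contDiff (h : HasWeakWirt U u a b) (hU : IsOpen U)
    (hb : MemLpLoc ⊤ U u) (hβ : ContDiff ℝ 1 β) :
    HasWeakWirt U (fun w => β (u w))
      (fun w => wirt β (u w) * a w + wirtBar β (u w) * conj (b w))
      (fun w => wirt β (u w) * b w + wirtBar β (u w) * conj (a w)) := by
  refine .of_local fun K hK hKU => ?_
  obtain ⟨L, hL, hKL, hLU⟩ := exists_compact_between hK hU hKU
  refine ⟨interior L, hKL, (h.mono (interior_subset.trans hLU)).comp isOpen_interior
    (R := (eLpNorm u ⊤ (volume.restrict L)).toReal) ENNReal.toReal_nonneg ?_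
    fun m _ => hβ.contDiffAt⟩
  have hm := hb L hLU hL
  refine ae_restrict_of_ae_restrict_of_subset interior_subset ?_
  filter_upwards [ae_le_eLpNormEssSup (f := u) (μ := volume.restrict L)] with w hw
  rw [← eLpNorm_exponent_top, ← ofReal_norm, ] at hw
  exact (ENNReal.ofReal_le_iff_le_toReal hm.2.ne).1 hw

theorem HasWeakWirt.sq (h : HasWeakWirt U u a b) (hU : IsOpen U) (hb : MemLpLoc ⊤ U u) :
    HasWeakWirt U (fun w => u w * u w) (fun w => 2 * u w * a w) (fun w => 2 * u w * b w) := by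
  have hd : ∀ m : ℂ, HasFDerivAt (fun m : ℂ => m * m) (wirtL (2 * m) 0) m := fun m => by
    have := (hasFDerivAt_wirtL_id m).wirtL_mul (hasFDerivAt_wirtL_id m)
    convert this using 2 <;> ring
  have := h.comp_contDiff hU hb (β := fun m => m * m) (contDiff_id.mul contDiff_id)
  simpa [(hd _).wirt_eq, (hd _).wirtBar_eq] using this

/-- The product rule for locally bounded Sobolev functions. -/
theorem HasWeakWirt.mul {v a' b' : ℂ → ℂ} (h : HasWeakWirt U u a b) (h' : HasWeakWirt U v a' b')
    (hU : IsOpen U) (hu : MemLpLoc ⊤ U u) (hv : MemLpLoc ⊤ U v) :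
    HasWeakWirt U (fun w => u w * v w) (fun w => a w * v w + u w * a' w)
      (fun w => b w * v w + u w * b' w) := by
  have h1 := ((h.add h').sq hU (hu.add hv)).const_mul 4⁻¹
  have h2 := ((h.add (h'.const_mul (-1))).sq hU (hu.add (hv.const_mul (-1)))).const_mul (-4⁻¹)
  refine (h1.add h2).congr hU ?_ ?_ ?_ <;> refine Eventually.of_forall fun w => ?_ <;>
    simp only [] <;> ring

end Chain

/-- A continuous function on the plane which has weak derivatives in `L²` and vanishes, together
with these derivatives, off a compact subset of `U`. -/
structure CompactSobolev (U : Set ℂ) (θ a b : ℂ → ℂ) : Prop where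
  continuous : Continuous θ
  weak : HasWeakWirt univ θ a b
  memLp_wirt : MemLp a 2
  memLp_wirtBar : MemLp b 2
  exists_compact : ∃ K, IsCompact K ∧ K ⊆ U ∧ ∀ w, w ∉ K → θ w = 0 ∧ a w = 0 ∧ b w = 0

theorem CompactSobolev.of_weak {U K : Set ℂ} {θ a b : ℂ → ℂ} (hU : IsOpen U)
    (hw : HasWeakWirt U θ a b) (hθ : ContinuousOn θ U) (ha : MemLpLoc 2 U a) (hb : MemLpLoc 2 U b)
    (hK : IsCompact K) (hKU : K ⊆ U) (h0 : ∀ w, w ∉ K → θ w = 0 ∧ a w = 0 ∧ b w = 0) :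
    CompactSobolev U θ a b := by
  obtain ⟨χ, hχ, -, -, V, hV, hKV, hVU, hχV⟩ := exists_cutoff hK hU hKU
  have hχd : ∀ w ∈ V, fderiv ℝ (fun w => (χ w : ℂ)) w = 0 := fun w hw => by
    have : (fun w => (χ w : ℂ)) =ᶠ[𝓝 w] fun _ => 1 := by
      filter_upwards [hV.mem_nhds hw] with x hx
      rw [hχV x hx]; simp
    rw [this.fderiv_eq, fderiv_const_apply]
  have hmem : ∀ {f : ℂ → ℂ}, MemLpLoc 2 U f → (∀ w, w ∉ K → f w = 0) → MemLp f 2 :=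
    fun {f} hf h0 => by
      have : f = K.indicator f := by
        ext w
        by_cases h : w ∈ K
        · simp [h]
        · simp [h, h0 w h]
      rw [this, memLp_indicator_iff_restrict hK.measurableSet]
      exact hf K hKU hK
  refine ⟨continuous_iff_continuousAt.2 fun w => ?_, ?_, hmem ha fun w h => (h0 w h).2.1,
    hmem hb fun w h => (h0 w h).2.2, K, hK, hKU, h0⟩
  · by_cases h : w ∈ U
    · exact (hθ w h).continuousAt (hU.mem_nhds h)
    · have : θ =ᶠ[𝓝 w] fun _ => 0 := by
        filter_upwards [hK.isClosed.isOpen_compl.mem_nhds fun hh => h (hKU hh)] with x hx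
        exact (h0 x hx).1
      exact continuousAt_const.congr this.symm
  · convert hw.cutoff hχ using 1
    · ext w
      by_cases h : w ∈ K
      · simp [hχV w (hKV h)]
      · simp [(h0 w h).1]
    · ext w
      by_cases h : w ∈ K
      · simp [hχV w (hKV h), wirt_eq_zero_of_fderiv (hχd w (hKV h))]
      · simp [h0 w h]
    · ext w
      by_cases h : w ∈ K
      · simp [hχV w (hKV h), wirtBar_eq_zero_of_fderiv (hχd w (hKV h))]
      · simp [h0 w h]

/-- A weak first order equation may be tested with compactly supported Sobolev functions. -/
theorem CompactSobolev.integral_eq_zero {U : Set ℂ} (hU : IsOpen U) {P Q H θ a b : ℂ → ℂ}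
    (hP : MemLpLoc 2 U P) (hQ : MemLpLoc 2 U Q) (hH : MemLpLoc 1 U H)
    (h : ∀ φ, IsTest U φ → ∫ w, (P w * wirt φ w + Q w * wirtBar φ w + H w * φ w) = 0)
    (hθ : CompactSobolev U θ a b) : ∫ w, (P w * a w + Q w * b w + H w * θ w) = 0 := by
  obtain ⟨K, hK, hKU, h0⟩ := hθ.exists_compact
  obtain ⟨χ, hχ, -, -, V, hV, hKV, hVU, hχV⟩ := exists_cutoff hK hU hKU
  have hχd : ∀ w ∈ V, fderiv ℝ (fun w => (χ w : ℂ)) w = 0 := fun w hw => by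
    have : (fun w => (χ w : ℂ)) =ᶠ[𝓝 w] fun _ => 1 := by
      filter_upwards [hV.mem_nhds hw] with x hx
      rw [hχV x hx]; simp
    rw [this.fderiv_eq, fderiv_const_apply]
  have m2 : ∀ {f : ℂ → ℂ}, MemLpLoc 2 U f → MemLp (fun w => f w * χ w) 2 := fun {f} hf => by
    have e : (fun w => f w * χ w) =
        (tsupport (fun w => (χ w : ℂ))).indicator (fun w => f w * χ w) := by
      ext w
      by_cases h : w ∈ tsupport (fun w => (χ w : ℂ))
      · simp [h]
      · have h1 : (χ w : ℂ) = 0 :=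
          image_eq_zero_of_notMem_tsupport (f := fun w => (χ w : ℂ)) h
        rw [indicator_of_notMem h, h1, mul_zero]
    rw [e, memLp_indicator_iff_restrict (isClosed_tsupport _).measurableSet]
    have : MemLpLoc 2 U (fun w => f w * χ w) :=
      hf.mul (q := ⊤) (.of_continuousOn hχ.continuous.continuousOn)
    exact this _ hχ.subset hχ.compact
  have hθc : HasCompactSupport θ := HasCompactSupport.of_support_subset_isCompact hK fun w hw => by
    by_contra hn
    exact hw (h0 w hn).1
  have hθi : Integrable θ := hθ.continuous.integrable_of_hasCompactSupport hθc
  have hac : HasCompactSupport a := HasCompactSupport.of_support_subset_isCompact hK fun w hw => by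
    by_contra hn
    exact hw (h0 w hn).2.1
  have hbc : HasCompactSupport b := HasCompactSupport.of_support_subset_isCompact hK fun w hw => by
    by_contra hn
    exact hw (h0 w hn).2.2
  have hal : LocallyIntegrable a := hθ.memLp_wirt.locallyIntegrable (by norm_num)
  have hbl : LocallyIntegrable b := hθ.memLp_wirtBar.locallyIntegrable (by norm_num)
  have mm : ∀ {f : ℂ → ℂ} (q : ℝ≥0∞), LocallyIntegrable f → HasCompactSupport f → ∀ n,
      MemLp (moll n f) q := fun q hf hc n =>
    (contDiff_moll hf n).continuous.memLp_of_hasCompactSupport (hasCompactSupport_moll hc n)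
  have hP1 := hP.mono_exponent (p := 1) (by norm_num)
  have hQ1 := hQ.mono_exponent (p := 1) (by norm_num)
  set S : ℂ → ℂ := fun w => P w * wirt (fun w => (χ w : ℂ)) w +
    Q w * wirtBar (fun w => (χ w : ℂ)) w + H w * χ w with hS
  have hSi : Integrable S := ((hP1.integrable_mul_test hχ.wirt).add
    (hQ1.integrable_mul_test hχ.wirtBar)).add (hH.integrable_mul_test hχ)
  have t1 := tendsto_integral_mul_of_eLpNorm (m2 hP) (mm 2 hal hac) hθ.memLp_wirt
    (tendsto_eLpNorm_moll (by norm_num) (by simp) hθ.memLp_wirt)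
  have t2 := tendsto_integral_mul_of_eLpNorm (m2 hQ) (mm 2 hbl hbc) hθ.memLp_wirtBar
    (tendsto_eLpNorm_moll (by norm_num) (by simp) hθ.memLp_wirtBar)
  have t3 : Tendsto (fun n => ∫ w, S w * moll n θ w) atTop (𝓝 (∫ w, S w * θ w)) := by
    refine tendsto_integral_mul_of_eLpNorm (p := 1) (q := ⊤) (memLp_one_iff_integrable.2 hSi)
      (mm ⊤ hθi.locallyIntegrable hθc) (hθ.continuous.memLp_of_hasCompactSupport hθc) ?_
    rw [ENNReal.tendsto_nhds_zero]
    intro ε hε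
    obtain ⟨δ, hδ, hδε⟩ : ∃ δ : ℝ, 0 < δ ∧ ENNReal.ofReal δ ≤ ε := by
      rcases eq_or_ne ε ⊤ with rfl | h
      · exact ⟨1, one_pos, le_top⟩
      · exact ⟨ε.toReal, ENNReal.toReal_pos hε.ne' h, ENNReal.ofReal_toReal_le⟩
    filter_upwards [Metric.tendstoUniformly_iff.1 (tendstoUniformly_moll hθ.continuous hθc) δ hδ]
      with n hn
    rw [eLpNorm_exponent_top]
    refine le_trans (eLpNormEssSup_le_of_ae_bound (C := δ) (Eventually.of_forall fun w => ?_)) hδε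
    have := hn w
    rw [dist_comm, dist_eq_norm] at this
    exact this.le
  have hid : ∀ n, (∫ w, P w * χ w * moll n a w) + (∫ w, Q w * χ w * moll n b w) +
      ∫ w, S w * moll n θ w = 0 := fun n => by
    have hm : ContDiff ℝ ∞ (moll n θ) := contDiff_moll hθi.locallyIntegrable n
    have ht : IsTest U (fun w => moll n θ w * χ w) := hχ.mul_left hm
    have hder : ∀ w, HasFDerivAt (fun w => moll n θ w * χ w) (wirtL
        (moll n a w * χ w + moll n θ w * wirt (fun w => (χ w : ℂ)) w)
        (moll n b w * χ w + moll n θ w * wirtBar (fun w => (χ w : ℂ)) w)) w := fun w => by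
      have := (hm.differentiable (by simp) w).hasFDerivAt_wirtL.wirtL_mul (hχ.hasFDerivAt w)
      rwa [wirt_moll hθ.weak, wirtBar_moll hθ.weak.bar] at this
    have hS' : Integrable (fun w => S w * moll n θ w) :=
      memLp_one_iff_integrable.1 ((mm ⊤ hθi.locallyIntegrable hθc n).mul'
        (memLp_one_iff_integrable.2 hSi))
    have hPi : Integrable (fun w => P w * χ w * moll n a w) :=
      memLp_one_iff_integrable.1 ((mm 2 hal hac n).mul' (m2 hP))
    have hQi : Integrable (fun w => Q w * χ w * moll n b w) :=
      memLp_one_iff_integrable.1 ((mm 2 hbl hbc n).mul' (m2 hQ))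
    rw [← integral_add₃ hPi hQi hS', ← h _ ht]
    congr 1; ext w
    simp only [(hder w).wirt_eq, (hder w).wirtBar_eq, hS]
    ring
  have hlim := tendsto_nhds_unique ((t1.add t2).add t3)
    ((tendsto_const_nhds (x := (0 : ℂ))).congr fun n => (hid n).symm)
  have hPi : Integrable (fun w => P w * χ w * a w) :=
    memLp_one_iff_integrable.1 (hθ.memLp_wirt.mul' (m2 hP))
  have hQi : Integrable (fun w => Q w * χ w * b w) :=
    memLp_one_iff_integrable.1 (hθ.memLp_wirtBar.mul' (m2 hQ))
  have hS' : Integrable (fun w => S w * θ w) :=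
    memLp_one_iff_integrable.1 ((hθ.continuous.memLp_of_hasCompactSupport (p := ⊤) hθc).mul'
      (memLp_one_iff_integrable.2 hSi))
  rw [← integral_add₃ hPi hQi hS'] at hlim
  rw [← hlim]
  congr 1; ext w
  by_cases hw : w ∈ K
  · simp [hS, hχV w (hKV hw), wirt_eq_zero_of_fderiv (hχd w (hKV hw)),
      wirtBar_eq_zero_of_fderiv (hχd w (hKV hw))]
  · obtain ⟨h1, h2, h3⟩ := h0 w hw
    simp [h1, h2, h3]

/-- The integral of a Jacobian vanishes if one of the functions has compact support. -/
theorem CompactSobolev.integral_jacobian {U : Set ℂ} (hU : IsOpen U) {θ a b v c d : ℂ → ℂ}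
    (hθ : CompactSobolev U θ a b) (hv : HasWeakWirt U v c d) (hc : MemLpLoc 2 U c)
    (hd : MemLpLoc 2 U d) : ∫ w, (a w * d w - b w * c w) = 0 := by
  have := hθ.integral_eq_zero hU hd hc.neg (H := 0) (.of_continuousOn continuousOn_const)
    fun φ hφ => by
      have h1 := hv.bar.integral_bar _ hφ.wirt
      have h2 := hv.integral_wirt _ hφ.wirtBar.contDiff hφ.wirtBar.compact hφ.wirtBar.subset
      have i1 := hv.memLpLoc_wirtBar.integrable_mul_test hφ.wirt
      have i2 := hv.memLpLoc_wirt.integrable_mul_test hφ.wirtBar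
      have e : ∀ w, wirtBar (wirt φ) w = wirt (wirtBar φ) w := fun w =>
        wirtBar_wirt_comm isOpen_univ (contDiff_infty.1 hφ.contDiff 2).contDiffOn (mem_univ w)
      simp_rw [e] at h1
      have : ∫ w, (d w * wirt φ w - c w * wirtBar φ w) = 0 := by
        rw [integral_sub i1 i2, ← neg_eq_iff_eq_neg.2 h1, ← neg_eq_iff_eq_neg.2 h2, sub_self]
      rw [← this]
      congr 1; ext w; simp; ring
  rw [← this]
  congr 1; ext w; simp; ring
end

noncomputable section

open MeasureTheory Set Filter Topology
open scoped ContDiff ComplexConjugate ENNReal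

theorem IsTest.comp_sub {a : ℂ} {r : ℝ} {φ : ℂ → ℂ} (hφ : IsTest (Metric.ball a r) φ) (t : ℂ) :
    IsTest (Metric.ball (a + t) r) (fun x => φ (x - t)) := by
  have hs : tsupport (fun x => φ (x - t)) ⊆ (fun x => x - t) ⁻¹' tsupport φ :=
    closure_minimal (fun x hx => subset_tsupport φ hx)
      ((isClosed_tsupport φ).preimage (continuous_id.sub continuous_const))
  refine ⟨hφ.contDiff.comp (contDiff_id.sub contDiff_const),
    hφ.compact.comp_homeomorph (Homeomorph.subRight t), fun x hx => ?_⟩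
  have := hφ.subset (hs hx)
  rw [Metric.mem_ball, dist_eq_norm] at this ⊢
  convert this using 2
  ring

theorem wirt_comp_sub (φ : ℂ → ℂ) (t x : ℂ) : wirt (fun y => φ (y - t)) x = wirt φ (x - t) := by
  simp only [wirt, fderiv_comp_sub]

theorem wirtBar_comp_sub (φ : ℂ → ℂ) (t x : ℂ) :
    wirtBar (fun y => φ (y - t)) x = wirtBar φ (x - t) := by
  simp only [wirtBar, fderiv_comp_sub]

/-- If `d ν` has vanishing distributional gradient, its integrals against the translates of a
test function do not depend on the translation. -/
theorem integral_comp_sub_const {ν : Measure ℂ} {d : ℂ → ℂ} (hd : Integrable d ν) {z₀ a : ℂ} {r : ℝ}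
    (h : ∀ φ, IsTest (Metric.ball z₀ (2 * r)) φ →
      ∫ x, d x * wirt φ x ∂ν = 0 ∧ ∫ x, d x * wirtBar φ x ∂ν = 0)
    {φ : ℂ → ℂ} (hφ : IsTest (Metric.ball a r) φ) {s t : ℂ} (hs : s ∈ Metric.ball (z₀ - a) r)
    (ht : t ∈ Metric.ball (z₀ - a) r) :
    ∫ x, d x * φ (x - s) ∂ν = ∫ x, d x * φ (x - t) ∂ν := by
  have hcf : Continuous (fderiv ℝ φ) := hφ.contDiff.continuous_fderiv (by simp)
  obtain ⟨C, hC⟩ := hcf.bounded_above_of_compact_support (hφ.compact.fderiv ℝ)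
  obtain ⟨C0, hC0⟩ := hφ.continuous.bounded_above_of_compact_support hφ.compact
  have hint : ∀ {ψ : ℂ → ℂ}, IsTest univ ψ → Integrable (fun x => d x * ψ x) ν := fun {ψ} hψ => by
    obtain ⟨C1, hC1⟩ := hψ.continuous.bounded_above_of_compact_support hψ.compact
    exact hd.mul_bdd hψ.continuous.aestronglyMeasurable (Eventually.of_forall hC1)
  have hm : ∀ t, AEStronglyMeasurable (fun x => d x • (-fderiv ℝ φ (x - t))) ν := fun t =>
    hd.1.smul (hcf.comp (continuous_id.sub continuous_const)).neg.aestronglyMeasurable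
  have hder : ∀ t, HasFDerivAt (fun t => ∫ x, d x * φ (x - t) ∂ν)
      (∫ x, d x • (-fderiv ℝ φ (x - t)) ∂ν) t := fun t => by
    refine hasFDerivAt_integral_of_dominated_of_fderiv_le (s := univ)
      (F' := fun t x => d x • (-fderiv ℝ φ (x - t)))
      (bound := fun x => ‖d x‖ * C) univ_mem
      (Eventually.of_forall fun t => hd.1.mul (hφ.continuous.comp
        (continuous_id.sub continuous_const)).aestronglyMeasurable)
      (hint ((hφ.comp_sub t).mono (subset_univ _)))
      (hm t) (Eventually.of_forall fun x t _ => ?_) (hd.norm.mul_const C)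
      (Eventually.of_forall fun x t _ => ?_)
    · rw [norm_smul, norm_neg]
      exact mul_le_mul_of_nonneg_left (hC _) (norm_nonneg _)
    · have h1 : HasFDerivAt (fun t : ℂ => x - t) (-ContinuousLinearMap.id ℝ ℂ) t :=
        (hasFDerivAt_id t).const_sub x
      have h2 := ((hφ.differentiable (x - t)).hasFDerivAt.comp t h1).const_mul (d x)
      refine h2.congr_fderiv (ContinuousLinearMap.ext fun v => ?_)
      simp
  refine Metric.isOpen_ball.is_const_of_fderiv_eq_zero
    (f := fun t => ∫ x, d x * φ (x - t) ∂ν) (convex_ball _ _).isPreconnected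
    (fun t _ => (hder t).differentiableAt.differentiableWithinAt) (fun t ht => ?_) hs ht
  rw [(hder t).fderiv]
  refine ContinuousLinearMap.ext fun v => ?_
  have hti : IsTest (Metric.ball z₀ (2 * r)) (fun x => φ (x - t)) := by
    refine (hφ.comp_sub t).mono fun x hx => ?_
    rw [Metric.mem_ball, dist_eq_norm] at hx ht ⊢
    calc ‖x - z₀‖ = ‖(x - (a + t)) + (t - (z₀ - a))‖ := by congr 1; ring
      _ ≤ _ := norm_add_le _ _
      _ < 2 * r := by linarith
  have hsm : Integrable (fun x => d x • (-fderiv ℝ φ (x - t))) ν := by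
    refine (hd.norm.mul_const C).mono' (hm t) (Eventually.of_forall fun x => ?_)
    rw [norm_smul, norm_neg]
    exact mul_le_mul_of_nonneg_left (hC _) (norm_nonneg _)
  rw [ContinuousLinearMap.integral_apply hsm]
  have e : ∀ x, (d x • (-fderiv ℝ φ (x - t))) v =
      (-v) * (d x * wirt (fun y => φ (y - t)) x) +
        (-conj v) * (d x * wirtBar (fun y => φ (y - t)) x) := fun x => by
    simp only [smul_apply, neg_apply, fderiv_apply_wirt,
      wirt_comp_sub, wirtBar_comp_sub, smul_eq_mul]
    ring
  simp_rw [e]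
  rw [integral_add ((hint (hti.wirt.mono (subset_univ _))).const_mul _)
    ((hint (hti.wirtBar.mono (subset_univ _))).const_mul _), integral_const_mul,
    integral_const_mul, (h _ hti).1, (h _ hti).2]
  simp

theorem isTest_ofReal_normed {r : ℝ} (κ : ContDiffBump (0 : ℂ)) (hκ : κ.rOut < r) :
    IsTest (Metric.ball 0 r) (fun x => (κ.normed volume x : ℂ)) := by
  have hs : tsupport (fun x => (κ.normed volume x : ℂ)) ⊆ tsupport (κ.normed volume) :=
    closure_mono fun z hz => by simpa using hz
  refine ⟨Complex.ofRealCLM.contDiff.comp κ.contDiff_normed,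
    (κ.hasCompactSupport_normed (μ := volume)).mono' ((subset_tsupport _).trans hs),
    hs.trans ?_⟩
  rw [κ.tsupport_normed_eq]
  exact Metric.closedBall_subset_ball hκ

/-- A finite measure with vanishing distributional gradient is locally a multiple of Lebesgue
measure. -/
theorem exists_eq_smul_volume_of_gradient_zero {ν : Measure ℂ} [IsFiniteMeasure ν] {z₀ : ℂ} {r : ℝ}
    (hr : 0 < r) (h : ∀ φ, IsTest (Metric.ball z₀ (2 * r)) φ →
      ∫ x, wirt φ x ∂ν = 0 ∧ ∫ x, wirtBar φ x ∂ν = 0) :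
    ∃ c : ℝ, 0 ≤ c ∧ ν.restrict (Metric.ball z₀ r) =
      ENNReal.ofReal c • volume.restrict (Metric.ball z₀ r) := by
  let κ : ContDiffBump (0 : ℂ) := ⟨r / 4, r / 2, by positivity, by linarith⟩
  have hκ : IsTest (Metric.ball 0 r) (fun x => (κ.normed volume x : ℂ)) :=
    isTest_ofReal_normed κ (by change r / 2 < r; linarith)
  set k : ℂ → ℂ := fun x => (κ.normed volume x : ℂ) with hk
  have hone : Integrable (fun _ : ℂ => (1 : ℂ)) ν := integrable_const 1
  have h' : ∀ φ, IsTest (Metric.ball z₀ (2 * r)) φ →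
      ∫ x, (1 : ℂ) * wirt φ x ∂ν = 0 ∧ ∫ x, (1 : ℂ) * wirtBar φ x ∂ν = 0 := by simpa using h
  have hk1 : ∫ x, k x = 1 := by
    simp only [hk]
    rw [integral_complex_ofReal, κ.integral_normed, Complex.ofReal_one]
  set c : ℝ := ∫ x, κ.normed volume (x - z₀) ∂ν with hc
  have hn : ∀ t ∈ Metric.ball z₀ r, ∫ x, k (x - t) ∂ν = c := fun t ht => by
    have := integral_comp_sub_const hone h' hκ (s := t) (t := z₀) (by simpa using ht)
      (by simpa using hr)
    simp only [one_mul] at this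
    rw [this, hc, ← integral_complex_ofReal]
  obtain ⟨Ck, hCk⟩ := hκ.continuous.bounded_above_of_compact_support hκ.compact
  have key : ∀ η, IsTest (Metric.ball z₀ r) η → ∫ x, η x ∂ν = c * ∫ x, η x := fun η hη => by
    obtain ⟨Ce, hCe⟩ := hη.continuous.bounded_above_of_compact_support hη.compact
    have hηi : Integrable η := hη.continuous.integrable_of_hasCompactSupport hη.compact
    have hki : Integrable k := hκ.continuous.integrable_of_hasCompactSupport hκ.compact
    have hm : ∀ s ∈ Metric.ball (0 : ℂ) r, ∫ x, η (x - s) ∂ν = ∫ x, η x ∂ν := fun s hs => by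
      have := integral_comp_sub_const hone h' hη (s := s) (t := 0) (by simpa using hs)
        (by simpa using hr)
      simpa using this
    have f1 : Integrable (Function.uncurry fun t x => η t * k (x - t)) (volume.prod ν) := by
      have := (hηi.comp_fst ν).mul_bdd (c := Ck) (g := fun p : ℂ × ℂ => k (p.2 - p.1))
        (hκ.continuous.comp (continuous_snd.sub continuous_fst)).aestronglyMeasurable
        (Eventually.of_forall fun p => hCk _)
      exact this
    have f2 : Integrable (Function.uncurry fun s x => k s * η (x - s)) (volume.prod ν) := by
      have := (hki.comp_fst ν).mul_bdd (c := Ce) (g := fun p : ℂ × ℂ => η (p.2 - p.1))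
        (hη.continuous.comp (continuous_snd.sub continuous_fst)).aestronglyMeasurable
        (Eventually.of_forall fun p => hCe _)
      exact this
    have e1 : ∫ t, ∫ x, η t * k (x - t) ∂ν = c * ∫ x, η x := by
      rw [← integral_const_mul]
      congr 1; ext t
      rw [integral_const_mul]
      by_cases ht : t ∈ Metric.ball z₀ r
      · rw [hn t ht]; ring
      · rw [hη.eq_zero ht]; simp
    have e2 : ∫ s, ∫ x, k s * η (x - s) ∂ν = ∫ x, η x ∂ν := by
      have : ∀ s, ∫ x, k s * η (x - s) ∂ν = k s * ∫ x, η x ∂ν := fun s => by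
        rw [integral_const_mul]
        by_cases hs : s ∈ Metric.ball (0 : ℂ) r
        · rw [hm s hs]
        · rw [hκ.eq_zero hs]; simp
      simp_rw [this]
      rw [integral_mul_const, hk1, one_mul]
    rw [← e1, ← e2, integral_integral_swap f1, integral_integral_swap f2]
    congr 1; ext x
    rw [← integral_sub_left_eq_self (fun s => k s * η (x - s)) volume x]
    congr 1; ext t
    rw [sub_sub_cancel]; ring
  refine ⟨c, integral_nonneg fun x => κ.nonneg_normed _, ?_⟩
  set V := (volume.restrict (Metric.ball z₀ r) : Measure ℂ) with hV
  have : IsFiniteMeasure V := ⟨by rw [hV, Measure.restrict_apply_univ]; exact measure_ball_lt_top⟩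
  set N := ν.restrict (Metric.ball z₀ r) with hN
  set σ := N + V with hσ
  have hNσ : N ≪ σ := Measure.AbsolutelyContinuous.rfl.add_right V
  have hVσ : V ≪ σ := by rw [hσ, add_comm]; exact Measure.AbsolutelyContinuous.rfl.add_right N
  set f : ℂ → ℝ := fun x => (N.rnDeriv σ x).toReal - c * (V.rnDeriv σ x).toReal with hf
  have i1 : Integrable (fun x => (N.rnDeriv σ x).toReal) σ := Measure.integrable_toReal_rnDeriv
  have i2 : Integrable (fun x => (V.rnDeriv σ x).toReal) σ := Measure.integrable_toReal_rnDeriv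
  have hfi : Integrable f σ := i1.sub (i2.const_mul c)
  have hz := Metric.isOpen_ball.ae_eq_zero_of_integral_contDiff_smul_eq_zero (U := Metric.ball z₀ r)
    (f := f) (μ := σ) (hfi.locallyIntegrable.locallyIntegrableOn _) fun g hg hgc hgs => by
      obtain ⟨Cg, hCg⟩ := hg.continuous.bounded_above_of_compact_support hgc
      have hts : tsupport (fun x => (g x : ℂ)) ⊆ tsupport g :=
        closure_mono fun z hz => by simpa using hz
      have hgt : IsTest (Metric.ball z₀ r) (fun x => (g x : ℂ)) :=
        ⟨Complex.ofRealCLM.contDiff.comp hg, hgc.mono' ((subset_tsupport _).trans hts),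
          hts.trans hgs⟩
      have hk := key _ hgt
      rw [integral_complex_ofReal, integral_complex_ofReal, ← Complex.ofReal_mul, Complex.ofReal_inj] at hk
      have hg0 : ∀ x, x ∉ Metric.ball z₀ r → g x = 0 := fun x hx =>
        image_eq_zero_of_notMem_tsupport fun hh => hx (hgs hh)
      have e1 : ∫ x, (N.rnDeriv σ x).toReal • g x ∂σ = ∫ x, g x ∂ν := by
        rw [integral_rnDeriv_smul hNσ, hN, setIntegral_eq_integral_of_forall_compl_eq_zero hg0]
      have e2 : ∫ x, (V.rnDeriv σ x).toReal • g x ∂σ = ∫ x, g x := by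
        rw [integral_rnDeriv_smul hVσ, hV, setIntegral_eq_integral_of_forall_compl_eq_zero hg0]
      have j1 : Integrable (fun x => (N.rnDeriv σ x).toReal • g x) σ :=
        i1.mul_bdd hg.continuous.aestronglyMeasurable (Eventually.of_forall hCg)
      have j2 : Integrable (fun x => (V.rnDeriv σ x).toReal • g x) σ :=
        i2.mul_bdd hg.continuous.aestronglyMeasurable (Eventually.of_forall hCg)
      calc ∫ x, g x • f x ∂σ = ∫ x, ((N.rnDeriv σ x).toReal • g x -
            c * ((V.rnDeriv σ x).toReal • g x)) ∂σ := by
            congr 1; ext x; simp only [hf, smul_eq_mul]; ring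
        _ = 0 := by rw [integral_sub j1 (j2.const_mul c), integral_const_mul, e1, e2, hk, sub_self]
  have hσB : σ (Metric.ball z₀ r)ᶜ = 0 := by
    simp [hσ, hN, hV, Measure.restrict_apply Metric.isOpen_ball.measurableSet.compl]
  have hae : N.rnDeriv σ =ᵐ[σ] fun x => ENNReal.ofReal c * V.rnDeriv σ x := by
    have hb : ∀ᵐ x ∂σ, x ∈ Metric.ball z₀ r := hσB
    filter_upwards [hz, hb, Measure.rnDeriv_ne_top N σ, Measure.rnDeriv_ne_top V σ]
      with x hx hxb h1 h2
    have := sub_eq_zero.1 (hx hxb)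
    rw [← ENNReal.ofReal_toReal h1, this, ENNReal.ofReal_mul' ENNReal.toReal_nonneg,
      ENNReal.ofReal_toReal h2]
  calc N = σ.withDensity (N.rnDeriv σ) := (Measure.withDensity_rnDeriv_eq N σ hNσ).symm
    _ = σ.withDensity (fun x => ENNReal.ofReal c * V.rnDeriv σ x) := withDensity_congr_ae hae
    _ = ENNReal.ofReal c • σ.withDensity (V.rnDeriv σ) :=
        withDensity_smul _ (Measure.measurable_rnDeriv V σ)
    _ = _ := by rw [Measure.withDensity_rnDeriv_eq V σ hVσ]

theorem eq_of_weak_gradient_zero {u : ℂ → ℂ} {z₀ : ℂ} {r : ℝ} (hr : 0 < r)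
    (hu : ContinuousOn u (Metric.closedBall z₀ (2 * r)))
    (h : HasWeakWirt (Metric.ball z₀ (2 * r)) u 0 0) {t : ℂ} (ht : t ∈ Metric.ball (0 : ℂ) r) :
    u (z₀ + t) = u z₀ := by
  set ν := (volume.restrict (Metric.ball z₀ (2 * r)) : Measure ℂ) with hν
  have hd : Integrable u ν :=
    (hu.integrableOn_compact (isCompact_closedBall _ _)).mono_set Metric.ball_subset_closedBall
  have hz : ∀ {φ : ℂ → ℂ}, IsTest (Metric.ball z₀ (2 * r)) φ →
      ∫ x, u x * φ x ∂ν = ∫ x, u x * φ x := fun hφ =>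
    setIntegral_eq_integral_of_forall_compl_eq_zero fun x hx => by rw [hφ.eq_zero hx, mul_zero]
  have h0 : ∀ φ, IsTest (Metric.ball z₀ (2 * r)) φ →
      ∫ x, u x * wirt φ x ∂ν = 0 ∧ ∫ x, u x * wirtBar φ x ∂ν = 0 := fun φ hφ => by
    rw [hz hφ.wirt, hz hφ.wirtBar, h.bar.integral_bar φ hφ,
      h.integral_wirt φ hφ.contDiff hφ.compact hφ.subset]
    simp
  have hBr : Metric.ball z₀ r ⊆ Metric.ball z₀ (2 * r) := Metric.ball_subset_ball (by linarith)
  have hmaps : MapsTo (fun x => x + t) (Metric.ball z₀ r) (Metric.ball z₀ (2 * r)) := fun x hx => by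
    rw [Metric.mem_ball, dist_eq_norm] at hx ht ⊢
    calc ‖x + t - z₀‖ = ‖(x - z₀) + (t - 0)‖ := by congr 1; ring
      _ ≤ _ := norm_add_le _ _
      _ < 2 * r := by linarith
  have hucont : ContinuousOn u (Metric.ball z₀ (2 * r)) := hu.mono Metric.ball_subset_closedBall
  have c1 : ContinuousOn (fun x => u (x + t)) (Metric.ball z₀ r) :=
    hucont.comp (continuous_id.add continuous_const).continuousOn hmaps
  have hae : (fun x => u (x + t)) =ᵐ[volume.restrict (Metric.ball z₀ r)] u := by
    refine ae_eq_of_test Metric.isOpen_ball (.of_continuousOn c1)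
      (.of_continuousOn (hucont.mono hBr)) fun φ hφ => ?_
    have := integral_comp_sub_const hd h0 hφ (s := t) (t := 0) (by simpa using ht)
      (by simpa using hr)
    have ht2 : IsTest (Metric.ball z₀ (2 * r)) (fun x => φ (x - t)) :=
      (hφ.comp_sub t).mono fun x hx => by
        have : x - t ∈ Metric.ball z₀ r := by
          rw [Metric.mem_ball, dist_eq_norm] at hx ⊢
          convert hx using 2; ring
        simpa using hmaps this
    rw [hz ht2] at this
    simp only [sub_zero] at this
    rw [hz (hφ.mono hBr)] at this
    rw [← this, ← integral_add_right_eq_self (fun x => u x * φ (x - t)) t]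
    simp
  exact Measure.eqOn_open_of_ae_eq hae Metric.isOpen_ball c1 (hucont.mono hBr)
    (Metric.mem_ball_self hr)
end

noncomputable section

open MeasureTheory Set Filter Topology
open scoped ContDiff ComplexConjugate ENNReal

/-- The Jacobian of a map with Wirtinger derivatives `a` and `b`. -/
def jac (a b : ℂ → ℂ) (w : ℂ) : ℝ := ‖a w‖ ^ 2 - ‖b w‖ ^ 2

theorem ofReal_jac (a b : ℂ → ℂ) (w : ℂ) :
    (jac a b w : ℂ) = a w * conj (a w) - b w * conj (b w) := by
  rw [jac, Complex.mul_conj, Complex.mul_conj, Complex.normSq_eq_norm_sq,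
    Complex.normSq_eq_norm_sq]
  push_cast; rfl

/-- Quasiconformality of `g`, with chosen measurable weak derivatives `a = g_w`, `b = g_{w̄}`. -/
structure QCData (g : OpenPartialHomeomorph ℂ ℂ) (a b : ℂ → ℂ) (k : ℝ) : Prop where
  measurable_wirt : Measurable a
  measurable_wirtBar : Measurable b
  weak : HasWeakWirt g.source g a b
  memLpLoc_wirt : MemLpLoc 2 g.source a
  memLpLoc_wirtBar : MemLpLoc 2 g.source b
  nonneg : 0 ≤ k
  lt_one : k < 1
  norm_le : ∀ w, ‖b w‖ ≤ k * ‖a w‖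

namespace QCData
variable {g : OpenPartialHomeomorph ℂ ℂ} {a b : ℂ → ℂ} {k : ℝ}

theorem mul_le_jac (h : QCData g a b k) (w : ℂ) : (1 - k ^ 2) * ‖a w‖ ^ 2 ≤ jac a b w := by
  have h1 : ‖b w‖ ^ 2 ≤ (k * ‖a w‖) ^ 2 := pow_le_pow_left₀ (norm_nonneg _) (h.norm_le w) 2
  rw [jac]; nlinarith

theorem one_sub_sq_pos (h : QCData g a b k) : 0 < 1 - k ^ 2 := by
  nlinarith [h.nonneg, h.lt_one]

theorem jac_nonneg (h : QCData g a b k) (w : ℂ) : 0 ≤ jac a b w :=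
  (mul_nonneg h.one_sub_sq_pos.le (sq_nonneg _)).trans (h.mul_le_jac w)

theorem eq_zero_of_jac (h : QCData g a b k) {w : ℂ} (hw : jac a b w = 0) : a w = 0 ∧ b w = 0 := by
  have h1 := h.mul_le_jac w
  rw [hw] at h1
  have h2 : ‖a w‖ ^ 2 ≤ 0 := by
    by_contra hn
    push Not at hn
    nlinarith [mul_pos h.one_sub_sq_pos hn]
  have h3 : a w = 0 := by
    have : ‖a w‖ = 0 := by nlinarith [norm_nonneg (a w)]
    simpa using this
  refine ⟨h3, ?_⟩
  have := h.norm_le w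
  rw [h3] at this
  simpa using this

theorem measurable_jac (h : QCData g a b k) : Measurable (jac a b) :=
  (h.measurable_wirt.norm.pow_const 2).sub (h.measurable_wirtBar.norm.pow_const 2)

theorem continuousOn_memLpLoc_top (g : OpenPartialHomeomorph ℂ ℂ) : MemLpLoc ⊤ g.source g :=
  .of_continuousOn g.continuousOn

theorem isCompact_image_symm {K : Set ℂ} (hK : IsCompact K) (hKt : K ⊆ g.target) :
    IsCompact (g.symm '' K) := hK.image_of_continuousOn (g.continuousOn_symm.mono hKt)

/-- Pull back of a test function by a quasiconformal homeomorphism. -/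
theorem compactSobolev (h : QCData g a b k) {φ : ℂ → ℂ} (hφ : IsTest g.target φ) :
    CompactSobolev g.source (g.source.indicator fun w => φ (g w))
      (g.source.indicator fun w => wirt φ (g w) * a w + wirtBar φ (g w) * conj (b w))
      (g.source.indicator fun w => wirt φ (g w) * b w + wirtBar φ (g w) * conj (a w)) := by
  have hw := h.weak.comp_contDiff g.open_source (continuousOn_memLpLoc_top g)
    (hφ.contDiff.of_le (by simp) : ContDiff ℝ 1 φ)
  have hi : ∀ f : ℂ → ℂ, f =ᵐ[volume.restrict g.source] g.source.indicator f := fun f =>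
    (indicator_ae_eq_restrict g.open_source.measurableSet).symm
  have hc : ∀ {ψ : ℂ → ℂ}, IsTest g.target ψ → ContinuousOn (fun w => ψ (g w)) g.source :=
    fun hψ => hψ.continuous.comp_continuousOn g.continuousOn
  have m1 : MemLpLoc ⊤ g.source (fun w => wirt φ (g w)) := .of_continuousOn (hc hφ.wirt)
  have m2 : MemLpLoc ⊤ g.source (fun w => wirtBar φ (g w)) := .of_continuousOn (hc hφ.wirtBar)
  refine .of_weak (K := g.symm '' tsupport φ) g.open_source
    (hw.congr g.open_source (hi _) (hi _) (hi _)) ((hc hφ).congr fun w hw => indicator_of_mem hw _)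
    (((m1.mul (r := 2) h.memLpLoc_wirt).add (m2.mul h.memLpLoc_wirtBar.star)).congr (hi _))
    (((m1.mul (r := 2) h.memLpLoc_wirtBar).add (m2.mul h.memLpLoc_wirt.star)).congr (hi _))
    (isCompact_image_symm hφ.compact hφ.subset) ?_ fun w hw => ?_
  · rintro _ ⟨z, hz, rfl⟩
    exact g.map_target (hφ.subset hz)
  · by_cases hws : w ∈ g.source
    · have hn : g w ∉ tsupport φ := fun hh => hw ⟨g w, hh, g.left_inv hws⟩
      have z0 : φ (g w) = 0 := image_eq_zero_of_notMem_tsupport hn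
      have z1 : wirt φ (g w) = 0 :=
        image_eq_zero_of_notMem_tsupport fun hh => hn (tsupport_wirt_subset _ hh)
      have z2 : wirtBar φ (g w) = 0 :=
        image_eq_zero_of_notMem_tsupport fun hh => hn (tsupport_wirtBar_subset _ hh)
      simp [hws, z0, z1, z2]
    · simp [hws]

theorem integral_test_jac (h : QCData g a b k) {φ : ℂ → ℂ} (hφ : IsTest g.target φ) :
    ∫ w in g.source, wirt φ (g w) * jac a b w = 0 ∧
      ∫ w in g.source, wirtBar φ (g w) * jac a b w = 0 := by
  have hs := h.compactSobolev hφ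
  have e1 := hs.integral_jacobian g.open_source h.weak.star h.memLpLoc_wirtBar.star
    h.memLpLoc_wirt.star
  have e2 := hs.integral_jacobian g.open_source h.weak h.memLpLoc_wirt h.memLpLoc_wirtBar
  have hm := g.open_source.measurableSet
  constructor
  · rw [← e1, ← integral_indicator hm]
    congr 1; ext w
    by_cases hw : w ∈ g.source
    · simp only [hw, indicator_of_mem, ofReal_jac]; ring
    · simp [hw]
  · rw [← neg_eq_zero, ← e2, ← integral_indicator hm, ← integral_neg]
    congr 1; ext w
    by_cases hw : w ∈ g.source
    · simp only [hw, indicator_of_mem, ofReal_jac]; ring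
    · simp [hw]

theorem _root_.CompactSobolev.mul_id {U : Set ℂ} {θ a b : ℂ → ℂ} (h : CompactSobolev U θ a b)
    (hU : IsOpen U) :
    CompactSobolev U (fun w => w * θ w) (fun w => θ w + w * a w) (fun w => w * b w) := by
  obtain ⟨K, hK, hKU, h0⟩ := h.exists_compact
  have hid : HasWeakWirt univ (fun w : ℂ => w) (fun _ => 1) (fun _ => 0) := by
    have := HasWeakWirt.of_contDiffOn isOpen_univ (contDiff_id (𝕜 := ℝ) (E := ℂ) (n := 1)).contDiffOn
    have e1 : wirt id = fun _ : ℂ => (1 : ℂ) := funext fun z => (hasFDerivAt_wirtL_id z).wirt_eq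
    have e2 : wirtBar id = fun _ : ℂ => (0 : ℂ) :=
      funext fun z => (hasFDerivAt_wirtL_id z).wirtBar_eq
    rw [e1, e2] at this
    exact this
  have hc : MemLpLoc ⊤ univ (fun w : ℂ => w) := .of_continuousOn continuous_id.continuousOn
  have hw := hid.mul h.weak isOpen_univ hc (.of_continuousOn h.continuous.continuousOn)
  simp only [one_mul, zero_mul, zero_add] at hw
  refine .of_weak hU (hw.mono (subset_univ U)) (continuous_id.mul h.continuous).continuousOn
    ((MemLpLoc.of_continuousOn h.continuous.continuousOn).add
      ((hc.mono_set (subset_univ U)).mul (h.memLp_wirt.memLpLoc U)))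
    ((hc.mono_set (subset_univ U)).mul (h.memLp_wirtBar.memLpLoc U)) hK hKU fun w hw => ?_
  obtain ⟨h1, h2, h3⟩ := h0 w hw
  simp [h1, h2, h3]

theorem integral_id_test_jac (h : QCData g a b k) {φ : ℂ → ℂ} (hφ : IsTest g.target φ) :
    ∫ w in g.source, w * wirt φ (g w) * jac a b w = -∫ w in g.source, φ (g w) * conj (a w) ∧
    ∫ w in g.source, w * wirtBar φ (g w) * jac a b w = ∫ w in g.source, φ (g w) * b w := by
  have hs := h.compactSobolev hφ
  have hs' := hs.mul_id g.open_source
  have e1 := hs'.integral_jacobian g.open_source h.weak.star h.memLpLoc_wirtBar.star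
    h.memLpLoc_wirt.star
  have e2 := hs'.integral_jacobian g.open_source h.weak h.memLpLoc_wirt h.memLpLoc_wirtBar
  have hm := g.open_source.measurableSet
  have hcs : HasCompactSupport (g.source.indicator fun w => φ (g w)) := by
    obtain ⟨K, hK, -, h0⟩ := hs.exists_compact
    refine HasCompactSupport.of_support_subset_isCompact hK fun w hw => ?_
    by_contra hn
    exact hw (h0 w hn).1
  have hts : tsupport (g.source.indicator fun w => φ (g w)) ⊆ g.source := by
    obtain ⟨K, hK, hKU, h0⟩ := hs.exists_compact
    refine (closure_minimal (fun w hw => ?_) hK.isClosed).trans hKU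
    by_contra hn
    exact hw (h0 w hn).1
  have i1 : Integrable fun w => conj (a w) * (g.source.indicator fun w => φ (g w)) w :=
    (h.memLpLoc_wirt.star.mono_exponent (by norm_num)).integrable_mul hs.continuous hcs hts
  have i2 : Integrable fun w => b w * (g.source.indicator fun w => φ (g w)) w :=
    (h.memLpLoc_wirtBar.mono_exponent (by norm_num)).integrable_mul hs.continuous hcs hts
  have hJ1 : MemLpLoc 1 g.source (fun w => (jac a b w : ℂ)) := by
    have := (h.memLpLoc_wirt.mul (r := 1) h.memLpLoc_wirt.star).sub
      (h.memLpLoc_wirtBar.mul (r := 1) h.memLpLoc_wirtBar.star)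
    simpa only [ofReal_jac] using this
  have hts' : ∀ {ψ : ℂ → ℂ}, IsTest g.target ψ → Integrable
      (fun w => (jac a b w : ℂ) * (w * (g.source.indicator fun w => ψ (g w)) w)) := fun {ψ} hψ => by
    have hs2 := h.compactSobolev hψ
    obtain ⟨K, hK, hKU, h0⟩ := hs2.exists_compact
    have hsub : Function.support (fun w => w * (g.source.indicator fun w => ψ (g w)) w) ⊆ K := by
      intro w hw
      by_contra hn
      exact hw (by simp only [(h0 w hn).1, mul_zero])
    exact hJ1.integrable_mul (continuous_id.mul hs2.continuous)
      (HasCompactSupport.of_support_subset_isCompact hK hsub)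
      ((closure_minimal hsub hK.isClosed).trans hKU)
  constructor
  · rw [← integral_indicator hm, ← integral_indicator hm, eq_neg_iff_add_eq_zero, ← integral_add]
    · rw [← e1]
      congr 1; ext w
      by_cases hw : w ∈ g.source
      · simp only [hw, indicator_of_mem, ofReal_jac]; ring
      · simp [hw]
    · refine (hts' hφ.wirt).congr (Eventually.of_forall fun w => ?_)
      by_cases hw : w ∈ g.source
      · simp only [hw, indicator_of_mem]; ring
      · simp [hw]
    · refine i1.congr (Eventually.of_forall fun w => ?_)
      by_cases hw : w ∈ g.source
      · simp only [hw, indicator_of_mem]; ring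
      · simp [hw]
  · rw [← integral_indicator hm, ← integral_indicator hm, ← sub_eq_zero, ← integral_sub,
      ← neg_eq_zero, ← integral_neg]
    · rw [← e2]
      congr 1; ext w
      by_cases hw : w ∈ g.source
      · simp only [hw, indicator_of_mem, ofReal_jac]; ring
      · simp [hw]
    · refine (hts' hφ.wirtBar).congr (Eventually.of_forall fun w => ?_)
      by_cases hw : w ∈ g.source
      · simp only [hw, indicator_of_mem]; ring
      · simp [hw]
    · refine i2.congr (Eventually.of_forall fun w => ?_)
      by_cases hw : w ∈ g.source
      · simp only [hw, indicator_of_mem]; ring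
      · simp [hw]

end QCData

/-- The image under `g` of the measure with density the Jacobian on the preimage of `D`. -/
def jacMap (g : OpenPartialHomeomorph ℂ ℂ) (a b : ℂ → ℂ) (D : Set ℂ) : Measure ℂ :=
  Measure.map g ((volume.restrict (g.source ∩ g ⁻¹' D)).withDensity
    fun w => ENNReal.ofReal (jac a b w))

namespace QCData
variable {g : OpenPartialHomeomorph ℂ ℂ} {a b : ℂ → ℂ} {k : ℝ}

theorem aemeasurable_jacMap (D : Set ℂ) : AEMeasurable g
    ((volume.restrict (g.source ∩ g ⁻¹' D)).withDensity fun w => ENNReal.ofReal (jac a b w)) :=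
  ((g.continuousOn.aemeasurable g.open_source.measurableSet).mono_measure
    (Measure.restrict_mono inter_subset_left le_rfl)).mono_ac
      (withDensity_absolutelyContinuous _ _)

theorem integral_jacMap (h : QCData g a b k) {D : Set ℂ} {F : ℂ → ℂ}
    (hF : AEStronglyMeasurable F (jacMap g a b D)) :
    ∫ z, F z ∂jacMap g a b D = ∫ w in g.source ∩ g ⁻¹' D, F (g w) * jac a b w := by
  rw [jacMap, integral_map (aemeasurable_jacMap D) hF,
    integral_withDensity_eq_integral_toReal_smul h.measurable_jac.ennreal_ofReal (by simp)]
  congr 1; ext w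
  rw [ENNReal.toReal_ofReal (h.jac_nonneg w), Complex.real_smul, mul_comm]

theorem lintegral_jacMap (h : QCData g a b k) {D : Set ℂ} {F : ℂ → ℝ≥0∞} (hF : Measurable F) :
    ∫⁻ z, F z ∂jacMap g a b D =
      ∫⁻ w in g.source ∩ g ⁻¹' D, ENNReal.ofReal (jac a b w) * F (g w) := by
  rw [jacMap, lintegral_map' hF.aemeasurable (aemeasurable_jacMap D),
    lintegral_withDensity_eq_lintegral_mul₀ h.measurable_jac.ennreal_ofReal.aemeasurable]
  · rfl
  · exact hF.comp_aemeasurable ((g.continuousOn.aemeasurable g.open_source.measurableSet).mono_measure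
      (Measure.restrict_mono inter_subset_left le_rfl))

theorem jacMap_restrict (D E : Set ℂ) (hD : IsOpen D) (hE : IsOpen E) (hED : E ⊆ D) :
    (jacMap g a b D).restrict E = jacMap g a b E := by
  have hm : MeasurableSet (g.source ∩ g ⁻¹' D) := (g.isOpen_inter_preimage hD).measurableSet
  rw [jacMap, Measure.restrict_map_of_aemeasurable (aemeasurable_jacMap D) hE.measurableSet,
    restrict_withDensity', Measure.restrict_restrict' hm, jacMap]
  congr 3
  ext w
  simp only [mem_inter_iff, mem_preimage]
  exact ⟨fun h => ⟨h.2.1, h.1⟩, fun h => ⟨h.2, h.1, hED h.2⟩⟩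

theorem exists_scale (h : QCData g a b k) {z₀ : ℂ} (hz₀ : z₀ ∈ g.target) :
    ∃ c r : ℝ, 0 < c ∧ 0 < r ∧ Metric.closedBall z₀ r ⊆ g.target ∧
      jacMap g a b (Metric.ball z₀ r) = ENNReal.ofReal c • volume.restrict (Metric.ball z₀ r) := by
  obtain ⟨R, hR, hRt⟩ := Metric.nhds_basis_closedBall.mem_iff.1 (g.open_target.mem_nhds hz₀)
  set r := R / 2 with hr
  have hr0 : 0 < r := by positivity
  have hR2 : 2 * r = R := by rw [hr]; ring
  have hbt : Metric.ball z₀ (2 * r) ⊆ g.target := by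
    rw [hR2]; exact Metric.ball_subset_closedBall.trans hRt
  have hsub : g.source ∩ g ⁻¹' Metric.ball z₀ (2 * r) ⊆ g.symm '' Metric.closedBall z₀ R := by
    rintro w ⟨hw, hwb⟩
    refine ⟨g w, Metric.ball_subset_closedBall (by rwa [hR2] at hwb), g.left_inv hw⟩
  have hK := isCompact_image_symm (isCompact_closedBall z₀ R) hRt
  have hKs : g.symm '' Metric.closedBall z₀ R ⊆ g.source := by
    rintro _ ⟨z, hz, rfl⟩; exact g.map_target (hRt hz)
  have hfin : IsFiniteMeasure (jacMap g a b (Metric.ball z₀ (2 * r))) := by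
    refine ⟨?_⟩
    rw [← lintegral_one, h.lintegral_jacMap measurable_const]
    simp only [mul_one]
    refine lt_of_le_of_lt (lintegral_mono_set hsub) ?_
    have ha : IntegrableOn (fun w => ‖a w‖ ^ 2) (g.symm '' Metric.closedBall z₀ R) :=
      (h.memLpLoc_wirt _ hKs hK).integrable_norm_pow (by norm_num)
    refine lt_of_le_of_lt (lintegral_mono fun w => ?_) ha.2
    rw [Real.enorm_of_nonneg (by positivity)]
    refine ENNReal.ofReal_le_ofReal ?_
    rw [jac]; linarith [sq_nonneg ‖b w‖]
  obtain ⟨c, hc, hcν⟩ := exists_eq_smul_volume_of_gradient_zero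
    (ν := jacMap g a b (Metric.ball z₀ (2 * r))) hr0 fun φ hφ => by
      have hφt := hφ.mono hbt
      have hset : ∀ {ψ : ℂ → ℂ}, IsTest (Metric.ball z₀ (2 * r)) ψ →
          ∫ w in g.source ∩ g ⁻¹' Metric.ball z₀ (2 * r), ψ (g w) * jac a b w =
            ∫ w in g.source, ψ (g w) * jac a b w := fun hψ => by
        refine (setIntegral_eq_of_subset_of_forall_sdiff_eq_zero g.open_source.measurableSet
          inter_subset_left fun w hw => ?_).symm
        rw [hψ.eq_zero fun hh => hw.2 ⟨hw.1, hh⟩, zero_mul]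
      rw [h.integral_jacMap hφ.wirt.continuous.aestronglyMeasurable,
        h.integral_jacMap hφ.wirtBar.continuous.aestronglyMeasurable, hset hφ.wirt,
        hset hφ.wirtBar]
      exact h.integral_test_jac hφt
  have hrR : Metric.ball z₀ r ⊆ Metric.ball z₀ (2 * r) := Metric.ball_subset_ball (by linarith)
  rw [jacMap_restrict _ _ Metric.isOpen_ball Metric.isOpen_ball hrR] at hcν
  refine ⟨c, r, lt_of_le_of_ne hc fun hc0 => ?_, hr0,
    (Metric.closedBall_subset_closedBall (by linarith)).trans hRt, hcν⟩
  rw [← hc0, ENNReal.ofReal_zero, zero_smul] at hcν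
  have hS : IsOpen (g.source ∩ g ⁻¹' Metric.ball z₀ r) :=
    g.isOpen_inter_preimage Metric.isOpen_ball
  have hwS : g.symm z₀ ∈ g.source ∩ g ⁻¹' Metric.ball z₀ r :=
    ⟨g.map_target hz₀, by rw [mem_preimage, g.right_inv hz₀]; exact Metric.mem_ball_self hr0⟩
  have hJ0 : ∀ᵐ w ∂volume.restrict (g.source ∩ g ⁻¹' Metric.ball z₀ r),
      ENNReal.ofReal (jac a b w) = 0 := by
    have := h.lintegral_jacMap (D := Metric.ball z₀ r) (F := fun _ => 1) measurable_const
    rw [hcν] at this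
    simp only [lintegral_zero_measure, mul_one] at this
    exact (lintegral_eq_zero_iff h.measurable_jac.ennreal_ofReal).1 this.symm
  have hab : ∀ᵐ w ∂volume.restrict (g.source ∩ g ⁻¹' Metric.ball z₀ r), a w = 0 ∧ b w = 0 := by
    filter_upwards [hJ0] with w hw
    exact h.eq_zero_of_jac (le_antisymm (ENNReal.ofReal_eq_zero.1 hw) (h.jac_nonneg w))
  obtain ⟨s, hs, hsS⟩ := Metric.nhds_basis_closedBall.mem_iff.1 (hS.mem_nhds hwS)
  have hs2 : 2 * (s / 2) = s := by ring
  have hconst := eq_of_weak_gradient_zero (u := g) (z₀ := g.symm z₀) (half_pos hs)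
    (g.continuousOn.mono (by rw [hs2]; exact hsS.trans inter_subset_left)) (by
      rw [hs2]
      have hss := Metric.ball_subset_closedBall.trans hsS
      refine (h.weak.mono (hss.trans inter_subset_left)).congr Metric.isOpen_ball (ae_eq_refl _)
        ?_ ?_ <;> filter_upwards [ae_restrict_of_ae_restrict_of_subset hss hab] with w hw
      exacts [hw.1, hw.2]) (t := (s / 4 : ℝ))
    (by rw [mem_ball_zero_iff, Complex.norm_real, Real.norm_of_nonneg (by positivity)]; linarith)
  have hmem : g.symm z₀ + (s / 4 : ℝ) ∈ g.source := (hsS (by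
    rw [Metric.mem_closedBall, dist_eq_norm, add_sub_cancel_left, Complex.norm_real,
      Real.norm_of_nonneg (by positivity)]; linarith)).1
  have := g.injOn hmem hwS.1 hconst
  have h4 : ((s / 4 : ℝ) : ℂ) = 0 := by simpa using this
  rw [Complex.ofReal_eq_zero] at h4
  linarith

end QCData
end

noncomputable section

open MeasureTheory Set Filter Topology
open scoped ContDiff ComplexConjugate ENNReal

/-- The derivative `f_z` of the inverse `f` of `g` on `B`, in terms of `a = g_w`, `b = g_{w̄}`. -/
def invWirt (g : OpenPartialHomeomorph ℂ ℂ) (a b : ℂ → ℂ) (B : Set ℂ) : ℂ → ℂ :=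
  B.indicator fun z => conj (a (g.symm z)) / jac a b (g.symm z)

/-- The derivative `f_{z̄}` of the inverse `f` of `g` on `B`. -/
def invWirtBar (g : OpenPartialHomeomorph ℂ ℂ) (a b : ℂ → ℂ) (B : Set ℂ) : ℂ → ℂ :=
  B.indicator fun z => -b (g.symm z) / jac a b (g.symm z)

theorem invWirt_of_mem {g : OpenPartialHomeomorph ℂ ℂ} {B : Set ℂ} {w : ℂ} (a b : ℂ → ℂ)
    (hw : w ∈ g.source) (hB : g w ∈ B) : invWirt g a b B (g w) = conj (a w) / jac a b w := by
  rw [invWirt, indicator_of_mem hB, g.left_inv hw]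

theorem invWirtBar_of_mem {g : OpenPartialHomeomorph ℂ ℂ} {B : Set ℂ} {w : ℂ} (a b : ℂ → ℂ)
    (hw : w ∈ g.source) (hB : g w ∈ B) : invWirtBar g a b B (g w) = -b w / jac a b w := by
  rw [invWirtBar, indicator_of_mem hB, g.left_inv hw]

theorem measurable_indicator_comp {f h : ℂ → ℂ} {B : Set ℂ} (hB : IsOpen B) (hf : ContinuousOn f B)
    (hh : Measurable h) : Measurable (B.indicator fun z => h (f z)) := by
  classical
  have hm : Measurable (B.piecewise f 0) :=
    hf.measurable_piecewise continuousOn_const hB.measurableSet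
  have : (B.indicator fun z => h (f z)) = B.indicator fun z => h (B.piecewise f 0 z) := by
    ext z
    by_cases hz : z ∈ B <;> simp [hz]
  rw [this]
  exact (hh.comp hm).indicator hB.measurableSet

namespace QCData
variable {g : OpenPartialHomeomorph ℂ ℂ} {a b : ℂ → ℂ} {k : ℝ} {z₀ : ℂ} {c r : ℝ}

theorem transfer (h : QCData g a b k) (hc : 0 < c) (hs : jacMap g a b (Metric.ball z₀ r) =
    ENNReal.ofReal c • volume.restrict (Metric.ball z₀ r)) {F : ℂ → ℂ}
    (hF : AEStronglyMeasurable F (volume.restrict (Metric.ball z₀ r))) :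
    ∫ w in g.source ∩ g ⁻¹' Metric.ball z₀ r, F (g w) * jac a b w =
      c * ∫ z in Metric.ball z₀ r, F z := by
  rw [← h.integral_jacMap (by rw [hs]; exact hF.smul_measure _), hs, integral_smul_measure,
    ENNReal.toReal_ofReal hc.le, Complex.real_smul]

theorem transfer_mul (h : QCData g a b k) (hc : 0 < c) (hs : jacMap g a b (Metric.ball z₀ r) =
    ENNReal.ofReal c • volume.restrict (Metric.ball z₀ r)) {F φ : ℂ → ℂ}
    (hF : AEStronglyMeasurable F (volume.restrict (Metric.ball z₀ r))) (hφ : Continuous φ) :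
    ∫ w in g.source ∩ g ⁻¹' Metric.ball z₀ r, F (g w) * φ (g w) * jac a b w =
      c * ∫ z in Metric.ball z₀ r, F z * φ z :=
  h.transfer hc hs (F := fun z => F z * φ z) (hF.mul hφ.aestronglyMeasurable)

theorem measurable_invWirt (h : QCData g a b k) (hB : Metric.ball z₀ r ⊆ g.target) :
    Measurable (invWirt g a b (Metric.ball z₀ r)) :=
  measurable_indicator_comp (h := fun w => conj (a w) / jac a b w) Metric.isOpen_ball
    (g.continuousOn_symm.mono hB) ((Complex.continuous_conj.measurable.comp h.measurable_wirt).div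
      (Complex.measurable_ofReal.comp h.measurable_jac))

theorem measurable_invWirtBar (h : QCData g a b k) (hB : Metric.ball z₀ r ⊆ g.target) :
    Measurable (invWirtBar g a b (Metric.ball z₀ r)) :=
  measurable_indicator_comp (h := fun w => -b w / jac a b w) Metric.isOpen_ball
    (g.continuousOn_symm.mono hB) (h.measurable_wirtBar.neg.div
      (Complex.measurable_ofReal.comp h.measurable_jac))

theorem norm_invWirtBar_le (h : QCData g a b k) (B : Set ℂ) (z : ℂ) :
    ‖invWirtBar g a b B z‖ ≤ k * ‖invWirt g a b B z‖ := by
  by_cases hz : z ∈ B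
  · simp only [invWirt, invWirtBar, indicator_of_mem hz, norm_div, norm_neg, Complex.norm_conj]
    rw [← mul_div_assoc]
    gcongr
    exact h.norm_le _
  · simp [invWirt, invWirtBar, hz]

theorem memLp_invWirt (h : QCData g a b k) (hc : 0 < c)
    (hBt : Metric.closedBall z₀ r ⊆ g.target) (hs : jacMap g a b (Metric.ball z₀ r) =
    ENNReal.ofReal c • volume.restrict (Metric.ball z₀ r)) :
    MemLp (invWirt g a b (Metric.ball z₀ r)) 2 (volume.restrict (Metric.ball z₀ r)) := by
  have hBt' := Metric.ball_subset_closedBall.trans hBt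
  have hm := h.measurable_invWirt hBt'
  rw [memLp_two_iff_integrable_sq_norm hm.aestronglyMeasurable]
  refine ⟨(hm.norm.pow_const 2).aestronglyMeasurable, ?_⟩
  have hsub : g.source ∩ g ⁻¹' Metric.ball z₀ r ⊆ g.symm '' Metric.closedBall z₀ r := by
    rintro w ⟨hw, hwb⟩
    exact ⟨g w, Metric.ball_subset_closedBall hwb, g.left_inv hw⟩
  have hK := isCompact_image_symm (isCompact_closedBall z₀ r) hBt
  have e1 := h.lintegral_jacMap (D := Metric.ball z₀ r)
    (F := fun z => ‖‖invWirt g a b (Metric.ball z₀ r) z‖ ^ 2‖ₑ) (hm.norm.pow_const 2).enorm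
  rw [hs, lintegral_smul_measure] at e1
  have hle : ∫⁻ w in g.source ∩ g ⁻¹' Metric.ball z₀ r, ENNReal.ofReal (jac a b w) *
      ‖‖invWirt g a b (Metric.ball z₀ r) (g w)‖ ^ 2‖ₑ < ⊤ := by
    calc _ ≤ ∫⁻ w in g.source ∩ g ⁻¹' Metric.ball z₀ r, ENNReal.ofReal (1 / (1 - k ^ 2)) := by
          refine setLIntegral_mono measurable_const fun w hw => ?_
          rw [Real.enorm_of_nonneg (by positivity), ← ENNReal.ofReal_mul (h.jac_nonneg w)]
          refine ENNReal.ofReal_le_ofReal ?_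
          have hwb : g w ∈ Metric.ball z₀ r := hw.2
          simp only [invWirt, indicator_of_mem hwb, g.left_inv hw.1, norm_div, Complex.norm_conj,
            Complex.norm_real, Real.norm_of_nonneg (h.jac_nonneg w)]
          rcases (h.jac_nonneg w).eq_or_lt with h0 | h0
          · rw [← h0]
            have := h.one_sub_sq_pos
            simpa using this.le
          · have : jac a b w * (‖a w‖ / jac a b w) ^ 2 = ‖a w‖ ^ 2 / jac a b w := by
              field_simp
            rw [this, div_le_div_iff₀ h0 h.one_sub_sq_pos]
            linarith [h.mul_le_jac w]
      _ ≤ ENNReal.ofReal (1 / (1 - k ^ 2)) * volume (g.symm '' Metric.closedBall z₀ r) := by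
          rw [setLIntegral_const]
          gcongr
      _ < ⊤ := ENNReal.mul_lt_top ENNReal.ofReal_lt_top hK.measure_lt_top
  rw [← e1, smul_eq_mul] at hle
  exact ENNReal.lt_top_of_mul_ne_top_right hle.ne (ENNReal.ofReal_pos.2 hc).ne'

/-- The inverse of a quasiconformal homeomorphism is locally quasiconformal. -/
theorem inverse (h : QCData g a b k) (hc : 0 < c)
    (hBt : Metric.closedBall z₀ r ⊆ g.target) (hs : jacMap g a b (Metric.ball z₀ r) =
    ENNReal.ofReal c • volume.restrict (Metric.ball z₀ r)) :
    QCData (g.symm.restrOpen (Metric.ball z₀ r) Metric.isOpen_ball)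
      (invWirt g a b (Metric.ball z₀ r)) (invWirtBar g a b (Metric.ball z₀ r)) k := by
  have hBt' := Metric.ball_subset_closedBall.trans hBt
  set B := Metric.ball z₀ r with hB
  have hsrc : (g.symm.restrOpen B Metric.isOpen_ball).source = B := by
    rw [OpenPartialHomeomorph.restrOpen_source]
    exact inter_eq_right.2 hBt'
  have hBm : MeasurableSet B := Metric.isOpen_ball.measurableSet
  have m1 : Measurable (invWirt g a b B) := h.measurable_invWirt hBt'
  have m2 : Measurable (invWirtBar g a b B) := h.measurable_invWirtBar hBt'
  have l1 := h.memLp_invWirt hc hBt hs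
  have l2 : MemLp (invWirtBar g a b B) 2 (volume.restrict B) :=
    l1.of_le_mul m2.aestronglyMeasurable (Eventually.of_forall (h.norm_invWirtBar_le B))
  have L1 : MemLpLoc 2 B (invWirt g a b B) := .of_memLp_restrict l1
  have L2 : MemLpLoc 2 B (invWirtBar g a b B) := .of_memLp_restrict l2
  have hfc : ContinuousOn g.symm B := g.continuousOn_symm.mono hBt'
  have hSsub : g.source ∩ g ⁻¹' B ⊆ g.source := inter_subset_left
  have hSm : MeasurableSet (g.source ∩ g ⁻¹' B) :=
    (g.isOpen_inter_preimage Metric.isOpen_ball).measurableSet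
  have hSset : ∀ {F φ : ℂ → ℂ}, IsTest B φ → ∫ w in g.source, φ (g w) * F w =
      ∫ w in g.source ∩ g ⁻¹' B, φ (g w) * F w := fun hφ =>
    setIntegral_eq_of_subset_of_forall_sdiff_eq_zero g.open_source.measurableSet hSsub
      fun w hw => by rw [hφ.eq_zero fun hh => hw.2 ⟨hw.1, hh⟩, zero_mul]
  have hBset : ∀ {F φ : ℂ → ℂ}, IsTest B φ → ∫ z, F z * φ z = ∫ z in B, F z * φ z := fun hφ =>
    (setIntegral_eq_integral_of_forall_compl_eq_zero
      fun z hz => by rw [hφ.eq_zero hz, mul_zero]).symm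
  have hc' : (c : ℂ) ≠ 0 := by exact_mod_cast hc.ne'
  have hcomp : ∀ {φ : ℂ → ℂ}, IsTest B φ →
      c * ∫ z, g.symm z * φ z = ∫ w in g.source, w * φ (g w) * jac a b w := fun {φ} hφ => by
    rw [hBset hφ, ← h.transfer_mul hc hs (hfc.aestronglyMeasurable hBm) hφ.continuous]
    have e := hSset (F := fun w => w * jac a b w) hφ
    rw [show (∫ w in g.source, w * φ (g w) * jac a b w) =
      ∫ w in g.source, φ (g w) * (w * jac a b w) by congr 1; ext w; ring, e]
    refine setIntegral_congr_fun hSm fun w hw => ?_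
    simp only [g.left_inv hw.1]
    ring
  have hw1 : ∀ φ, IsTest B φ → ∫ z, g.symm z * wirt φ z = -∫ z, invWirt g a b B z * φ z :=
    fun φ hφ => by
      apply mul_left_cancel₀ hc'
      rw [hcomp hφ.wirt,
        (h.integral_id_test_jac (hφ.mono hBt')).1, hSset hφ, mul_neg, hBset hφ,
        ← h.transfer_mul hc hs m1.aestronglyMeasurable hφ.continuous]
      congr 1
      refine setIntegral_congr_fun hSm fun w hw => ?_
      simp only [invWirt_of_mem (B := B) a b hw.1 hw.2]
      by_cases h0 : jac a b w = 0
      · simp [(h.eq_zero_of_jac h0).1]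
      · have : (jac a b w : ℂ) ≠ 0 := by exact_mod_cast h0
        field_simp
  have hw2 : ∀ φ, IsTest B φ → ∫ z, g.symm z * wirtBar φ z = -∫ z, invWirtBar g a b B z * φ z :=
    fun φ hφ => by
      apply mul_left_cancel₀ hc'
      rw [hcomp hφ.wirtBar,
        (h.integral_id_test_jac (hφ.mono hBt')).2, hSset hφ, mul_neg, hBset hφ,
        ← h.transfer_mul hc hs m2.aestronglyMeasurable hφ.continuous,
        ← integral_neg]
      refine setIntegral_congr_fun hSm fun w hw => ?_
      simp only [invWirtBar_of_mem (B := B) a b hw.1 hw.2]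
      by_cases h0 : jac a b w = 0
      · simp [(h.eq_zero_of_jac h0).2]
      · have : (jac a b w : ℂ) ≠ 0 := by exact_mod_cast h0
        field_simp
  refine ⟨m1, m2, ?_, hsrc ▸ L1, hsrc ▸ L2, h.nonneg, h.lt_one, h.norm_invWirtBar_le B⟩
  rw [hsrc]
  exact ⟨.of_continuousOn hfc, L1.mono_exponent (by norm_num), L2.mono_exponent (by norm_num),
    fun φ h1 h2 h3 => hw1 φ ⟨h1, h2, h3⟩, fun φ h1 h2 h3 => hw2 φ ⟨h1, h2, h3⟩⟩

/-- The derivative of a quasiconformal homeomorphism does not vanish almost everywhere. -/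
theorem ae_ne_zero (h : QCData g a b k) : ∀ᵐ w ∂volume.restrict g.source, a w ≠ 0 := by
  rw [ae_restrict_iff' g.open_source.measurableSet, ae_iff]
  have hset : {w | ¬(w ∈ g.source → a w ≠ 0)} = g.source ∩ {w | a w = 0} := by
    ext w; simp
  rw [hset]
  refine measure_null_of_locally_null _ fun w₀ hw₀ => ?_
  obtain ⟨c, r, hc, hr, hBt, hs⟩ := h.exists_scale (g.map_source hw₀.1)
  have hi := h.inverse hc hBt hs
  set B := Metric.ball (g w₀) r with hB
  have hBt' := Metric.ball_subset_closedBall.trans hBt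
  obtain ⟨c', r', hc', hr', hBt2, hs'⟩ := hi.exists_scale (z₀ := w₀) (by
    have : (g.symm.restrOpen B Metric.isOpen_ball) (g w₀) ∈
        (g.symm.restrOpen B Metric.isOpen_ball).target := by
      refine OpenPartialHomeomorph.map_source _ ?_
      rw [OpenPartialHomeomorph.restrOpen_source]
      exact ⟨g.map_source hw₀.1, Metric.mem_ball_self hr⟩
    rwa [OpenPartialHomeomorph.coe_restrOpen, g.left_inv hw₀.1] at this)
  set E := Metric.ball w₀ r' ∩ {w | a w = 0} with hE
  have hEm : MeasurableSet E :=
    Metric.isOpen_ball.measurableSet.inter (h.measurable_wirt (measurableSet_singleton 0))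
  have hz := hi.lintegral_jacMap (D := Metric.ball w₀ r') (F := E.indicator 1)
    (measurable_one.indicator hEm)
  rw [hs', lintegral_smul_measure, lintegral_indicator_one hEm,
    Measure.restrict_apply' Metric.isOpen_ball.measurableSet] at hz
  have hz0 : ∀ z, ENNReal.ofReal (jac (invWirt g a b B) (invWirtBar g a b B) z) *
      E.indicator 1 ((g.symm.restrOpen B Metric.isOpen_ball) z) = 0 := fun z => by
    by_cases hzE : g.symm z ∈ E
    · have ha : a (g.symm z) = 0 := hzE.2
      have h1 : invWirt g a b B z = 0 := by
        by_cases hzB : z ∈ B <;> simp [invWirt, hzB, ha]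
      have h2 : invWirtBar g a b B z = 0 := by
        have := h.norm_invWirtBar_le B z
        rw [h1] at this
        simpa using this
      simp [jac, h1, h2]
    · rw [OpenPartialHomeomorph.coe_restrOpen, indicator_of_notMem hzE, mul_zero]
  rw [lintegral_congr hz0] at hz
  rw [lintegral_zero, smul_eq_mul, mul_eq_zero] at hz
  have hE0 := hz.resolve_left (ENNReal.ofReal_pos.2 hc').ne'
  refine ⟨E, ?_, by rwa [inter_eq_left.2 (show E ⊆ Metric.ball w₀ r' from inter_subset_left)] at hE0⟩
  exact mem_nhdsWithin.2 ⟨Metric.ball w₀ r', Metric.isOpen_ball, Metric.mem_ball_self hr',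
    fun w hw => ⟨hw.1, hw.2.2⟩⟩

end QCData

theorem hasFDerivAt_normSq_aux (m : ℂ) : HasFDerivAt (fun m : ℂ => 1 - m * conj m)
    (wirtL (-conj m) (-m)) m := by
  have h1 := (hasFDerivAt_wirtL_id m).wirtL_mul (hasFDerivAt_wirtL_id m).wirtL_conj
  refine (h1.const_sub 1).congr_fderiv (ContinuousLinearMap.ext fun v => ?_)
  simp; ring

theorem one_sub_mul_conj_ne_zero {m : ℂ} (hm : ‖m‖ < 1) : 1 - m * conj m ≠ 0 := by
  rw [Complex.mul_conj, Complex.normSq_eq_norm_sq]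
  have : (1 : ℝ) - ‖m‖ ^ 2 ≠ 0 := by nlinarith [norm_nonneg m]
  exact_mod_cast this

/-- The first order equation in divergence form. -/
theorem divergence_form {U : Set ℂ} (hU : IsOpen U) {μ a b l : ℂ → ℂ} {k : ℝ} (hk0 : 0 ≤ k)
    (hk : k < 1) (hμ : ∀ᵐ w ∂volume.restrict U, ‖μ w‖ ≤ k) (h : HasWeakWirt U μ a b)
    (heq : ∀ᵐ w ∂volume.restrict U, InverseDilatationEq (μ w) (a w) (b w) (l w))
    (hl : ContinuousOn l U) {ψ ψ₁ ψ₂ : ℂ → ℂ} (hψ : CompactSobolev U ψ ψ₁ ψ₂) :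
    ∫ w in U, ((ψ₂ w - μ w * ψ₁ w) / (1 - μ w * conj (μ w)) +
      l w * (μ w / (1 - μ w * conj (μ w))) * ψ w) = 0 := by
  have hne : ∀ m ∈ Metric.closedBall (0 : ℂ) k, 1 - m * conj m ≠ 0 := fun m hm =>
    one_sub_mul_conj_ne_zero ((by simpa using hm : ‖m‖ ≤ k).trans_lt hk)
  have hDs : ContDiff ℝ 1 (fun m : ℂ => 1 - m * conj m) :=
    contDiff_const.sub (contDiff_id.mul Complex.conjCLE.contDiff)
  have hPs : ∀ m ∈ Metric.closedBall (0 : ℂ) k, ContDiffAt ℝ 1 (fun m => (1 - m * conj m)⁻¹) m :=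
    fun m hm => hDs.contDiffAt.inv (hne m hm)
  have hQs : ∀ m ∈ Metric.closedBall (0 : ℂ) k,
      ContDiffAt ℝ 1 (fun m => m * (1 - m * conj m)⁻¹) m :=
    fun m hm => contDiffAt_id.mul (hPs m hm)
  have dP : ∀ m ∈ Metric.closedBall (0 : ℂ) k, HasFDerivAt (fun m : ℂ => (1 - m * conj m)⁻¹)
      (wirtL (conj m * ((1 - m * conj m) ^ 2)⁻¹) (m * ((1 - m * conj m) ^ 2)⁻¹)) m := fun m hm => by
    have := ((hasDerivAt_inv (hne m hm)).hasFDerivAt_wirtL).wirtL_comp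
      (h := fun x => x⁻¹) (k := fun m => 1 - m * conj m) (hasFDerivAt_normSq_aux m)
    convert this using 2 <;> ring
  have dQ : ∀ m ∈ Metric.closedBall (0 : ℂ) k, HasFDerivAt (fun m : ℂ => m * (1 - m * conj m)⁻¹)
      (wirtL (((1 - m * conj m) ^ 2)⁻¹) (m ^ 2 * ((1 - m * conj m) ^ 2)⁻¹)) m := fun m hm => by
    have := (hasFDerivAt_wirtL_id m).wirtL_mul (dP m hm)
    have hm0 := hne m hm
    convert this using 2
    · field_simp; ring
    · ring
  have hP := h.comp hU hk0 hμ hPs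
  have hQ := h.comp hU hk0 hμ hQs
  have hum := h.memLpLoc.aestronglyMeasurable hU
  have LP : MemLpLoc ⊤ U (fun w => (1 - μ w * conj (μ w))⁻¹) :=
    memLpLoc_top_comp hum hμ (c := fun m => (1 - m * conj m)⁻¹) fun m hm =>
      (hPs m hm).continuousAt.continuousWithinAt
  have LQ : MemLpLoc ⊤ U (fun w => μ w * (1 - μ w * conj (μ w))⁻¹) :=
    memLpLoc_top_comp hum hμ (c := fun m => m * (1 - m * conj m)⁻¹) fun m hm =>
      (hQs m hm).continuousAt.continuousWithinAt
  have LH : MemLpLoc ⊤ U (fun w => l w * (μ w * (1 - μ w * conj (μ w))⁻¹)) :=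
    (MemLpLoc.of_continuousOn (p := ⊤) hl).mul LQ
  have hkey := hψ.integral_eq_zero hU (LQ.neg.mono_exponent le_top) (LP.mono_exponent le_top)
    (LH.mono_exponent le_top) fun φ hφ => by
      have e1 := hP.bar.integral_bar φ hφ
      have e2 := hQ.integral_wirt φ hφ.contDiff hφ.compact hφ.subset
      have i1 := (LP.mono_exponent (p := 1) le_top).integrable_mul_test hφ.wirtBar
      have i2 := (LQ.neg.mono_exponent (p := 1) le_top).integrable_mul_test hφ.wirt
      have i3 := (LH.mono_exponent (p := 1) le_top).integrable_mul_test hφ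
      rw [integral_add₃ i2 i1 i3, e1]
      simp_rw [neg_mul]
      rw [integral_neg, e2, neg_neg, ← sub_eq_add_neg,
        ← integral_sub (hQ.memLpLoc_wirt.integrable_mul_test hφ)
          (hP.memLpLoc_wirtBar.integrable_mul_test hφ)]
      refine (integral_add ((hQ.memLpLoc_wirt.integrable_mul_test hφ).sub
          (hP.memLpLoc_wirtBar.integrable_mul_test hφ)) i3).symm.trans ?_
      refine integral_eq_zero_of_ae ?_
      filter_upwards [(ae_restrict_iff' hU.measurableSet).1 heq,
        (ae_restrict_iff' hU.measurableSet).1 hμ] with w hw hwk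
      by_cases hwU : w ∈ U
      · have hmem : μ w ∈ Metric.closedBall (0 : ℂ) k := by simpa using hwk hwU
        have hD := hne _ hmem
        have q1 := hw hwU
        rw [InverseDilatationEq] at q1
        have q2 := congrArg conj q1
        simp only [map_sub, map_mul, map_neg, map_add, Complex.conj_conj] at q2
        simp only [Pi.zero_apply, Pi.sub_apply]
        rw [(dP _ hmem).wirt_eq, (dP _ hmem).wirtBar_eq, (dQ _ hmem).wirt_eq,
          (dQ _ hmem).wirtBar_eq]
        field_simp
        linear_combination (φ w) * q1 - (μ w * φ w) * q2
      · simp [hφ.eq_zero hwU]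
  obtain ⟨K, hK, hKU, h0⟩ := hψ.exists_compact
  rw [setIntegral_eq_integral_of_forall_compl_eq_zero, ← hkey]
  · congr 1; ext w; ring
  · intro w hw
    obtain ⟨h1, h2, h3⟩ := h0 w fun hh => hw (hKU hh)
    simp [h1, h2, h3]

namespace QCData
variable {g : OpenPartialHomeomorph ℂ ℂ} {a b : ℂ → ℂ} {k : ℝ} {z₀ : ℂ} {c r : ℝ}

/-- The inverse of `g` is a weak solution of the harmonic map equation. -/
theorem weak_harmonic (h : QCData g a b k) (hc : 0 < c)
    (hBt : Metric.closedBall z₀ r ⊆ g.target) (hs : jacMap g a b (Metric.ball z₀ r) =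
    ENNReal.ofReal c • volume.restrict (Metric.ball z₀ r)) {μ μ₁ μ₂ l : ℂ → ℂ}
    (hba : ∀ᵐ w ∂volume.restrict g.source, b w = μ w * a w)
    (hμ : ∀ᵐ w ∂volume.restrict g.source, ‖μ w‖ ≤ k) (hw : HasWeakWirt g.source μ μ₁ μ₂)
    (heq : ∀ᵐ w ∂volume.restrict g.source, InverseDilatationEq (μ w) (μ₁ w) (μ₂ w) (l w))
    (hl : ContinuousOn l g.source) {φ : ℂ → ℂ} (hφ : IsTest (Metric.ball z₀ r) φ) :
    ∫ z, invWirt g a b (Metric.ball z₀ r) z * wirtBar φ z =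
      ∫ z, l (g.symm z) * invWirt g a b (Metric.ball z₀ r) z *
        invWirtBar g a b (Metric.ball z₀ r) z * φ z := by
  have hBt' := Metric.ball_subset_closedBall.trans hBt
  set B := Metric.ball z₀ r with hB
  have hBm : MeasurableSet B := Metric.isOpen_ball.measurableSet
  have hSsub : g.source ∩ g ⁻¹' B ⊆ g.source := inter_subset_left
  have hSm : MeasurableSet (g.source ∩ g ⁻¹' B) :=
    (g.isOpen_inter_preimage Metric.isOpen_ball).measurableSet
  have hdiv := divergence_form g.open_source h.nonneg h.lt_one hμ hw heq hl
    (h.compactSobolev (hφ.mono hBt'))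
  have m1 : Measurable (invWirt g a b B) := h.measurable_invWirt hBt'
  have m2 : Measurable (invWirtBar g a b B) := h.measurable_invWirtBar hBt'
  have hm := g.open_source.measurableSet
  have hlc : AEStronglyMeasurable (fun z => l (g.symm z)) (volume.restrict B) :=
    (hl.comp (g.continuousOn_symm.mono hBt') fun z hz =>
      g.map_target (hBt' hz)).aestronglyMeasurable hBm
  have hBset : ∀ {F φ : ℂ → ℂ}, IsTest B φ → ∫ z, F z * φ z = ∫ z in B, F z * φ z := fun hφ =>
    (setIntegral_eq_integral_of_forall_compl_eq_zero
      fun z hz => by rw [hφ.eq_zero hz, mul_zero]).symm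
  have hc' : (c : ℂ) ≠ 0 := by exact_mod_cast hc.ne'
  have key : ∫ w in g.source ∩ g ⁻¹' B, (wirtBar φ (g w) * conj (a w) +
      l w * (conj (a w) * b w / jac a b w) * φ (g w)) = 0 := by
    rw [← hdiv]
    rw [← setIntegral_eq_of_subset_of_forall_sdiff_eq_zero hm hSsub]
    · refine setIntegral_congr_ae hm ?_
      filter_upwards [(ae_restrict_iff' hm).1 hba, (ae_restrict_iff' hm).1 hμ,
        (ae_restrict_iff' hm).1 h.ae_ne_zero] with w w1 w2 w3 hws
      have hD := one_sub_mul_conj_ne_zero ((w2 hws).trans_lt h.lt_one)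
      have ha : a w ≠ 0 := w3 hws
      have ha' : conj (a w) ≠ 0 := by simpa using ha
      have hJ : (jac a b w : ℂ) = a w * conj (a w) * (1 - μ w * conj (μ w)) := by
        rw [ofReal_jac, w1 hws, map_mul]; ring
      simp only [indicator_of_mem hws, hJ, w1 hws, map_mul]
      field_simp
      ring
    · intro w hw
      have hn : g w ∉ B := fun hh => hw.2 ⟨hw.1, hh⟩
      rw [hφ.eq_zero hn, hφ.wirtBar.eq_zero hn]; simp
  have L1 : MemLpLoc 2 B (invWirt g a b B) := .of_memLp_restrict (h.memLp_invWirt hc hBt hs)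
  have L2 : MemLpLoc 2 B (invWirtBar g a b B) := .of_memLp_restrict
    ((h.memLp_invWirt hc hBt hs).of_le_mul m2.aestronglyMeasurable
      (Eventually.of_forall (h.norm_invWirtBar_le B)))
  have hlt : MemLpLoc ⊤ B (fun z => l (g.symm z)) := .of_continuousOn
    (hl.comp (g.continuousOn_symm.mono hBt') fun z hz => g.map_target (hBt' hz))
  have i1 : Integrable (fun z => invWirt g a b B z * wirtBar φ z) :=
    (L1.mono_exponent (p := 1) (by norm_num)).integrable_mul_test hφ.wirtBar
  have i2 : Integrable (fun z => l (g.symm z) * invWirt g a b B z * invWirtBar g a b B z * φ z) :=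
    ((hlt.mul (r := 2) L1).mul (r := 1) L2).integrable_mul_test hφ
  have t := h.transfer hc hs (F := fun z => invWirt g a b B z * wirtBar φ z -
    l (g.symm z) * invWirt g a b B z * invWirtBar g a b B z * φ z)
    (i1.sub i2).aestronglyMeasurable.restrict
  rw [integral_sub i1.integrableOn i2.integrableOn, ← hBset hφ.wirtBar, ← hBset hφ] at t
  have t0 : ∫ w in g.source ∩ g ⁻¹' B, (invWirt g a b B (g w) * wirtBar φ (g w) -
      l (g.symm (g w)) * invWirt g a b B (g w) * invWirtBar g a b B (g w) * φ (g w)) *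
        jac a b w = 0 := by
    rw [← key]
    refine setIntegral_congr_fun hSm fun w hw => ?_
    simp only [invWirt_of_mem (B := B) a b hw.1 hw.2, invWirtBar_of_mem (B := B) a b hw.1 hw.2, g.left_inv hw.1]
    by_cases h0 : jac a b w = 0
    · simp [(h.eq_zero_of_jac h0).1, h0]
    · have : (jac a b w : ℂ) ≠ 0 := by exact_mod_cast h0
      field_simp
      ring
  rw [t0] at t
  exact sub_eq_zero.1 ((mul_eq_zero.1 t.symm).resolve_left hc')

end QCData
end

noncomputable section

open MeasureTheory Set Filter Topology
open scoped ContDiff ComplexConjugate ENNReal Convolution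

/-- The Cauchy–Pompeiu formula for compactly supported functions. -/
theorem integral_wirtBar_div {φ : ℂ → ℂ} (hφ : ContDiff ℝ 1 φ) (hc : HasCompactSupport φ) :
    ∫ ζ, wirtBar φ ζ / ζ = -Real.pi * φ 0 := by
  set e : ℝ → ℂ := fun t => Real.cos t + Real.sin t * Complex.I with he
  have hecont : Continuous e := by simp only [he]; fun_prop
  have hede : ∀ t, HasDerivAt e (Complex.I * e t) t := fun t => by
    have h1 := (Real.hasDerivAt_cos t).ofReal_comp
    have h2 := ((Real.hasDerivAt_sin t).ofReal_comp).mul_const Complex.I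
    refine (h1.add h2).congr_deriv ?_
    simp only [he]
    push_cast
    linear_combination (-Complex.sin t) * Complex.I_sq
  have hee : ∀ t, conj (e t) * e t = 1 := fun t => by
    simp only [he, map_add, map_mul, Complex.conj_ofReal, Complex.conj_I]
    have := Complex.cos_sq_add_sin_sq (t : ℂ)
    push_cast
    linear_combination this - Complex.sin t ^ 2 * Complex.I_sq
  have hne : ∀ t, e t ≠ 0 := fun t h0 => by simpa [h0] using hee t
  have hfc : Continuous (fderiv ℝ φ) := hφ.continuous_fderiv (by simp)
  obtain ⟨R, hR0, hR⟩ : ∃ R, 0 < R ∧ tsupport φ ⊆ Metric.ball 0 R :=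
    (hc.isBounded).subset_ball_lt 0 0
  have hz : ∀ r t : ℝ, R ≤ r → (r : ℂ) * e t ∉ tsupport φ := fun r t hr hh => by
    have h1 := hR hh
    have h2 : ‖e t‖ = 1 := by
      have := congrArg norm (hee t)
      rw [norm_mul, Complex.norm_conj, norm_one] at this
      nlinarith [norm_nonneg (e t)]
    rw [mem_ball_zero_iff, norm_mul, h2, Complex.norm_real, mul_one] at h1
    linarith [Real.le_norm_self r]
  set X : ℝ × ℝ → ℂ := fun p => fderiv ℝ φ (p.1 * e p.2) (e p.2) with hX
  set Y : ℝ × ℝ → ℂ := fun p => fderiv ℝ φ (p.1 * e p.2) (Complex.I * e p.2) with hY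
  have hpt : Continuous fun p : ℝ × ℝ => (p.1 : ℂ) * e p.2 :=
    (Complex.continuous_ofReal.comp continuous_fst).mul (hecont.comp continuous_snd)
  have hXc : Continuous X := (hfc.comp hpt).clm_apply (hecont.comp continuous_snd)
  have hYc : Continuous Y :=
    (hfc.comp hpt).clm_apply (continuous_const.mul (hecont.comp continuous_snd))
  have hint : ∀ Z : ℝ × ℝ → ℂ, Continuous Z → (∀ p : ℝ × ℝ, R ≤ p.1 → Z p = 0) →
      IntegrableOn Z (Ioi 0 ×ˢ Ioo (-Real.pi) Real.pi) := fun Z hZ h0 => by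
    have h1 : IntegrableOn Z (Icc 0 R ×ˢ Icc (-Real.pi) Real.pi) :=
      hZ.continuousOn.integrableOn_compact (isCompact_Icc.prod isCompact_Icc)
    have h2 : IntegrableOn Z (Ioc 0 R ×ˢ Ioo (-Real.pi) Real.pi) :=
      h1.mono_set (prod_mono Ioc_subset_Icc_self Ioo_subset_Icc_self)
    refine h2.of_forall_sdiff_eq_zero (measurableSet_Ioi.prod measurableSet_Ioo) fun p hp => h0 p ?_
    by_contra hn
    push Not at hn
    exact hp.2 ⟨⟨hp.1.1, hn.le⟩, hp.1.2⟩
  have hf0 : ∀ p : ℝ × ℝ, R ≤ p.1 → fderiv ℝ φ (p.1 * e p.2) = 0 := fun p hp =>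
    image_eq_zero_of_notMem_tsupport fun hh => hz p.1 p.2 hp (tsupport_fderiv_subset ℝ hh)
  have hXi := hint X hXc fun p hp => by simp [hX, hf0 p hp]
  have hYi := hint Y hYc fun p hp => by simp [hY, hf0 p hp]
  have hXint : ∫ p in Ioi 0 ×ˢ Ioo (-Real.pi) Real.pi, X p = -(2 * Real.pi) * φ 0 := by
    have h1 : Integrable X ((volume.restrict (Ioi 0)).prod
        (volume.restrict (Ioo (-Real.pi) Real.pi))) := by
      rw [Measure.prod_restrict]; exact hXi
    rw [Measure.volume_eq_prod, ← Measure.prod_restrict, integral_prod_symm _ h1]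
    have h2 : ∀ t, ∫ r in Ioi (0 : ℝ), X (r, t) = -φ 0 := fun t => by
      have hd : ∀ r ∈ Ici (0 : ℝ), HasDerivAt (fun r : ℝ => φ (r * e t)) (X (r, t)) r := fun r _ => by
        have h3 : HasDerivAt (fun r : ℝ => (r : ℂ) * e t) (e t) r := by
          simpa using (HasDerivAt.ofReal_comp (hasDerivAt_id r)).mul_const (e t)
        exact (hφ.differentiable (by simp) (r * e t)).hasFDerivAt.comp_hasDerivAt r h3
      have hi : IntegrableOn (fun r => X (r, t)) (Ioi 0) := by
        have h4 : IntegrableOn (fun r => X (r, t)) (Ioc 0 R) :=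
          ((hXc.comp (Continuous.prodMk_left t)).continuousOn.integrableOn_compact
            isCompact_Icc).mono_set Ioc_subset_Icc_self
        refine h4.of_forall_sdiff_eq_zero measurableSet_Ioi fun r hr => ?_
        have : R ≤ r := by
          by_contra hn
          push Not at hn
          exact hr.2 ⟨hr.1, hn.le⟩
        simp [hX, hf0 (r, t) this]
      have ht : Tendsto (fun r : ℝ => φ (r * e t)) atTop (𝓝 0) := by
        refine tendsto_const_nhds.congr' ?_
        filter_upwards [eventually_ge_atTop R] with r hr
        exact (image_eq_zero_of_notMem_tsupport (hz r t hr)).symm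
      rw [integral_Ioi_of_hasDerivAt_of_tendsto' hd hi ht]
      simp
    simp_rw [h2]
    rw [setIntegral_const, Measure.real, Real.volume_Ioo, ENNReal.toReal_ofReal (by
      linarith [Real.pi_pos]), Complex.real_smul]
    push_cast
    ring
  have hYint : ∫ p in Ioi 0 ×ˢ Ioo (-Real.pi) Real.pi, Y p = 0 := by
    rw [Measure.volume_eq_prod, setIntegral_prod _ hYi]
    refine setIntegral_eq_zero_of_forall_eq_zero fun r hr => ?_
    have hr' : (r : ℂ) ≠ 0 := by exact_mod_cast (ne_of_gt hr)
    have hd : ∀ t, HasDerivAt (fun t => φ (r * e t) / r) (Y (r, t)) t := fun t => by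
      have h1 : HasDerivAt (fun t => (r : ℂ) * e t) (r * (Complex.I * e t)) t :=
        (hede t).const_mul _
      have h2 := ((hφ.differentiable (by simp) (r * e t)).hasFDerivAt.comp_hasDerivAt t h1).div_const
        (r : ℂ)
      refine h2.congr_deriv ?_
      simp only [hY]
      rw [fderiv_apply_wirt, fderiv_apply_wirt]
      simp only [map_mul, Complex.conj_ofReal]
      field_simp
    have h3 := intervalIntegral.integral_eq_sub_of_hasDerivAt (a := -Real.pi) (b := Real.pi)
      (fun t _ => hd t) ((hYc.comp (Continuous.prodMk_right r)).intervalIntegrable _ _)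
    rw [intervalIntegral.integral_of_le (by linarith [Real.pi_pos]),
      ← setIntegral_congr_set Ioo_ae_eq_Ioc] at h3
    rw [h3]
    simp [he]
  rw [← Complex.integral_comp_polarCoord_symm]
  have hkey : ∫ p in polarCoord.target, p.1 • (wirtBar φ (Complex.polarCoord.symm p) /
      Complex.polarCoord.symm p) = ∫ p in Ioi 0 ×ˢ Ioo (-Real.pi) Real.pi,
      ((1 / 2 : ℂ) * X p + (Complex.I / 2) * Y p) := by
    refine setIntegral_congr_fun (measurableSet_Ioi.prod measurableSet_Ioo) fun p hp => ?_
    have hp' : (p.1 : ℂ) ≠ 0 := by exact_mod_cast (ne_of_gt hp.1)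
    have h1 := hne p.2
    have h2 := hee p.2
    simp only [hX, hY, Complex.polarCoord_symm_apply, Complex.real_smul]
    rw [fderiv_apply_wirt, fderiv_apply_wirt]
    change (p.1 : ℂ) * (wirtBar φ (p.1 * e p.2) / (p.1 * e p.2)) = _
    simp only [map_mul, Complex.conj_I]
    have h3 : conj (e p.2) = 1 / e p.2 := by field_simp; exact h2
    rw [h3]
    field_simp
    ring_nf
    rw [Complex.I_sq]
    ring
  rw [hkey, integral_add (hXi.const_mul _) (hYi.const_mul _), integral_const_mul,
    integral_const_mul, hXint, hYint]
  ring

theorem memLp_inv_ball {q : ℝ} (hq0 : 0 < q) (hq : q < 2) (R : ℝ) :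
    MemLp (fun ζ : ℂ => ζ⁻¹) (ENNReal.ofReal q) (volume.restrict (Metric.ball 0 R)) := by
  have hm : Measurable (fun ζ : ℂ => ζ⁻¹) := measurable_inv
  rw [← integrable_norm_rpow_iff hm.aestronglyMeasurable (by simpa using hq0) (by simp),
    ENNReal.toReal_ofReal hq0.le]
  have := (integrableOn_fun_norm_addHaar (E := ℂ) (μ := volume) (f := fun y : ℝ => y ^ (-q))
    (r := R)).2 ?_
  · refine this.congr_fun (fun ζ _ => ?_) Metric.isOpen_ball.measurableSet
    simp only [norm_inv]
    rw [Real.inv_rpow (norm_nonneg _), Real.rpow_neg (norm_nonneg _)]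
  · have h1 : IntegrableOn (fun y : ℝ => y ^ (1 - q)) (Ioo 0 R) := by
      rcases le_or_gt R 0 with hR | hR
      · simp [Ioo_eq_empty (not_lt.2 hR)]
      · have := intervalIntegral.intervalIntegrable_rpow' (a := 0) (b := R) (r := 1 - q)
          (by linarith)
        exact ((intervalIntegrable_iff_integrableOn_Ioo_of_le hR.le).1 this)
    refine h1.congr_fun (fun y hy => ?_) measurableSet_Ioo
    simp only [Complex.finrank_real_complex, smul_eq_mul]
    rw [show 2 - 1 = 1 from rfl, pow_one, sub_eq_add_neg, Real.rpow_add hy.1, Real.rpow_one]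

theorem locallyIntegrable_inv : LocallyIntegrable (fun ζ : ℂ => ζ⁻¹) := by
  refine (locallyIntegrable_iff).2 fun K hK => ?_
  obtain ⟨R, hR⟩ := hK.isBounded.subset_ball 0
  have := memLp_inv_ball one_pos one_lt_two R
  rw [ENNReal.ofReal_one] at this
  exact IntegrableOn.mono_set (memLp_one_iff_integrable.1 this) hR

theorem exists_wirtBar_eq {A : ℂ → ℂ} (hA : ContDiff ℝ 1 A) (hc : HasCompactSupport A) :
    ∃ s : ℂ → ℂ, ContDiff ℝ 1 s ∧ ∀ z, wirtBar s z = A z := by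
  set L := ContinuousLinearMap.mul ℝ ℂ
  set S : ℂ → ℂ := (fun ζ : ℂ => ζ⁻¹) ⋆[L, volume] A with hS
  have hSd : ContDiff ℝ 1 S := hc.contDiff_convolution_right L locallyIntegrable_inv hA
  have hfd : ∀ z v, fderiv ℝ S z v = ∫ ζ, ζ⁻¹ * fderiv ℝ A (z - ζ) v := fun z v => by
    rw [hS, (hc.hasFDerivAt_convolution_right L locallyIntegrable_inv hA z).fderiv,
      convolution_precompR_apply _ locallyIntegrable_inv (hc.fderiv ℝ)
        (hA.continuous_fderiv (by simp)), convolution_def]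
    rfl
  have hint : ∀ z v, Integrable (fun ζ => ζ⁻¹ * fderiv ℝ A (z - ζ) v) := fun z v => by
    have h1 : Continuous fun ζ => fderiv ℝ A (z - ζ) v :=
      ((hA.continuous_fderiv (by simp)).comp (continuous_const.sub continuous_id)).clm_apply
        continuous_const
    have h2 : HasCompactSupport fun ζ => fderiv ℝ A (z - ζ) v :=
      ((hc.fderiv_apply ℝ v)).comp_homeomorph (Homeomorph.subLeft z)
    have := locallyIntegrable_inv.integrable_smul_left_of_hasCompactSupport h1 h2
    simpa [mul_comm] using this
  refine ⟨fun z => (Real.pi : ℂ)⁻¹ * S z, contDiff_const.mul hSd, fun z => ?_⟩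
  have hpi : (Real.pi : ℂ) ≠ 0 := by exact_mod_cast Real.pi_ne_zero
  have h1 : wirtBar S z = ∫ ζ, ζ⁻¹ * wirtBar A (z - ζ) := by
    simp only [wirtBar]
    rw [hfd, hfd, ← integral_const_mul, ← integral_add (hint z 1) ((hint z _).const_mul _),
      ← integral_div]
    congr 1; ext ζ; ring
  have h2 : HasCompactSupport fun ζ => A (z - ζ) := hc.comp_homeomorph (Homeomorph.subLeft z)
  have h3 := integral_wirtBar_div (hA.comp (contDiff_const.sub contDiff_id)) h2
  have h4 : ∀ ζ, wirtBar (A ∘ fun ζ => z - id ζ) ζ = -wirtBar A (z - ζ) := fun ζ => by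
    have hd : HasFDerivAt (fun ζ => z - ζ) (wirtL (-1) 0) ζ := by
      refine ((hasFDerivAt_id ζ).const_sub z).congr_fderiv (ContinuousLinearMap.ext fun v => ?_)
      simp
    have := ((hA.differentiable (by simp) (z - ζ)).hasFDerivAt_wirtL).wirtL_comp
      (k := fun ζ => z - ζ) hd
    have h5 := this.wirtBar_eq
    simp only [map_neg, map_one, mul_zero, mul_neg, mul_one, zero_add] at h5
    exact h5
  simp_rw [h4, neg_div] at h3
  rw [integral_neg] at h3
  have h6 := (((hSd.differentiable (by simp) z).hasFDerivAt_wirtL).const_mul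
    ((Real.pi : ℂ)⁻¹))
  have h7 : wirtBar (fun z => (Real.pi : ℂ)⁻¹ * S z) z = (Real.pi : ℂ)⁻¹ * wirtBar S z := by
    refine HasFDerivAt.wirtBar_eq (α := (Real.pi : ℂ)⁻¹ * wirt S z) (h6.congr_fderiv
      (ContinuousLinearMap.ext fun v => ?_))
    simp; ring
  rw [h7, h1]
  have h8 : ∫ ζ, ζ⁻¹ * wirtBar A (z - ζ) = ∫ ζ, wirtBar A (z - ζ) / ζ := by
    congr 1; ext ζ; rw [div_eq_inv_mul]
  rw [h8, neg_eq_iff_eq_neg.1 h3]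
  simp

end

noncomputable section

open MeasureTheory Set Filter Topology
open scoped ContDiff ComplexConjugate ENNReal Convolution

instance holderTriple_inv_bound : ENNReal.HolderTriple (ENNReal.ofReal (4 / 3)) 4 1 := by
  have h : ENNReal.ofReal (4 / 3) = 4 / 3 := by
    rw [ENNReal.ofReal_div_of_pos (by norm_num)]; simp
  refine ⟨?_⟩
  rw [h, ENNReal.inv_div (by simp) (by simp), inv_one, ← one_div, ENNReal.div_add_div_same]
  norm_num
  exact ENNReal.div_self (by simp) (by simp)

theorem enorm_le_eLpNorm_wirtBar (R : ℝ) : ∃ C : ℝ≥0∞, C ≠ ⊤ ∧ ∀ y : ℂ → ℂ, ContDiff ℝ 1 y →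
    tsupport y ⊆ Metric.closedBall 0 R → ∀ z, ‖y z‖ₑ ≤ C * eLpNorm (wirtBar y) 4 := by
  set κ : ℂ → ℂ := fun ζ => ζ⁻¹
  have hκ := memLp_inv_ball (q := 4 / 3) (by norm_num) (by norm_num) (2 * R + 1)
  set B := Metric.ball (0 : ℂ) (2 * R + 1) with hB
  refine ⟨ENNReal.ofReal (1 / Real.pi) * eLpNorm κ (ENNReal.ofReal (4 / 3)) (volume.restrict B),
    ENNReal.mul_ne_top ENNReal.ofReal_ne_top hκ.2.ne, fun y hy hyR z => ?_⟩
  have hyc : HasCompactSupport y :=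
    (isCompact_closedBall _ _).of_isClosed_subset (isClosed_tsupport _) hyR
  by_cases hz : z ∈ Metric.closedBall 0 R
  swap
  · rw [image_eq_zero_of_notMem_tsupport fun hh => hz (hyR hh)]
    simp
  have h1 := integral_wirtBar_div (φ := fun ζ => y (ζ + z)) (hy.comp (contDiff_id.add contDiff_const))
    (hyc.comp_homeomorph (Homeomorph.addRight z))
  have hwb : Continuous (wirtBar y) := (hy.wirtBar (m := 0) (by simp)).continuous
  have h2 : ∀ ζ, wirtBar (fun ζ => y (ζ + z)) ζ = wirtBar y (ζ + z) := fun ζ => by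
    have hd : HasFDerivAt (fun ζ => ζ + z) (wirtL 1 0) ζ := by
      refine ((hasFDerivAt_id ζ).add_const z).congr_fderiv (ContinuousLinearMap.ext fun v => ?_)
      simp
    simpa using (((hy.differentiable (by simp) (ζ + z)).hasFDerivAt_wirtL).wirtL_comp
      (k := fun ζ => ζ + z) hd).wirtBar_eq
  simp_rw [h2, zero_add] at h1
  have hpi : (Real.pi : ℂ) ≠ 0 := by exact_mod_cast Real.pi_ne_zero
  have h3 : y z = -((1 / Real.pi : ℝ) : ℂ) * ∫ ζ in B, κ ζ * wirtBar y (ζ + z) := by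
    rw [setIntegral_eq_integral_of_forall_compl_eq_zero]
    · simp_rw [κ, inv_mul_eq_div, h1]
      push_cast
      field_simp
    · intro ζ hζ
      rw [image_eq_zero_of_notMem_tsupport (f := wirtBar y), mul_zero]
      intro hh
      have h4 := hyR (tsupport_wirtBar_subset _ hh)
      rw [mem_closedBall_zero_iff] at h4 hz
      rw [hB, mem_ball_zero_iff, not_lt] at hζ
      have := norm_sub_le (ζ + z) z
      rw [add_sub_cancel_right] at this
      linarith
  rw [h3, enorm_mul, enorm_neg, mul_assoc]
  gcongr
  · rw [← ofReal_norm, Complex.norm_real, Real.norm_of_nonneg (by positivity)]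
  refine (enorm_integral_le_lintegral_enorm _).trans ?_
  rw [← eLpNorm_one_eq_lintegral_enorm]
  refine (eLpNorm_smul_le_mul_eLpNorm (p := ENNReal.ofReal (4 / 3)) (q := 4) (r := 1)
    (f := fun ζ => wirtBar y (ζ + z)) (φ := κ)
    (hwb.comp (continuous_id.add continuous_const)).aestronglyMeasurable hκ.1).trans ?_
  gcongr
  refine (eLpNorm_mono_measure _ Measure.restrict_le_self).trans ?_
  exact (eLpNorm_comp_measurePreserving (g := wirtBar y) hwb.aestronglyMeasurable
    (measurePreserving_add_right volume z)).le

theorem eLpNorm_wirt_eq {U : Set ℂ} {y : ℂ → ℂ} (hy : IsTest U y) :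
    eLpNorm (wirt y) 2 = eLpNorm (wirtBar y) 2 := by
  have hI : ∀ {φ : ℂ → ℂ}, IsTest U φ → Integrable (fun w => φ w * conj (φ w)) := fun hφ =>
    (hφ.continuous.mul (Complex.continuous_conj.comp hφ.continuous)).integrable_of_hasCompactSupport
      hφ.compact.mul_right
  have key : ∫ w, wirt y w * conj (wirt y w) = ∫ w, wirtBar y w * conj (wirtBar y w) := by
    have hw := HasWeakWirt.of_contDiffOn isOpen_univ
      (hy.contDiff.of_le (by simp) : ContDiff ℝ 1 y).contDiffOn
    have e1 := hw.integral_wirt _ hy.star.wirtBar.contDiff hy.star.wirtBar.compact (subset_univ _)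
    have e2 := hw.integral_wirtBar _ hy.star.wirt.contDiff hy.star.wirt.compact (subset_univ _)
    have e3 : ∀ w, wirtBar (wirt fun w => conj (y w)) w = wirt (wirtBar fun w => conj (y w)) w :=
      fun w => wirtBar_wirt_comm isOpen_univ ((contDiff_infty.1 hy.star.contDiff 2).contDiffOn)
        (mem_univ w)
    simp_rw [e3] at e2
    rw [e1] at e2
    simp_rw [hy.wirtBar_star, hy.wirt_star] at e2
    exact neg_injective e2
  have h2 : ∀ {φ : ℂ → ℂ}, IsTest U φ →
      eLpNorm φ 2 = ENNReal.ofReal (∫ w, ‖φ w‖ ^ 2) ^ (1 / 2 : ℝ) := fun {φ} hφ => by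
    rw [eLpNorm_eq_lintegral_rpow_enorm_toReal (by simp) (by simp),
      ofReal_integral_eq_lintegral_ofReal]
    · congr 2 with w
      rw [ENNReal.ofReal_pow (norm_nonneg _), ofReal_norm]
      simp
    · have := (hI hφ).norm
      simpa [← sq] using this
    · exact Eventually.of_forall fun w => by positivity
  rw [h2 hy.wirt, h2 hy.wirtBar]
  congr 2
  have h3 : ∀ φ : ℂ → ℂ, ∫ w, φ w * conj (φ w) = ((∫ w, ‖φ w‖ ^ 2 : ℝ) : ℂ) := fun φ => by
    rw [← integral_complex_ofReal]
    congr 1; ext w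
    rw [Complex.mul_conj, Complex.normSq_eq_norm_sq]
  rw [h3, h3] at key
  exact_mod_cast key

theorem eLpNorm_fderiv_le {U : Set ℂ} {y : ℂ → ℂ} (hy : IsTest U y) :
    eLpNorm (fderiv ℝ y) 2 ≤ 2 * eLpNorm (wirtBar y) 2 := by
  have m1 : AEStronglyMeasurable (fun w => ‖wirt y w‖) (volume : Measure ℂ) :=
    hy.wirt.continuous.norm.aestronglyMeasurable
  have m2 : AEStronglyMeasurable (fun w => ‖wirtBar y w‖) (volume : Measure ℂ) :=
    hy.wirtBar.continuous.norm.aestronglyMeasurable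
  have h5 := eLpNorm_add_le (p := 2) m1 m2 one_le_two
  rw [eLpNorm_norm, eLpNorm_norm, eLpNorm_wirt_eq hy, ← two_mul] at h5
  refine le_trans (eLpNorm_mono_real fun w => ?_) h5
  rw [fderiv_eq_wirtL]
  exact norm_wirtL_le _ _

theorem eLpNorm_eight_le_wirtBar (R : ℝ) : ∃ C : ℝ≥0∞, C ≠ ⊤ ∧ ∀ y : ℂ → ℂ, IsTest univ y →
    tsupport y ⊆ Metric.closedBall 0 R → eLpNorm y 8 ≤ C * eLpNorm (wirtBar y) 2 := by
  set B := Metric.closedBall (0 : ℂ) R with hB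
  set C₁ := eLpNormLESNormFDerivOfLeConst ℂ (volume : Measure ℂ) B (8 / 5) 8
  refine ⟨C₁ * (volume B ^ (1 / (8 / 5 : ℝ) - 1 / 2) * 2), ENNReal.mul_ne_top (by simp)
    (ENNReal.mul_ne_top (ENNReal.rpow_ne_top_of_nonneg (by norm_num)
      measure_closedBall_lt_top.ne) (by simp)), fun y hy hyB => ?_⟩
  have h1 := eLpNorm_le_eLpNorm_fderiv_of_le (volume : Measure ℂ) (u := y) (s := B)
    (p := 8 / 5) (q := 8) (hy.contDiff.of_le (by simp)) ((subset_tsupport _).trans hyB)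
    (by rw [← NNReal.coe_le_coe]; push_cast; norm_num) (by
      rw [Complex.finrank_real_complex, ← NNReal.coe_lt_coe]; push_cast; norm_num)
    (by rw [Complex.finrank_real_complex]; push_cast; norm_num) Metric.isBounded_closedBall
  have hfc : Continuous (fderiv ℝ y) := hy.contDiff.continuous_fderiv (by simp)
  have h2 : eLpNorm (fderiv ℝ y) ((8 / 5 : NNReal) : ℝ≥0∞) =
      eLpNorm (fderiv ℝ y) ((8 / 5 : NNReal) : ℝ≥0∞) (volume.restrict B) := by
    have hind : B.indicator (fderiv ℝ y) = fderiv ℝ y := by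
      refine indicator_eq_self.2 ((subset_tsupport _).trans ?_)
      exact (tsupport_fderiv_subset ℝ).trans hyB
    rw [← eLpNorm_indicator_eq_eLpNorm_restrict Metric.isClosed_closedBall.measurableSet, hind]
  have hle : ((8 / 5 : NNReal) : ℝ≥0∞) ≤ 2 := by
    have : (8 / 5 : NNReal) ≤ 2 := by rw [← NNReal.coe_le_coe]; push_cast; norm_num
    exact_mod_cast this
  have h3 := eLpNorm_le_eLpNorm_mul_rpow_measure_univ (μ := volume.restrict B) hle
    (f := fderiv ℝ y) hfc.aestronglyMeasurable
  have h4 : eLpNorm (fderiv ℝ y) 2 (volume.restrict B) ≤ 2 * eLpNorm (wirtBar y) 2 :=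
    (eLpNorm_mono_measure _ Measure.restrict_le_self).trans (eLpNorm_fderiv_le hy)
  refine (h1.trans (mul_le_mul_right (h2.le.trans (h3.trans (mul_le_mul_left h4 _))) _)).trans
    (le_of_eq ?_)
  simp only [Measure.restrict_apply_univ]
  have : ((8 / 5 : NNReal) : ℝ≥0∞).toReal = 8 / 5 := by simp
  rw [this, ENNReal.toReal_ofNat]
  ring

end

noncomputable section

open MeasureTheory Set Filter Topology
open scoped ContDiff ComplexConjugate ENNReal Convolution

theorem tsupport_moll_subset {u : ℂ → ℂ} {R : ℝ} (hu : tsupport u ⊆ Metric.closedBall 0 R) (n : ℕ) :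
    tsupport (moll n u) ⊆ Metric.closedBall 0 (R + 1) := by
  refine closure_minimal (fun z hz => ?_) Metric.isClosed_closedBall
  by_contra hn
  apply hz
  rw [moll_apply]
  refine integral_eq_zero_of_ae (Eventually.of_forall fun t => ?_)
  by_cases ht : t ∈ tsupport u
  · have h1 : mollKer n (z - t) = 0 := by
      by_contra h0
      have h2 : z - t ∈ Function.support ((mollBump n).normed volume) := h0
      rw [ContDiffBump.support_normed_eq, mem_ball_zero_iff] at h2
      have h3 : (mollBump n).rOut ≤ 1 := by
        simp only [mollBump]
        rw [div_le_one (by positivity)]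
        linarith [(Nat.cast_nonneg n : (0 : ℝ) ≤ n)]
      have h4 := mem_closedBall_zero_iff.1 (hu ht)
      apply hn
      rw [mem_closedBall_zero_iff]
      have := norm_add_le (z - t) t
      rw [sub_add_cancel] at this
      linarith
    simp [h1]
  · simp [image_eq_zero_of_notMem_tsupport ht]

theorem MemLpLoc.memLp_of_hasCompactSupport {p : ℝ≥0∞} {u : ℂ → ℂ} (hu : MemLpLoc p univ u)
    (hc : HasCompactSupport u) : MemLp u p := by
  have h := hu _ (subset_univ _) hc
  rw [← memLp_indicator_iff_restrict (isClosed_tsupport u).measurableSet] at h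
  rwa [indicator_eq_self.2 (subset_tsupport u)] at h

theorem MemLpLoc.memLp_mul_test {p : ℝ≥0∞} {U : Set ℂ} {u φ : ℂ → ℂ} (hu : MemLpLoc p U u)
    (hφ : IsTest U φ) : MemLp (fun w => u w * φ w) p := by
  have h := (hu.mul (q := ⊤) (r := p) (.of_continuousOn hφ.continuous.continuousOn)) _ hφ.subset
    hφ.compact
  rw [← memLp_indicator_iff_restrict (isClosed_tsupport φ).measurableSet] at h
  rwa [indicator_eq_self.2 fun w hw => subset_tsupport φ fun h0 => hw (by simp [h0])] at h

namespace HasWeakBar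
variable {y G : ℂ → ℂ}

theorem integrable_of_hasCompactSupport (h : HasWeakBar univ y G) (hc : HasCompactSupport y) :
    Integrable y := memLp_one_iff_integrable.1 (h.memLpLoc.memLp_of_hasCompactSupport hc)

/-- A gain of integrability for compactly supported functions with square integrable `y_{w̄}`. -/
theorem memLp_eight (h : HasWeakBar univ y G) (hc : HasCompactSupport y) (hG : MemLp G 2) :
    MemLp y 8 := by
  have hi := h.integrable_of_hasCompactSupport hc
  obtain ⟨R, hR⟩ := hc.isBounded.subset_closedBall 0
  obtain ⟨C, hC, hle⟩ := eLpNorm_eight_le_wirtBar (R + 1)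
  have hb : ∀ n, eLpNorm (moll n y) 8 ≤ C * eLpNorm G 2 := fun n => by
    refine (hle _ (isTest_moll hi hc n) (tsupport_moll_subset hR n)).trans ?_
    rw [wirtBar_moll h]
    gcongr
    exact eLpNorm_moll_le one_le_two (by simp) hG.1 n
  refine ⟨hi.1, lt_of_le_of_lt (Lp.eLpNorm_lim_le_liminf_eLpNorm (f := fun n => moll n y)
    (fun n => (contDiff_moll hi.locallyIntegrable n).continuous.aestronglyMeasurable) y
    (ae_tendsto_moll hi.locallyIntegrable)) ?_⟩
  refine lt_of_le_of_lt ?_ (ENNReal.mul_lt_top hC.lt_top hG.2)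
  exact liminf_le_of_frequently_le' (Eventually.of_forall hb).frequently

/-- Compactly supported functions with `y_{w̄}` in `L⁴` are continuous. -/
theorem exists_continuous (h : HasWeakBar univ y G) (hc : HasCompactSupport y) (hG : MemLp G 4) :
    ∃ v : ℂ → ℂ, Continuous v ∧ y =ᵐ[volume] v := by
  have hi := h.integrable_of_hasCompactSupport hc
  obtain ⟨R, hR⟩ := hc.isBounded.subset_closedBall 0
  obtain ⟨C, hC, hle⟩ := enorm_le_eLpNorm_wirtBar (R + 1)
  have hyn := fun n => isTest_moll hi hc n
  set e : ℕ → ℝ≥0∞ := fun n => eLpNorm (fun z => moll n G z - G z) 4 with he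
  have he0 : Tendsto e atTop (𝓝 0) := tendsto_eLpNorm_moll (by norm_num) (by simp) hG
  have hGn : ∀ n, AEStronglyMeasurable (moll n G) volume := fun n => by
    rw [← wirtBar_moll h]; exact (hyn n).wirtBar.continuous.aestronglyMeasurable
  have hb : ∀ n m z, ‖moll n y z - moll m y z‖ₑ ≤ C * (e n + e m) := fun n m z => by
    have hs : tsupport (fun z => moll n y z - moll m y z) ⊆ Metric.closedBall 0 (R + 1) :=
      (tsupport_sub _ _).trans (union_subset (tsupport_moll_subset hR n) (tsupport_moll_subset hR m))
    refine (hle (fun z => moll n y z - moll m y z)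
      (((hyn n).contDiff.sub (hyn m).contDiff).of_le (by simp)) hs z).trans ?_
    gcongr
    have h1 : wirtBar (fun z => moll n y z - moll m y z) =
        (fun z => moll n G z - G z) - fun z => moll m G z - G z := by
      ext z
      rw [← wirtBar_moll h n, ← wirtBar_moll h m]
      simp only [wirtBar, Pi.sub_apply]
      rw [fderiv_fun_sub ((hyn n).differentiable z) ((hyn m).differentiable z)]
      simp only [sub_apply]
      ring
    rw [h1]
    exact eLpNorm_sub_le ((hGn n).sub hG.1) ((hGn m).sub hG.1) (by norm_num)
  have hcau : UniformCauchySeqOn (fun n => moll n y) atTop univ := by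
    rw [Metric.uniformCauchySeqOn_iff]
    intro ε hε
    have h1 : Tendsto (fun p : ℕ × ℕ => C * (e p.1 + e p.2)) (atTop ×ˢ atTop) (𝓝 0) := by
      have := ENNReal.Tendsto.const_mul ((he0.comp tendsto_fst).add (he0.comp tendsto_snd))
        (a := C) (Or.inr hC)
      simpa using this
    have h2 := h1.eventually (gt_mem_nhds (ENNReal.ofReal_pos.2 hε))
    rw [prod_atTop_atTop_eq, eventually_atTop] at h2
    obtain ⟨N, hN⟩ := h2
    refine ⟨max N.1 N.2, fun m hm n hn z _ => ?_⟩
    rw [← edist_lt_ofReal, edist_eq_enorm_sub]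
    exact (hb m n z).trans_lt (hN (m, n) ⟨(le_max_left _ _).trans hm, (le_max_right _ _).trans hn⟩)
  have hlim : ∀ z, ∃ l, Tendsto (fun n => moll n y z) atTop (𝓝 l) := fun z =>
    cauchySeq_tendsto_of_complete (hcau.cauchySeq (mem_univ z))
  choose v hv using hlim
  refine ⟨v, ?_, ?_⟩
  · have := hcau.tendstoUniformlyOn_of_tendsto fun z _ => hv z
    exact (tendstoUniformlyOn_univ.1 this).continuous
      (Eventually.of_forall fun n => (hyn n).continuous).frequently
  · filter_upwards [ae_tendsto_moll hi.locallyIntegrable] with z hz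
    exact tendsto_nhds_unique hz (hv z)

theorem memLpLoc_eight {U : Set ℂ} (hU : IsOpen U) (h : HasWeakBar U y G) (hy : MemLpLoc 2 U y)
    (hG : MemLpLoc 2 U G) : MemLpLoc 8 U y := fun K hKU hK => by
  obtain ⟨χ, hχ, -, -, V, hV, hKV, hVU, hχV⟩ := exists_cutoff hK hU hKU
  have h1 := h.cutoff hχ
  have h2 : MemLp (fun w => y w * wirtBar (fun w => (χ w : ℂ)) w + G w * χ w) 2 :=
    (hy.memLp_mul_test hχ.wirtBar).add (hG.memLp_mul_test hχ)
  have := (h1.memLp_eight hχ.compact.mul_left h2).restrict K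
  exact (memLp_congr_ae ((ae_restrict_iff' hK.measurableSet).2 (Eventually.of_forall fun w hw => by
    simp [hχV w (hKV hw)]))).1 this

theorem exists_continuous_on {U K : Set ℂ} (hU : IsOpen U) (h : HasWeakBar U y G)
    (hy : MemLpLoc 4 U y) (hG : MemLpLoc 4 U G) (hK : IsCompact K) (hKU : K ⊆ U) :
    ∃ v : ℂ → ℂ, Continuous v ∧ y =ᵐ[volume.restrict K] v := by
  obtain ⟨χ, hχ, -, -, V, hV, hKV, hVU, hχV⟩ := exists_cutoff hK hU hKU
  have h1 := h.cutoff hχ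
  have h2 : MemLp (fun w => y w * wirtBar (fun w => (χ w : ℂ)) w + G w * χ w) 4 :=
    (hy.memLp_mul_test hχ.wirtBar).add (hG.memLp_mul_test hχ)
  obtain ⟨v, hv, he⟩ := h1.exists_continuous hχ.compact.mul_left h2
  refine ⟨v, hv, (ae_restrict_iff' hK.measurableSet).2 ?_⟩
  filter_upwards [he] with w hw hwK
  rw [← hw, hχV w (hKV hwK)]
  simp

end HasWeakBar

theorem HasWeakWirt.hasFDerivAt_of_continuous {u a b : ℂ → ℂ} (h : HasWeakWirt univ u a b)
    (hu : Continuous u) (ha : Continuous a) (hb : Continuous b) (huc : HasCompactSupport u)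
    (hac : HasCompactSupport a) (hbc : HasCompactSupport b) (z : ℂ) :
    HasFDerivAt u (wirtL (a z) (b z)) z := by
  have hi := hu.integrable_of_hasCompactSupport huc (μ := (volume : Measure ℂ))
  refine hasFDerivAt_of_tendstoUniformly (l := atTop) (f := fun n => moll n u)
    (f' := fun n z => wirtL (moll n a z) (moll n b z)) (g' := fun z => wirtL (a z) (b z)) ?_
    (fun n z => ?_) (fun z => (tendstoUniformly_moll hu huc).tendsto_at z) z
  · have ta := tendstoUniformly_moll ha hac
    have tb := tendstoUniformly_moll hb hbc
    rw [Metric.tendstoUniformly_iff] at ta tb ⊢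
    intro ε hε
    filter_upwards [ta (ε / 2) (half_pos hε), tb (ε / 2) (half_pos hε)] with n h1 h2 z
    have h3 : wirtL (a z) (b z) - wirtL (moll n a z) (moll n b z) =
        wirtL (a z - moll n a z) (b z - moll n b z) :=
      ContinuousLinearMap.ext fun v => by simp; ring
    rw [dist_eq_norm, h3]
    refine (norm_wirtL_le _ _).trans_lt ?_
    have := h1 z
    have := h2 z
    rw [dist_eq_norm] at *
    linarith
  · rw [← wirt_moll h, ← wirtBar_moll h.bar]
    exact ((isTest_moll hi huc n).differentiable z).hasFDerivAt_wirtL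

theorem HasWeakWirt.hasFDerivAt_of_continuousOn {U : Set ℂ} (hU : IsOpen U) {u a b : ℂ → ℂ}
    (h : HasWeakWirt U u a b) (hu : ContinuousOn u U) (ha : ContinuousOn a U)
    (hb : ContinuousOn b U) {z : ℂ} (hz : z ∈ U) : HasFDerivAt u (wirtL (a z) (b z)) z := by
  obtain ⟨χ, hχ, -, -, V, hV, hKV, hVU, hχV⟩ := exists_cutoff (isCompact_singleton (x := z)) hU
    (singleton_subset_iff.2 hz)
  have hzV : z ∈ V := hKV rfl
  have hχc : ∀ {φ : ℂ → ℂ} {f : ℂ → ℂ}, IsTest U φ → ContinuousOn f U →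
      Continuous fun w => f w * φ w := fun {φ f} hφ hf => by
    refine continuous_iff_continuousAt.2 fun w => ?_
    by_cases hw : w ∈ U
    · exact (hf.continuousAt (hU.mem_nhds hw)).mul hφ.continuous.continuousAt
    · have h1 : φ =ᶠ[𝓝 w] 0 := notMem_tsupport_iff_eventuallyEq.1 fun hh => hw (hφ.subset hh)
      have h2 : (fun w => f w * φ w) =ᶠ[𝓝 w] fun _ => 0 := by
        filter_upwards [h1] with x hx
        simp [hx]
      exact continuousAt_const.congr h2.symm
  have h1 := (h.cutoff hχ).hasFDerivAt_of_continuous (hχc hχ hu)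
    ((hχc hχ.wirt hu).add (hχc hχ ha)) ((hχc hχ.wirtBar hu).add (hχc hχ hb))
    hχ.compact.mul_left (hχ.wirt.compact.mul_left.add hχ.compact.mul_left)
    (hχ.wirtBar.compact.mul_left.add hχ.compact.mul_left) z
  have h2 : (fun w => u w * χ w) =ᶠ[𝓝 z] u := by
    filter_upwards [hV.mem_nhds hzV] with w hw
    simp [hχV w hw]
  have h3 : fderiv ℝ (fun w => (χ w : ℂ)) z = 0 := by
    have : (fun w => (χ w : ℂ)) =ᶠ[𝓝 z] fun _ => 1 := by
      filter_upwards [hV.mem_nhds hzV] with w hw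
      simp [hχV w hw]
    rw [this.fderiv_eq, fderiv_const_apply]
  rw [wirt_eq_zero_of_fderiv h3, wirtBar_eq_zero_of_fderiv h3, hχV z hzV] at h1
  simpa using h1.congr_of_eventuallyEq h2.symm

end

noncomputable section

open MeasureTheory Set Filter Topology
open scoped ContDiff ComplexConjugate ENNReal

theorem HasWeakWirt.sub_const {U : Set ℂ} {f u v : ℂ → ℂ} (hU : IsOpen U) (h : HasWeakWirt U f u v)
    (c : ℂ) : HasWeakWirt U (fun z => f z - c) u v := by
  have h1 := h.add (HasWeakWirt.of_contDiffOn hU (contDiff_const (c := -c)).contDiffOn)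
  refine h1.congr hU (Eventually.of_forall fun z => by simp [sub_eq_add_neg])
    (Eventually.of_forall fun z => ?_) (Eventually.of_forall fun z => ?_)
  · simp [(hasFDerivAt_wirtL_const (-c) z).wirt_eq]
  · simp [(hasFDerivAt_wirtL_const (-c) z).wirtBar_eq]

theorem HasWeakWirt.sub {U : Set ℂ} {f u v f' u' v' : ℂ → ℂ} (h : HasWeakWirt U f u v)
    (h' : HasWeakWirt U f' u' v') : HasWeakWirt U (fun z => f z - f' z) (fun z => u z - u' z)
      (fun z => v z - v' z) := by
  have := h.add (h'.const_mul (-1))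
  simpa [sub_eq_add_neg] using this

theorem MeasureTheory.MemLp.integrable_norm_sq {p : ℂ → ℂ} (h : MemLp p 2) :
    Integrable fun z => ‖p z‖ ^ 2 := (memLp_two_iff_integrable_sq_norm h.1).1 h

namespace CompactSobolev
variable {U : Set ℂ} {θ a b : ℂ → ℂ}

theorem mul (h : CompactSobolev U θ a b) (hU : IsOpen U) {F c d : ℂ → ℂ} (hF : ContinuousOn F U)
    (hw : HasWeakWirt U F c d) (hc : MemLpLoc 2 U c) (hd : MemLpLoc 2 U d) :
    CompactSobolev U (fun z => F z * θ z) (fun z => c z * θ z + F z * a z)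
      (fun z => d z * θ z + F z * b z) := by
  obtain ⟨K, hK, hKU, h0⟩ := h.exists_compact
  have hF' : MemLpLoc ⊤ U F := .of_continuousOn hF
  have hθ : MemLpLoc ⊤ U θ := .of_continuousOn h.continuous.continuousOn
  refine .of_weak hU (hw.mul (h.weak.mono (subset_univ U)) hU hF' hθ)
    (hF.mul h.continuous.continuousOn) ((hc.mul hθ).add (hF'.mul (h.memLp_wirt.memLpLoc U)))
    ((hd.mul hθ).add (hF'.mul (h.memLp_wirtBar.memLpLoc U))) hK hKU fun w hw => ?_
  obtain ⟨h1, h2, h3⟩ := h0 w hw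
  simp [h1, h2, h3]

theorem star (h : CompactSobolev U θ a b) :
    CompactSobolev U (fun z => conj (θ z)) (fun z => conj (b z)) (fun z => conj (a z)) := by
  obtain ⟨K, hK, hKU, h0⟩ := h.exists_compact
  refine ⟨Complex.continuous_conj.comp h.continuous, h.weak.star, h.memLp_wirtBar.star,
    h.memLp_wirt.star, K, hK, hKU, fun w hw => ?_⟩
  obtain ⟨h1, h2, h3⟩ := h0 w hw
  simp [h1, h2, h3]

theorem eq_zero (h : CompactSobolev U θ a b) {z : ℂ} (hz : z ∉ U) : θ z = 0 ∧ a z = 0 ∧ b z = 0 := by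
  obtain ⟨K, -, hKU, h0⟩ := h.exists_compact
  exact h0 z fun hh => hz (hKU hh)

theorem hasCompactSupport (h : CompactSobolev U θ a b) : HasCompactSupport θ := by
  obtain ⟨K, hK, hKU, h0⟩ := h.exists_compact
  refine HasCompactSupport.of_support_subset_isCompact hK fun w hw => ?_
  by_contra hn
  exact hw (h0 w hn).1

theorem tsupport_subset (h : CompactSobolev U θ a b) : tsupport θ ⊆ U := by
  obtain ⟨K, hK, hKU, h0⟩ := h.exists_compact
  refine (closure_minimal (fun w hw => ?_) hK.isClosed).trans hKU
  by_contra hn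
  exact hw (h0 w hn).1

theorem memLp_mul (h : CompactSobolev U θ a b) {p : ℝ≥0∞} {u : ℂ → ℂ} (hu : MemLpLoc p U u) :
    MemLp (fun z => u z * θ z) p := by
  have h1 := (hu.mul (q := ⊤) (r := p) (.of_continuousOn h.continuous.continuousOn)) _
    h.tsupport_subset h.hasCompactSupport
  rw [← memLp_indicator_iff_restrict (isClosed_tsupport θ).measurableSet] at h1
  rwa [indicator_eq_self.2 fun w hw => subset_tsupport θ fun h0 => hw (by simp [h0])] at h1

theorem integrable_mul (h : CompactSobolev U θ a b) {u : ℂ → ℂ} (hu : MemLpLoc 1 U u) :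
    Integrable (fun z => u z * θ z) := memLp_one_iff_integrable.1 (h.memLp_mul hu)

theorem integrable_mul_wirtBar (h : CompactSobolev U θ a b) {u : ℂ → ℂ} (hu : MemLpLoc 2 U u) :
    Integrable (fun z => u z * b z) := by
  obtain ⟨K, hK, hKU, h0⟩ := h.exists_compact
  have h1 : MemLp (K.indicator u) 2 :=
    (memLp_indicator_iff_restrict hK.measurableSet).2 (hu K hKU hK)
  have h2 : MemLp (fun z => K.indicator u z * b z) 1 := h.memLp_wirtBar.mul' h1
  refine (memLp_one_iff_integrable.1 h2).congr (Eventually.of_forall fun z => ?_)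
  by_cases hz : z ∈ K
  · simp [hz]
  · simp [hz, (h0 z hz).2.2]

theorem integral_sq_eq (h : CompactSobolev U θ a b) : ∫ z, ‖a z‖ ^ 2 = ∫ z, ‖b z‖ ^ 2 := by
  have h1 := ((⟨h.continuous, h.weak, h.memLp_wirt, h.memLp_wirtBar, by
    obtain ⟨K, hK, -, h0⟩ := h.exists_compact
    exact ⟨K, hK, subset_univ _, h0⟩⟩ : CompactSobolev univ θ a b)).integral_jacobian isOpen_univ
      h.weak.star (h.memLp_wirtBar.star.memLpLoc univ) (h.memLp_wirt.star.memLpLoc univ)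
  have h2 : ∀ z, a z * conj (a z) - b z * conj (b z) = ((‖a z‖ ^ 2 - ‖b z‖ ^ 2 : ℝ) : ℂ) :=
    fun z => by
      rw [Complex.mul_conj, Complex.mul_conj, Complex.normSq_eq_norm_sq, Complex.normSq_eq_norm_sq]
      push_cast; rfl
  simp_rw [h2] at h1
  rw [integral_complex_ofReal] at h1
  have h3 : ∫ z, (‖a z‖ ^ 2 - ‖b z‖ ^ 2) = 0 := by exact_mod_cast h1
  rw [integral_sub h.memLp_wirt.integrable_norm_sq h.memLp_wirtBar.integrable_norm_sq] at h3
  linarith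

end CompactSobolev

theorem IsTest.compactSobolev {U : Set ℂ} {φ : ℂ → ℂ} (h : IsTest U φ) :
    CompactSobolev U φ (_root_.wirt φ) (_root_.wirtBar φ) := by
  refine ⟨h.continuous, .of_contDiffOn isOpen_univ (h.contDiff.of_le (by simp)).contDiffOn,
    h.wirt.continuous.memLp_of_hasCompactSupport h.wirt.compact,
    h.wirtBar.continuous.memLp_of_hasCompactSupport h.wirtBar.compact, tsupport φ, h.compact,
    h.subset, fun w hw => ⟨image_eq_zero_of_notMem_tsupport hw, ?_, ?_⟩⟩
  · exact image_eq_zero_of_notMem_tsupport fun hh => hw (tsupport_wirt_subset _ hh)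
  · exact image_eq_zero_of_notMem_tsupport fun hh => hw (tsupport_wirtBar_subset _ hh)

theorem integral_sq_le_of_norm_sub_le {p X : ℂ → ℂ} {q : ℂ → ℝ} (hp : MemLp p 2)
    (hX : Integrable X) (hX0 : ∫ z, X z = 0) (hq : Integrable q)
    (h : ∀ z, ‖p z * conj (p z) - X z‖ ≤ q z) : ∫ z, ‖p z‖ ^ 2 ≤ ∫ z, q z := by
  have h2 : ∀ z, p z * conj (p z) = ((‖p z‖ ^ 2 : ℝ) : ℂ) := fun z => by
    rw [Complex.mul_conj, Complex.normSq_eq_norm_sq]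
  have h1 : Integrable fun z => p z * conj (p z) :=
    memLp_one_iff_integrable.1 (hp.star.mul' hp)
  have h3 := norm_integral_le_of_norm_le hq (Eventually.of_forall h)
  rw [integral_sub h1 hX, hX0, sub_zero] at h3
  simp_rw [h2] at h3
  rw [integral_complex_ofReal, Complex.norm_real] at h3
  exact (Real.le_norm_self _).trans h3

/-- `f` is a weak solution of `f_{z z̄} + L f_z f_{z̄} = 0` on `U` with `|f_{z̄}| ≤ |f_z|`. -/
structure WeakHarmonic (U : Set ℂ) (f u v L : ℂ → ℂ) : Prop where
  isOpen : IsOpen U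
  continuousOn : ContinuousOn f U
  weak : HasWeakWirt U f u v
  memLpLoc_wirt : MemLpLoc 2 U u
  memLpLoc_wirtBar : MemLpLoc 2 U v
  norm_le : ∀ z, ‖v z‖ ≤ ‖u z‖
  continuousOn_coeff : ContinuousOn L U
  integral_eq : ∀ φ, IsTest U φ → ∫ z, u z * wirtBar φ z = ∫ z, L z * u z * v z * φ z

namespace WeakHarmonic
variable {U : Set ℂ} {f u v L f' u' v' L' : ℂ → ℂ} {f₀ : ℂ} {ε Λ : ℝ}

theorem memLpLoc_tension (h : WeakHarmonic U f u v L) :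
    MemLpLoc 1 U (fun z => L z * u z * v z) :=
  ((MemLpLoc.of_continuousOn (p := ⊤) h.continuousOn_coeff).mul (r := 2) h.memLpLoc_wirt).mul
    h.memLpLoc_wirtBar

theorem integral_sobolev (h : WeakHarmonic U f u v L) {θ a b : ℂ → ℂ}
    (hθ : CompactSobolev U θ a b) : ∫ z, (u z * b z - L z * u z * v z * θ z) = 0 := by
  have := hθ.integral_eq_zero h.isOpen (P := 0) (.of_continuousOn continuousOn_const)
    h.memLpLoc_wirt h.memLpLoc_tension.neg fun φ hφ => by
      have i1 := (h.memLpLoc_wirt.mono_exponent (p := 1) (by norm_num)).integrable_mul_test hφ.wirtBar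
      have i2 := h.memLpLoc_tension.integrable_mul_test hφ
      simp only [Pi.zero_apply, zero_mul, zero_add, neg_mul, ← sub_eq_add_neg]
      rw [integral_sub i1 (by simpa using i2), h.integral_eq φ hφ]
      simp
  rw [← this]
  congr 1; ext z
  simp [sub_eq_add_neg]

theorem integrable_sobolev (h : WeakHarmonic U f u v L) {θ a b : ℂ → ℂ}
    (hθ : CompactSobolev U θ a b) : Integrable (fun z => u z * b z - L z * u z * v z * θ z) :=
  (hθ.integrable_mul_wirtBar h.memLpLoc_wirt).sub (hθ.integrable_mul h.memLpLoc_tension)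

theorem integral_mul_sq_le (h : WeakHarmonic U f u v L) (hε : ∀ z ∈ U, ‖f z - f₀‖ ≤ ε)
    (hΛ : ∀ z ∈ U, ‖L z‖ ≤ Λ) (hεΛ : Λ * ε ≤ 1 / 2) {ξ ξ₁ ξ₂ : ℂ → ℂ}
    (hξ : CompactSobolev U ξ ξ₁ ξ₂) :
    ∫ z, ‖u z * ξ z‖ ^ 2 ≤ 8 * ε ^ 2 * ∫ z, (‖ξ₁ z‖ ^ 2 + ‖ξ₂ z‖ ^ 2) := by
  have h1 := hξ.mul h.isOpen hξ.star.continuous.continuousOn (hξ.star.weak.mono (subset_univ U))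
    (hξ.star.memLp_wirt.memLpLoc U) (hξ.star.memLp_wirtBar.memLpLoc U)
  have h2 := h1.mul (F := fun z => conj (f z - f₀)) h.isOpen (Complex.continuous_conj.comp_continuousOn
    (h.continuousOn.sub continuousOn_const)) (h.weak.sub_const h.isOpen f₀).star
    h.memLpLoc_wirtBar.star h.memLpLoc_wirt.star
  have hp := hξ.memLp_mul h.memLpLoc_wirt
  have hi : Integrable fun z => ‖ξ₁ z‖ ^ 2 + ‖ξ₂ z‖ ^ 2 :=
    (hξ.memLp_wirt.integrable_norm_sq).add hξ.memLp_wirtBar.integrable_norm_sq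
  have hq : Integrable fun z => 3 / 4 * ‖u z * ξ z‖ ^ 2 +
      2 * ε ^ 2 * (‖ξ₁ z‖ ^ 2 + ‖ξ₂ z‖ ^ 2) :=
    (hp.integrable_norm_sq.const_mul _).add (hi.const_mul _)
  have key := integral_sq_le_of_norm_sub_le hp (h.integrable_sobolev h2) (h.integral_sobolev h2) hq
    fun z => by
      by_cases hz : z ∈ U
      · have e0 : 0 ≤ ε := (norm_nonneg _).trans (hε z hz)
        have l0 : 0 ≤ Λ := (norm_nonneg _).trans (hΛ z hz)
        have e1 : u z * ξ z * conj (u z * ξ z) - (u z * (conj (u z) * (conj (ξ z) * ξ z) +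
            conj (f z - f₀) * (conj (ξ₁ z) * ξ z + conj (ξ z) * ξ₂ z)) -
            L z * u z * v z * (conj (f z - f₀) * (conj (ξ z) * ξ z))) =
            -(conj (f z - f₀) * (u z * ξ z) * conj (ξ₁ z)) -
            conj (f z - f₀) * (u z * conj (ξ z)) * ξ₂ z +
            L z * conj (f z - f₀) * (u z * ξ z) * (v z * conj (ξ z)) := by
          rw [map_mul]; ring
        rw [e1]
        refine (norm_add_le _ _).trans ?_
        refine (add_le_add_left (norm_sub_le _ _) _).trans ?_
        simp only [norm_neg, norm_mul, Complex.norm_conj]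
        have a1 := hε z hz
        have a2 := hΛ z hz
        have a3 := h.norm_le z
        set A := ‖u z‖ * ‖ξ z‖ with hA
        have hA0 : 0 ≤ A := by positivity
        have b1 : ‖f z - f₀‖ * A * ‖ξ₁ z‖ ≤ ε * A * ‖ξ₁ z‖ := by gcongr
        have b2 : ‖f z - f₀‖ * A * ‖ξ₂ z‖ ≤ ε * A * ‖ξ₂ z‖ := by gcongr
        have b3 : ‖L z‖ * ‖f z - f₀‖ * A * (‖v z‖ * ‖ξ z‖) ≤ Λ * ε * A * A := by
          rw [hA]; gcongr
        have b4 : Λ * ε * A * A ≤ 1 / 2 * A * A := by gcongr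
        nlinarith [sq_nonneg (A / 2 - ε * (‖ξ₁ z‖ + ‖ξ₂ z‖)),
          mul_nonneg (sq_nonneg ε) (sq_nonneg (‖ξ₁ z‖ - ‖ξ₂ z‖))]
      · obtain ⟨z1, z2, z3⟩ := hξ.eq_zero hz
        simp [z1, z2, z3]
  rw [integral_add (hp.integrable_norm_sq.const_mul _) (hi.const_mul _), integral_const_mul,
    integral_const_mul] at key
  linarith

/-- The Caccioppoli estimate for the difference of two weak solutions of small oscillation. -/
theorem caccioppoli (h : WeakHarmonic U f u v L) (h' : WeakHarmonic U f' u' v' L') {M : ℝ}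
    (hε : ∀ z ∈ U, ‖f z - f₀‖ ≤ ε) (hε' : ∀ z ∈ U, ‖f' z - f₀‖ ≤ ε) (hΛ : ∀ z ∈ U, ‖L z‖ ≤ Λ)
    (hΛ' : ∀ z ∈ U, ‖L' z‖ ≤ Λ) (hL : ∀ z ∈ U, ‖L' z - L z‖ ≤ M * ‖f' z - f z‖)
    (hM : 0 ≤ M) (hΛ0 : 0 ≤ Λ) (hεΛ : Λ * ε ≤ 1 / 2) (hsmall : (M + 8 * Λ ^ 2) * (64 * ε ^ 2) ≤ 1 / 4)
    {η : ℂ → ℝ} (hη : IsTest U (fun z => (η z : ℂ))) :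
    ∫ z, ‖(u' z - u z) * η z‖ ^ 2 ≤
        20 * ∫ z, ‖(f' z - f z) * wirt (fun z => (η z : ℂ)) z‖ ^ 2 ∧
      ∫ z, ‖(v' z - v z) * η z‖ ^ 2 ≤
        86 * ∫ z, ‖(f' z - f z) * wirt (fun z => (η z : ℂ)) z‖ ^ 2 := by
  have hU := h.isOpen
  have hreal : ∀ z, wirtBar (fun z => (η z : ℂ)) z = conj (wirt (fun z => (η z : ℂ)) z) := fun z => by
    rw [← hη.wirtBar_star]; simp
  set D := wirt (fun z => (η z : ℂ)) with hD
  have hξ := hη.compactSobolev.mul (F := fun z => f' z - f z) hU (h'.continuousOn.sub h.continuousOn) (h'.weak.sub h.weak)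
    (h'.memLpLoc_wirt.sub h.memLpLoc_wirt) (h'.memLpLoc_wirtBar.sub h.memLpLoc_wirtBar)
  have hθ := hξ.star.mul hU hη.continuous.continuousOn
    (hη.compactSobolev.weak.mono (subset_univ U))
    (hη.compactSobolev.memLp_wirt.memLpLoc U) (hη.compactSobolev.memLp_wirtBar.memLpLoc U)
  have La : MemLp (fun z => (u' z - u z) * (η z : ℂ)) 2 :=
    (h'.memLpLoc_wirt.sub h.memLpLoc_wirt).memLp_mul_test hη
  have Lb : MemLp (fun z => (v' z - v z) * (η z : ℂ)) 2 :=
    (h'.memLpLoc_wirtBar.sub h.memLpLoc_wirtBar).memLp_mul_test hη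
  have LD : MemLp (fun z => (f' z - f z) * D z) 2 :=
    (MemLpLoc.of_continuousOn (h'.continuousOn.sub h.continuousOn)).memLp_mul_test hη.wirt
  have Lu := hξ.memLp_mul h.memLpLoc_wirt
  have Lu' := hξ.memLp_mul h'.memLpLoc_wirt
  have S := h.integral_mul_sq_le hε hΛ hεΛ hξ
  have S' := h'.integral_mul_sq_le hε' hΛ' hεΛ hξ
  have hN := hξ.integral_sq_eq
  rw [integral_add hξ.memLp_wirt.integrable_norm_sq hξ.memLp_wirtBar.integrable_norm_sq,
    ← hN] at S S'
  have N1 : ∫ z, ‖(u' z - u z) * (η z : ℂ) + (f' z - f z) * D z‖ ^ 2 ≤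
      ∫ z, (2 * ‖(u' z - u z) * (η z : ℂ)‖ ^ 2 + 2 * ‖(f' z - f z) * D z‖ ^ 2) := by
    refine integral_mono hξ.memLp_wirt.integrable_norm_sq
      ((La.integrable_norm_sq.const_mul 2).add (LD.integrable_norm_sq.const_mul 2)) fun z => ?_
    have := norm_add_le ((u' z - u z) * (η z : ℂ)) ((f' z - f z) * D z)
    have h0 := norm_nonneg ((u' z - u z) * (η z : ℂ) + (f' z - f z) * D z)
    nlinarith [sq_nonneg (‖(u' z - u z) * (η z : ℂ)‖ - ‖(f' z - f z) * D z‖)]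
  have W1 : ∫ z, ‖(v' z - v z) * (η z : ℂ)‖ ^ 2 ≤
      ∫ z, (2 * ‖(v' z - v z) * (η z : ℂ) + (f' z - f z) * wirtBar (fun z => (η z : ℂ)) z‖ ^ 2 +
        2 * ‖(f' z - f z) * D z‖ ^ 2) := by
    refine integral_mono Lb.integrable_norm_sq ((hξ.memLp_wirtBar.integrable_norm_sq.const_mul
      2).add (LD.integrable_norm_sq.const_mul 2)) fun z => ?_
    have e1 : ‖(f' z - f z) * D z‖ = ‖(f' z - f z) * wirtBar (fun z => (η z : ℂ)) z‖ := by
      rw [hreal, norm_mul, norm_mul, Complex.norm_conj]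
    simp only
    rw [e1]
    have := norm_sub_le ((v' z - v z) * (η z : ℂ) + (f' z - f z) * wirtBar (fun z => (η z : ℂ)) z)
      ((f' z - f z) * wirtBar (fun z => (η z : ℂ)) z)
    rw [add_sub_cancel_right] at this
    have h0 := norm_nonneg ((v' z - v z) * (η z : ℂ))
    nlinarith [sq_nonneg (‖(v' z - v z) * (η z : ℂ) + (f' z - f z) *
      wirtBar (fun z => (η z : ℂ)) z‖ - ‖(f' z - f z) * wirtBar (fun z => (η z : ℂ)) z‖)]
  rw [integral_add (La.integrable_norm_sq.const_mul 2) (LD.integrable_norm_sq.const_mul 2),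
    integral_const_mul, integral_const_mul] at N1
  rw [integral_add (hξ.memLp_wirtBar.integrable_norm_sq.const_mul 2)
    (LD.integrable_norm_sq.const_mul 2), integral_const_mul, integral_const_mul, ← hN] at W1
  have i1 := La.integrable_norm_sq.const_mul (3 / 8)
  have i2 := LD.integrable_norm_sq.const_mul 4
  have i3 := Lu'.integrable_norm_sq.const_mul (M + 2 * Λ ^ 2)
  have i4 := Lu.integrable_norm_sq.const_mul (8 * Λ ^ 2)
  have i5 := Lb.integrable_norm_sq.const_mul (1 / 32)
  have Y1 := integral_sq_le_of_norm_sub_le La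
    ((h'.integrable_sobolev hθ).sub (h.integrable_sobolev hθ)) (by
      simp only [Pi.sub_apply]
      rw [integral_sub (h'.integrable_sobolev hθ) (h.integrable_sobolev hθ),
        h'.integral_sobolev hθ, h.integral_sobolev hθ, sub_zero])
    ((((i1.add i2).add i3).add i4).add i5) fun z => by
      simp only [Pi.add_apply, Pi.sub_apply]
      by_cases hz : z ∈ U
      · have er : conj (η z : ℂ) = η z := Complex.conj_ofReal _
        rw [hreal]
        have e1 : (u' z - u z) * η z * conj ((u' z - u z) * η z) -
            (u' z * (conj (D z) * conj ((f' z - f z) * η z) +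
              η z * conj ((u' z - u z) * η z + (f' z - f z) * D z)) -
              L' z * u' z * v' z * (η z * conj ((f' z - f z) * η z)) -
            (u z * (conj (D z) * conj ((f' z - f z) * η z) +
              η z * conj ((u' z - u z) * η z + (f' z - f z) * D z)) -
              L z * u z * v z * (η z * conj ((f' z - f z) * η z)))) =
            -(2 * ((u' z - u z) * η z) * conj ((f' z - f z) * D z)) +
            (L' z - L z) * η z * u' z * v' z * conj ((f' z - f z) * η z) +
            L z * ((u' z - u z) * η z) * (v' z * conj ((f' z - f z) * η z)) +
            L z * (u z * conj ((f' z - f z) * η z)) * ((v' z - v z) * η z) := by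
          simp only [map_mul, map_add, map_sub, er]
          ring
        refine (congrArg norm e1).le.trans ?_
        refine (norm_add_le _ _).trans ((add_le_add_left ((norm_add_le _ _).trans
          (add_le_add_left (norm_add_le _ _) _)) _).trans ?_)
        set a := (u' z - u z) * (η z : ℂ)
        set b := (v' z - v z) * (η z : ℂ)
        have a1 := hΛ z hz
        have a2 := hL z hz
        have a3 := h'.norm_le z
        have b1 : ‖-(2 * a * conj ((f' z - f z) * D z))‖ = 2 * ‖a‖ * ‖(f' z - f z) * D z‖ := by
          rw [norm_neg, norm_mul, norm_mul, Complex.norm_conj]; simp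
        have b2 : ‖(L' z - L z) * η z * u' z * v' z * conj ((f' z - f z) * η z)‖ ≤
            M * ‖u' z * ((f' z - f z) * η z)‖ ^ 2 := by
          simp only [norm_mul, Complex.norm_conj]
          calc _ ≤ (M * ‖f' z - f z‖) * ‖(η z : ℂ)‖ * ‖u' z‖ * ‖u' z‖ *
                (‖f' z - f z‖ * ‖(η z : ℂ)‖) := by gcongr
            _ = _ := by ring
        have b3 : ‖L z * a * (v' z * conj ((f' z - f z) * η z))‖ ≤
            Λ * ‖a‖ * ‖u' z * ((f' z - f z) * η z)‖ := by
          rw [norm_mul, norm_mul (v' z), norm_mul (L z), norm_mul (u' z), Complex.norm_conj]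
          gcongr
        have b4 : ‖L z * (u z * conj ((f' z - f z) * η z)) * b‖ ≤
            Λ * ‖u z * ((f' z - f z) * η z)‖ * ‖b‖ := by
          rw [norm_mul, norm_mul (L z), norm_mul (u z), norm_mul (u z), Complex.norm_conj]
          gcongr
        nlinarith [sq_nonneg (‖a‖ / 2 - 2 * ‖(f' z - f z) * D z‖),
          sq_nonneg (‖a‖ - 4 * (Λ * ‖u' z * ((f' z - f z) * η z)‖)),
          sq_nonneg (‖b‖ - 16 * (Λ * ‖u z * ((f' z - f z) * η z)‖))]
      · have e1 : (η z : ℂ) = 0 := hη.eq_zero hz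
        have e2 : D z = 0 := hη.wirt.eq_zero hz
        simp [e1, e2, hreal]
  rw [integral_add' (((i1.add i2).add i3).add i4) i5, integral_add' ((i1.add i2).add i3) i4,
    integral_add' (i1.add i2) i3, integral_add' i1 i2, integral_const_mul, integral_const_mul,
    integral_const_mul, integral_const_mul, integral_const_mul] at Y1
  set Y := ∫ z, ‖(u' z - u z) * (η z : ℂ)‖ ^ 2
  set Z := ∫ z, ‖(f' z - f z) * D z‖ ^ 2 with hZ
  set W := ∫ z, ‖(v' z - v z) * (η z : ℂ)‖ ^ 2
  set N := ∫ z, ‖(u' z - u z) * (η z : ℂ) + (f' z - f z) * D z‖ ^ 2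
  set Q := ∫ z, ‖u z * ((f' z - f z) * (η z : ℂ))‖ ^ 2
  set P := ∫ z, ‖u' z * ((f' z - f z) * (η z : ℂ))‖ ^ 2
  have hY0 : 0 ≤ Y := integral_nonneg fun z => by positivity
  have hZ0 : 0 ≤ Z := integral_nonneg fun z => by positivity
  have c1 : (M + 2 * Λ ^ 2) * P ≤ (M + 2 * Λ ^ 2) * (8 * ε ^ 2 * (N + N)) := by gcongr
  have c2 : 8 * Λ ^ 2 * Q ≤ 8 * Λ ^ 2 * (8 * ε ^ 2 * (N + N)) := by gcongr
  have c3 : (M + 10 * Λ ^ 2) * (16 * ε ^ 2 * N) ≤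
      (M + 10 * Λ ^ 2) * (16 * ε ^ 2 * (2 * Y + 2 * Z)) := by gcongr
  have c4 : (M + 10 * Λ ^ 2) * (16 * ε ^ 2 * (2 * Y + 2 * Z)) ≤
      ((M + 8 * Λ ^ 2) * (64 * ε ^ 2)) * (Y + Z) := by
    have : 0 ≤ (M * 32 + Λ ^ 2 * 192) * ε ^ 2 * (Y + Z) := by positivity
    linarith
  have c5 : ((M + 8 * Λ ^ 2) * (64 * ε ^ 2)) * (Y + Z) ≤ 1 / 4 * (Y + Z) := by gcongr
  constructor <;> linarith

end WeakHarmonic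
end

noncomputable section

open MeasureTheory Set Filter Topology
open scoped ContDiff ComplexConjugate ENNReal Convolution

theorem exists_weak_limit {s : ℕ → ℂ → ℂ} {C : ℝ} (hs : ∀ n, MemLp (s n) 2)
    (hC : ∀ n, eLpNorm (s n) 2 ≤ ENNReal.ofReal C) : ∃ a : ℂ → ℂ, MemLp a 2 ∧
      ∃ 𝒰 : Filter ℕ, 𝒰.NeBot ∧ 𝒰 ≤ atTop ∧ ∀ φ : ℂ → ℂ, MemLp φ 2 →
        Tendsto (fun n => ∫ z, s n z * φ z) 𝒰 (𝓝 (∫ z, a z * φ z)) := by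
  set H := Lp ℂ 2 (volume : Measure ℂ)
  set x : ℕ → H := fun n => (hs n).star.toLp _ with hx
  have hxC : ∀ n, ‖x n‖ ≤ max C 0 := fun n => by
    rw [hx, Lp.norm_toLp]
    refine ENNReal.toReal_le_of_le_ofReal (le_max_right _ _) ?_
    have : eLpNorm (fun z => conj (s n z)) 2 = eLpNorm (s n) 2 :=
      eLpNorm_congr_norm_ae (Eventually.of_forall fun z => by simp)
    exact (this.le.trans (hC n)).trans (ENNReal.ofReal_le_ofReal (le_max_left _ _))
  set ℓ : ℕ → WeakDual ℂ H := fun n => StrongDual.toWeakDual (InnerProductSpace.toDual ℂ H (x n))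
  have hcomp := WeakDual.isCompact_closedBall (0 : StrongDual ℂ H) (max C 0)
  have hmem : ∀ n, ℓ n ∈ WeakDual.toStrongDual ⁻¹' Metric.closedBall (0 : StrongDual ℂ H) (max C 0) :=
    fun n => by
      rw [mem_preimage, mem_closedBall_zero_iff]
      exact ((InnerProductSpace.toDual ℂ H).norm_map (x n)).le.trans (hxC n)
  obtain ⟨y, -, hy⟩ := hcomp.ultrafilter_le_nhds ((hyperfilter ℕ).map ℓ)
    (le_principal_iff.2 (mem_map.2 (Eventually.of_forall hmem)))
  set b : H := (InnerProductSpace.toDual ℂ H).symm (WeakDual.toStrongDual y)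
  refine ⟨fun z => conj (b z), (Lp.memLp b).star, hyperfilter ℕ, inferInstance, ?_, fun φ hφ => ?_⟩
  · rw [← Nat.cofinite_eq_atTop]; exact hyperfilter_le_cofinite
  have h1 : Tendsto (fun n => ℓ n (hφ.toLp φ)) (hyperfilter ℕ) (𝓝 (y (hφ.toLp φ))) :=
    ((WeakDual.eval_continuous (hφ.toLp φ)).tendsto y).comp hy
  have h2 : ∀ n, ℓ n (hφ.toLp φ) = ∫ z, s n z * φ z := fun n => by
    change inner ℂ (x n) (hφ.toLp φ) = _
    rw [L2.inner_def]
    refine integral_congr_ae ?_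
    filter_upwards [hφ.coeFn_toLp, (hs n).star.coeFn_toLp] with z h3 h4
    rw [h3, hx, h4]
    simp [mul_comm]
  have h3 : y (hφ.toLp φ) = ∫ z, conj (b z) * φ z := by
    have : inner ℂ b (hφ.toLp φ) = y (hφ.toLp φ) := InnerProductSpace.toDual_symm_apply
    rw [← this, L2.inner_def]
    refine integral_congr_ae ?_
    filter_upwards [hφ.coeFn_toLp] with z h3
    rw [h3]
    simp [mul_comm]
  simp_rw [h2, h3] at h1
  exact h1

theorem tendsto_integral_difference_quotient {u : ℂ → ℂ} (hu : LocallyIntegrable u) {φ : ℂ → ℂ}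
    (hφ : IsTest univ φ) (e : ℂ) {t : ℕ → ℝ} (ht : Tendsto t atTop (𝓝[≠] 0)) :
    Tendsto (fun n => ∫ z, (u (z + t n * e) - u z) / t n * φ z) atTop
      (𝓝 (-∫ z, u z * fderiv ℝ φ z e)) := by
  set L := ContinuousLinearMap.mul ℝ ℂ
  set ψ : ℂ → ℂ := fun z => φ (-z) with hψ
  have hψs : ContDiff ℝ 1 ψ := (hφ.contDiff.of_le (by simp)).comp contDiff_neg
  have hψc : HasCompactSupport ψ := hφ.compact.comp_homeomorph (Homeomorph.neg ℂ)
  have hd := hψc.hasFDerivAt_convolution_right L hu hψs 0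
  have hi : ∀ x, Integrable fun z => u z * φ (z - x) := fun x => by
    have := hu.integrable_smul_left_of_hasCompactSupport (g := fun z => φ (z - x))
      (hφ.continuous.comp (continuous_id.sub continuous_const))
      (hφ.compact.comp_homeomorph (Homeomorph.subRight x))
    simpa [mul_comm] using this
  have hP : ∀ x, (u ⋆[L, volume] ψ) x = ∫ z, u z * φ (z - x) := fun x => by
    rw [convolution_def]
    refine integral_congr_ae (Eventually.of_forall fun z => ?_)
    simp [L, hψ]
  have hval : (u ⋆[L.precompR ℂ, volume] fderiv ℝ ψ) 0 e = -∫ z, u z * fderiv ℝ φ z e := by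
    rw [convolution_precompR_apply _ hu (hψc.fderiv ℝ) (hψs.continuous_fderiv (by simp)),
      convolution_def, ← integral_neg]
    refine integral_congr_ae (Eventually.of_forall fun z => ?_)
    have h1 : fderiv ℝ ψ (0 - z) = -fderiv ℝ φ z := by
      have h2 := (hφ.differentiable (-(0 - z))).hasFDerivAt.comp (0 - z)
        (hasFDerivAt_id (𝕜 := ℝ) (0 - z)).neg
      have h3 : HasFDerivAt ψ (-fderiv ℝ φ z) (0 - z) := by
        refine HasFDerivAt.congr_fderiv h2 (ContinuousLinearMap.ext fun v => ?_)
        simp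
      exact h3.fderiv
    change u z * fderiv ℝ ψ (0 - z) e = _
    rw [h1]
    simp
  have hline : HasDerivAt (fun s : ℝ => (s : ℂ) * e) e 0 := by
    simpa using (HasDerivAt.ofReal_comp (hasDerivAt_id (0 : ℝ))).mul_const e
  have hd' : HasDerivAt (fun s : ℝ => (u ⋆[L, volume] ψ) (s * e))
      ((u ⋆[L.precompR ℂ, volume] fderiv ℝ ψ) 0 e) 0 :=
    HasFDerivAt.comp_hasDerivAt (f := fun s : ℝ => (s : ℂ) * e) (l := u ⋆[L, volume] ψ)
      (l' := (u ⋆[L.precompR ℂ, volume] fderiv ℝ ψ) 0) 0 (by simpa using hd) hline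
  rw [hval, hasDerivAt_iff_tendsto_slope] at hd'
  refine (hd'.comp ht).congr' ?_
  filter_upwards with n
  rw [Function.comp_apply, slope_def_module, hP, hP]
  have h1 : ∫ z, u z * φ (z - t n * e) = ∫ z, u (z + t n * e) * φ z := by
    rw [← integral_add_right_eq_self _ (t n * e : ℂ)]
    simp
  have h2 : Integrable fun z => u (z + t n * e) * φ z := by
    simpa using (hi (t n * e)).comp_add_right (t n * e : ℂ)
  have h3 : Integrable fun z => u z * φ z := by simpa using hi 0
  simp only [Complex.ofReal_zero, zero_mul, sub_zero]
  rw [h1, ← integral_sub h2 h3, ← integral_smul]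
  refine integral_congr_ae (Eventually.of_forall fun z => ?_)
  simp only [Complex.real_smul]
  push_cast
  ring

/-- A function whose difference quotients are bounded in `L²` has weak derivatives in `L²`. -/
theorem exists_hasWeakWirt_of_difference_quotient {u : ℂ → ℂ} (hu : LocallyIntegrable u) {V : Set ℂ}
    (hV : IsOpen V) {C : ℝ} {t : ℕ → ℝ} (ht : Tendsto t atTop (𝓝[≠] 0))
    (hC : ∀ e : ℂ, ‖e‖ = 1 → ∀ n, eLpNorm (fun z => (u (z + t n * e) - u z) / t n) 2
      (volume.restrict V) ≤ ENNReal.ofReal C) :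
    ∃ a b, HasWeakWirt V u a b ∧ MemLp a 2 ∧ MemLp b 2 := by
  have key : ∀ e : ℂ, ‖e‖ = 1 → ∃ c : ℂ → ℂ, MemLp c 2 ∧ ∀ φ, IsTest V φ →
      ∫ z, c z * φ z = -∫ z, u z * fderiv ℝ φ z e := fun e he => by
    have hm : ∀ n, AEStronglyMeasurable (fun z => (u (z + t n * e) - u z) / t n) volume := fun n => by
      have := ((hu.aestronglyMeasurable.comp_measurePreserving
        (measurePreserving_add_right volume (t n * e : ℂ))).sub
          hu.aestronglyMeasurable).mul_const (t n : ℂ)⁻¹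
      simpa [div_eq_mul_inv, Function.comp_def] using this
    have hE : ∀ n, eLpNorm (V.indicator fun z => (u (z + t n * e) - u z) / t n) 2 ≤
        ENNReal.ofReal C := fun n => by
      rw [eLpNorm_indicator_eq_eLpNorm_restrict hV.measurableSet]; exact hC e he n
    obtain ⟨c, hc, 𝒰, h𝒰, hle, hlim⟩ := exists_weak_limit
      (fun n => ⟨(hm n).indicator hV.measurableSet, (hE n).trans_lt ENNReal.ofReal_lt_top⟩) hE
    refine ⟨c, hc, fun φ hφ => ?_⟩
    have h1 := hlim φ (hφ.continuous.memLp_of_hasCompactSupport hφ.compact)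
    have h2 := (tendsto_integral_difference_quotient hu (hφ.mono (subset_univ V)) e ht).mono_left hle
    refine tendsto_nhds_unique (h1.congr fun n => ?_) h2
    congr 1; ext z
    by_cases hz : z ∈ V
    · simp [hz]
    · simp [hφ.eq_zero hz]
  obtain ⟨c, hc, hc'⟩ := key 1 (by simp)
  obtain ⟨d, hd, hd'⟩ := key Complex.I (by simp)
  have Lc := hc.memLpLoc V
  have Ld := hd.memLpLoc V
  have hint : ∀ {φ : ℂ → ℂ}, IsTest V φ → Integrable (fun z => c z * φ z) ∧
      Integrable (fun z => d z * φ z) := fun hφ =>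
    ⟨(Lc.mono_exponent (p := 1) (by norm_num)).integrable_mul_test hφ,
      (Ld.mono_exponent (p := 1) (by norm_num)).integrable_mul_test hφ⟩
  have hui : ∀ {φ : ℂ → ℂ} (e : ℂ), IsTest V φ → Integrable (fun z => u z * fderiv ℝ φ z e) :=
    fun {φ} e hφ => by
      have := hu.integrable_smul_left_of_hasCompactSupport (g := fun z => fderiv ℝ φ z e)
        ((hφ.contDiff.continuous_fderiv (by simp)).clm_apply continuous_const)
        (hφ.compact.fderiv_apply ℝ e)
      simpa [mul_comm] using this
  have e1 : (fun z => (c z - Complex.I * d z) / 2) =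
      fun z => (2⁻¹ : ℂ) * c z - (Complex.I / 2) * d z := by ext z; ring
  have e2 : (fun z => (c z + Complex.I * d z) / 2) =
      fun z => (2⁻¹ : ℂ) * c z + (Complex.I / 2) * d z := by ext z; ring
  have m1 : MemLp (fun z => (c z - Complex.I * d z) / 2) 2 := by
    rw [e1]; exact (hc.const_mul _).sub (hd.const_mul _)
  have m2 : MemLp (fun z => (c z + Complex.I * d z) / 2) 2 := by
    rw [e2]; exact (hc.const_mul _).add (hd.const_mul _)
  refine ⟨_, _, ⟨fun K _ hK => memLp_one_iff_integrable.2 (hu.integrableOn_isCompact hK),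
    (m1.memLpLoc V).mono_exponent (by norm_num), (m2.memLpLoc V).mono_exponent (by norm_num),
    fun φ h1 h2 h3 => ?_, fun φ h1 h2 h3 => ?_⟩, m1, m2⟩
  · have hφ : IsTest V φ := ⟨h1, h2, h3⟩
    have i1 := hint hφ
    have e3 : ∀ z, u z * wirt φ z = (2⁻¹ : ℂ) * (u z * fderiv ℝ φ z 1) -
        (Complex.I / 2) * (u z * fderiv ℝ φ z Complex.I) := fun z => by rw [wirt]; ring
    have e4 : ∀ z, (c z - Complex.I * d z) / 2 * φ z = (2⁻¹ : ℂ) * (c z * φ z) -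
        (Complex.I / 2) * (d z * φ z) := fun z => by ring
    simp_rw [e3, e4]
    rw [integral_sub ((hui 1 hφ).const_mul _) ((hui _ hφ).const_mul _),
      integral_sub (i1.1.const_mul _) (i1.2.const_mul _), integral_const_mul, integral_const_mul,
      integral_const_mul, integral_const_mul, hc' φ hφ, hd' φ hφ]
    ring
  · have hφ : IsTest V φ := ⟨h1, h2, h3⟩
    have i1 := hint hφ
    have e3 : ∀ z, u z * wirtBar φ z = (2⁻¹ : ℂ) * (u z * fderiv ℝ φ z 1) +
        (Complex.I / 2) * (u z * fderiv ℝ φ z Complex.I) := fun z => by rw [wirtBar]; ring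
    have e4 : ∀ z, (c z + Complex.I * d z) / 2 * φ z = (2⁻¹ : ℂ) * (c z * φ z) +
        (Complex.I / 2) * (d z * φ z) := fun z => by ring
    simp_rw [e3, e4]
    rw [integral_add ((hui 1 hφ).const_mul _) ((hui _ hφ).const_mul _),
      integral_add (i1.1.const_mul _) (i1.2.const_mul _), integral_const_mul, integral_const_mul,
      integral_const_mul, integral_const_mul, hc' φ hφ, hd' φ hφ]
    ring

theorem eLpNorm_translate_sub_le_of_test {F : ℂ → ℂ} (hF : ContDiff ℝ 1 F) (h : ℂ) :
    eLpNorm (fun z => F (z + h) - F z) 2 ≤ ‖h‖ₑ * eLpNorm (fderiv ℝ F) 2 := by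
  set P : Measure ℝ := volume.restrict (Ioc 0 1) with hP
  have hPp : IsProbabilityMeasure P := ⟨by simp [hP]⟩
  have hfc : Continuous (fderiv ℝ F) := hF.continuous_fderiv (by simp)
  have hline : ∀ z : ℂ, Continuous fun t : ℝ => z + t * h := fun z => by fun_prop
  have hpt : ∀ z, ‖F (z + h) - F z‖ₑ ^ (2 : ℝ) ≤
      ‖h‖ₑ ^ (2 : ℝ) * ∫⁻ t, ‖fderiv ℝ F (z + t * h)‖ₑ ^ (2 : ℝ) ∂P := fun z => by
    have hd : ∀ t : ℝ, HasDerivAt (fun t : ℝ => F (z + t * h)) (fderiv ℝ F (z + t * h) h) t :=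
      fun t => by
        have h1 : HasDerivAt (fun t : ℝ => z + (t : ℂ) * h) h t := by
          simpa using ((HasDerivAt.ofReal_comp (hasDerivAt_id t)).mul_const h).const_add z
        exact (hF.differentiable (by simp) _).hasFDerivAt.comp_hasDerivAt t h1
    have h2 := intervalIntegral.integral_eq_sub_of_hasDerivAt (a := 0) (b := 1) (fun t _ => hd t)
      (((hfc.comp (hline z)).clm_apply continuous_const).intervalIntegrable _ _)
    rw [intervalIntegral.integral_of_le zero_le_one] at h2
    simp only [Complex.ofReal_one, one_mul, Complex.ofReal_zero, zero_mul, add_zero] at h2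
    have hm : AEStronglyMeasurable (fun t : ℝ => fderiv ℝ F (z + t * h)) P :=
      (hfc.comp (hline z)).aestronglyMeasurable
    have e1 : ‖F (z + h) - F z‖ₑ ≤ ‖h‖ₑ * eLpNorm (fun t : ℝ => fderiv ℝ F (z + t * h)) 1 P := by
      rw [← h2, eLpNorm_one_eq_lintegral_enorm, ← lintegral_const_mul _ (by fun_prop)]
      refine (enorm_integral_le_lintegral_enorm _).trans (lintegral_mono fun t => ?_)
      exact (ContinuousLinearMap.le_opENorm (fderiv ℝ F (z + t * h)) h).trans (mul_comm _ _).le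
    have e2 := e1.trans (mul_le_mul_right (eLpNorm_le_eLpNorm_of_exponent_le one_le_two hm) _)
    calc _ ≤ (‖h‖ₑ * eLpNorm (fun t : ℝ => fderiv ℝ F (z + t * h)) 2 P) ^ (2 : ℝ) := by gcongr
      _ = _ := by
        rw [ENNReal.mul_rpow_of_nonneg _ _ (by norm_num),
          eLpNorm_eq_lintegral_rpow_enorm_toReal (by simp) (by simp), ← ENNReal.rpow_mul]
        simp
  rw [eLpNorm_eq_lintegral_rpow_enorm_toReal (by simp) (by simp),
    eLpNorm_eq_lintegral_rpow_enorm_toReal (by simp) (by simp), ENNReal.toReal_ofNat]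
  have hsw : ∫⁻ z, ‖F (z + h) - F z‖ₑ ^ (2 : ℝ) ≤
      ‖h‖ₑ ^ (2 : ℝ) * ∫⁻ z, ‖fderiv ℝ F z‖ₑ ^ (2 : ℝ) := by
    calc _ ≤ ∫⁻ z, ‖h‖ₑ ^ (2 : ℝ) * ∫⁻ t, ‖fderiv ℝ F (z + t * h)‖ₑ ^ (2 : ℝ) ∂P :=
          lintegral_mono hpt
      _ = ‖h‖ₑ ^ (2 : ℝ) * ∫⁻ z, ∫⁻ t, ‖fderiv ℝ F (z + t * h)‖ₑ ^ (2 : ℝ) ∂P :=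
          lintegral_const_mul' _ _ (by simp)
      _ = ‖h‖ₑ ^ (2 : ℝ) * ∫⁻ t, ∫⁻ z, ‖fderiv ℝ F (z + t * h)‖ₑ ^ (2 : ℝ) ∂volume ∂P := by
          rw [lintegral_lintegral_swap]
          have : Continuous fun p : ℂ × ℝ => fderiv ℝ F (p.1 + p.2 * h) := by fun_prop
          exact (this.measurable.enorm.pow_const _).aemeasurable
      _ = ‖h‖ₑ ^ (2 : ℝ) * ∫⁻ t, ∫⁻ z, ‖fderiv ℝ F z‖ₑ ^ (2 : ℝ) ∂volume ∂P := by
          congr 1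
          refine lintegral_congr fun t => ?_
          exact lintegral_add_right_eq_self (fun z => ‖fderiv ℝ F z‖ₑ ^ (2 : ℝ)) _
      _ = _ := by rw [lintegral_const]; simp
  calc _ ≤ (‖h‖ₑ ^ (2 : ℝ) * ∫⁻ z, ‖fderiv ℝ F z‖ₑ ^ (2 : ℝ)) ^ (1 / (2 : ℝ)) := by gcongr
    _ = _ := by
      rw [ENNReal.mul_rpow_of_nonneg _ _ (by norm_num), ← ENNReal.rpow_mul]
      simp

theorem CompactSobolev.eLpNorm_translate_sub_le {U : Set ℂ} {F a b : ℂ → ℂ}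
    (hF : CompactSobolev U F a b) (h : ℂ) :
    eLpNorm (fun z => F (z + h) - F z) 2 ≤ ‖h‖ₑ * (eLpNorm a 2 + eLpNorm b 2) := by
  have hi : Integrable F := hF.continuous.integrable_of_hasCompactSupport hF.hasCompactSupport
  have ht := fun n => isTest_moll hi hF.hasCompactSupport n
  have hlim := tendstoUniformly_moll hF.continuous hF.hasCompactSupport
  refine (Lp.eLpNorm_lim_le_liminf_eLpNorm (f := fun n z => moll n F (z + h) - moll n F z)
    (fun n => (((ht n).continuous.comp (continuous_id.add continuous_const)).sub
      (ht n).continuous).aestronglyMeasurable) _ (Eventually.of_forall fun z =>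
      (hlim.tendsto_at (z + h)).sub (hlim.tendsto_at z))).trans ?_
  refine liminf_le_of_frequently_le' (Eventually.of_forall fun n => ?_).frequently
  refine (eLpNorm_translate_sub_le_of_test ((ht n).contDiff.of_le (by simp)) h).trans ?_
  gcongr
  have m1 : AEStronglyMeasurable (fun w => ‖moll n a w‖) (volume : Measure ℂ) := by
    rw [← wirt_moll hF.weak]; exact (ht n).wirt.continuous.norm.aestronglyMeasurable
  have m2 : AEStronglyMeasurable (fun w => ‖moll n b w‖) (volume : Measure ℂ) := by
    rw [← wirtBar_moll hF.weak.bar]; exact (ht n).wirtBar.continuous.norm.aestronglyMeasurable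
  have h5 := eLpNorm_add_le (p := 2) m1 m2 one_le_two
  rw [eLpNorm_norm, eLpNorm_norm] at h5
  refine le_trans (eLpNorm_mono_real fun w => ?_) (h5.trans (add_le_add
    (eLpNorm_moll_le one_le_two (by simp) hF.memLp_wirt.1 n)
    (eLpNorm_moll_le one_le_two (by simp) hF.memLp_wirtBar.1 n)))
  rw [fderiv_eq_wirtL, wirt_moll hF.weak, wirtBar_moll hF.weak.bar]
  exact norm_wirtL_le _ _

end

noncomputable section

open MeasureTheory Set Filter Topology
open scoped ContDiff ComplexConjugate ENNReal

theorem MemLpLoc.comp_add_right {p : ℝ≥0∞} {U : Set ℂ} {u : ℂ → ℂ} (hu : MemLpLoc p U u) (h : ℂ) :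
    MemLpLoc p ((fun z => z + h) ⁻¹' U) (fun z => u (z + h)) := fun K hK hc => by
  have h1 : MemLp u p (volume.restrict ((fun z => z + h) '' K)) :=
    hu _ (image_subset_iff.2 hK) (hc.image (continuous_id.add continuous_const))
  have h2 := (measurePreserving_add_right volume h).restrict_preimage_emb
    (Homeomorph.addRight h).measurableEmbedding ((fun z => z + h) '' K)
  rw [preimage_image_eq _ (add_left_injective h)] at h2
  exact h1.comp_measurePreserving h2

theorem IsTest.comp_sub_const {U : Set ℂ} {h : ℂ} {φ : ℂ → ℂ}
    (hφ : IsTest ((fun z => z + h) ⁻¹' U) φ) : IsTest U (fun z => φ (z - h)) := by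
  have hs : tsupport (fun x => φ (x - h)) ⊆ (fun x => x - h) ⁻¹' tsupport φ :=
    closure_minimal (fun x hx => subset_tsupport φ hx)
      ((isClosed_tsupport φ).preimage (continuous_id.sub continuous_const))
  refine ⟨hφ.contDiff.comp (contDiff_id.sub contDiff_const),
    hφ.compact.comp_homeomorph (Homeomorph.subRight h), fun x hx => ?_⟩
  simpa using hφ.subset (hs hx)

theorem integral_comp_add_mul (u φ : ℂ → ℂ) (h : ℂ) :
    ∫ z, u (z + h) * φ z = ∫ z, u z * φ (z - h) := by
  rw [← integral_add_right_eq_self (fun z => u z * φ (z - h)) h]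
  simp

theorem HasWeakBar.comp_add_right {U : Set ℂ} {u b : ℂ → ℂ} (hu : HasWeakBar U u b) (h : ℂ) :
    HasWeakBar ((fun z => z + h) ⁻¹' U) (fun z => u (z + h)) (fun z => b (z + h)) := by
  refine ⟨hu.memLpLoc.comp_add_right h, hu.memLpLoc_bar.comp_add_right h, fun φ hφ => ?_⟩
  have h1 := hu.integral_bar _ hφ.comp_sub_const
  simp_rw [wirtBar_comp_sub] at h1
  rw [integral_comp_add_mul, h1, integral_comp_add_mul]

theorem HasWeakWirt.comp_add_right {U : Set ℂ} {u a b : ℂ → ℂ} (hu : HasWeakWirt U u a b) (h : ℂ) :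
    HasWeakWirt ((fun z => z + h) ⁻¹' U) (fun z => u (z + h)) (fun z => a (z + h))
      (fun z => b (z + h)) :=
  hasWeakWirt_iff.2 ⟨hu.bar.comp_add_right h, hu.star.bar.comp_add_right h⟩

theorem eLpNorm_two_eq {p : ℂ → ℂ} (hp : MemLp p 2) :
    eLpNorm p 2 = ENNReal.ofReal (∫ w, ‖p w‖ ^ 2) ^ (1 / 2 : ℝ) := by
  rw [eLpNorm_eq_lintegral_rpow_enorm_toReal (by simp) (by simp),
    ofReal_integral_eq_lintegral_ofReal hp.integrable_norm_sq
      (Eventually.of_forall fun w => by positivity)]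
  congr 2 with w
  rw [ENNReal.ofReal_pow (norm_nonneg _), ofReal_norm]
  simp

theorem eLpNorm_two_le_of_integral_sq_le {p q : ℂ → ℂ} (hp : MemLp p 2) (hq : MemLp q 2) {c : ℝ}
    (hc : 0 ≤ c) (h : ∫ z, ‖p z‖ ^ 2 ≤ c ^ 2 * ∫ z, ‖q z‖ ^ 2) :
    eLpNorm p 2 ≤ ENNReal.ofReal c * eLpNorm q 2 := by
  rw [eLpNorm_two_eq hp, eLpNorm_two_eq hq]
  calc _ ≤ ENNReal.ofReal (c ^ 2 * ∫ z, ‖q z‖ ^ 2) ^ (1 / 2 : ℝ) := by gcongr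
    _ = _ := by
      rw [ENNReal.ofReal_mul (by positivity), ENNReal.mul_rpow_of_nonneg _ _ (by norm_num),
        ENNReal.ofReal_pow hc, ← ENNReal.rpow_natCast, ← ENNReal.rpow_mul]
      simp

namespace WeakHarmonic
variable {U V : Set ℂ} {f u v L : ℂ → ℂ}

theorem mono (h : WeakHarmonic U f u v L) (hV : IsOpen V) (hVU : V ⊆ U) : WeakHarmonic V f u v L :=
  ⟨hV, h.continuousOn.mono hVU, h.weak.mono hVU, h.memLpLoc_wirt.mono_set hVU,
    h.memLpLoc_wirtBar.mono_set hVU, h.norm_le, h.continuousOn_coeff.mono hVU,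
    fun φ hφ => h.integral_eq φ (hφ.mono hVU)⟩

theorem comp_add_right (h : WeakHarmonic U f u v L) (τ : ℂ) :
    WeakHarmonic ((fun z => z + τ) ⁻¹' U) (fun z => f (z + τ)) (fun z => u (z + τ))
      (fun z => v (z + τ)) (fun z => L (z + τ)) := by
  have hc : Continuous fun z : ℂ => z + τ := continuous_id.add continuous_const
  refine ⟨h.isOpen.preimage hc, h.continuousOn.comp hc.continuousOn (mapsTo_preimage _ _),
    h.weak.comp_add_right τ, h.memLpLoc_wirt.comp_add_right τ, h.memLpLoc_wirtBar.comp_add_right τ,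
    fun z => h.norm_le _, h.continuousOn_coeff.comp hc.continuousOn (mapsTo_preimage _ _),
    fun φ hφ => ?_⟩
  have h1 := h.integral_eq _ hφ.comp_sub_const
  simp_rw [wirtBar_comp_sub] at h1
  rw [integral_comp_add_mul, h1, ← integral_comp_add_mul (fun z => L z * u z * v z)]

/-- The derivatives of a weak solution are in `W^{1,2}_loc`. -/
theorem exists_sobolev (h : WeakHarmonic U f u v L) {M Λ : ℝ} (hM : 0 ≤ M) (hΛ0 : 0 ≤ Λ)
    (hΛ : ∀ z ∈ U, ‖L z‖ ≤ Λ) (hL : ∀ z ∈ U, ∀ z' ∈ U, ‖L z' - L z‖ ≤ M * ‖f z' - f z‖) {z₀ : ℂ}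
    (hz₀ : z₀ ∈ U) : ∃ r, 0 < r ∧ Metric.ball z₀ r ⊆ U ∧
      (∃ a b, HasWeakWirt (Metric.ball z₀ r) u a b ∧ MemLp a 2 ∧ MemLp b 2) ∧
      ∃ a b, HasWeakWirt (Metric.ball z₀ r) v a b ∧ MemLp a 2 ∧ MemLp b 2 := by
  have hU := h.isOpen
  set T := 1 + M + Λ with hT
  have hT1 : 1 ≤ T := by linarith
  set ε := 1 / (64 * T) with hε
  have hε0 : 0 < ε := by positivity
  have hTε : T * ε = 1 / 64 := by rw [hε]; field_simp
  have hεΛ : Λ * ε ≤ 1 / 2 := by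
    have : Λ * ε ≤ T * ε := by gcongr; linarith
    linarith
  have hsmall : (M + 8 * Λ ^ 2) * (64 * ε ^ 2) ≤ 1 / 4 := by
    have h1 : M + 8 * Λ ^ 2 ≤ 8 * T ^ 2 := by nlinarith
    calc (M + 8 * Λ ^ 2) * (64 * ε ^ 2) ≤ 8 * T ^ 2 * (64 * ε ^ 2) := by gcongr
      _ = 512 * (T * ε) ^ 2 := by ring
      _ ≤ 1 / 4 := by rw [hTε]; norm_num
  obtain ⟨ρ, hρ, hρU⟩ := Metric.isOpen_iff.1
    (h.continuousOn.isOpen_inter_preimage hU (Metric.isOpen_ball (x := f z₀) (ε := ε))) z₀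
    ⟨hz₀, Metric.mem_ball_self hε0⟩
  set r := ρ / 5 with hr
  have hr0 : 0 < r := by positivity
  have h4 : Metric.closedBall z₀ (4 * r) ⊆ Metric.ball z₀ ρ :=
    Metric.closedBall_subset_ball (by rw [hr]; linarith)
  have h4U : Metric.closedBall z₀ (4 * r) ⊆ U := fun z hz => (hρU (h4 hz)).1
  have hfε : ∀ z ∈ Metric.closedBall z₀ (4 * r), ‖f z - f z₀‖ ≤ ε := fun z hz => by
    have := (hρU (h4 hz)).2
    rw [mem_preimage, mem_ball_iff_norm] at this
    exact this.le
  obtain ⟨χ, hχ, -, -, V, hV, hKV, hVU, hχV⟩ := exists_cutoff (isCompact_closedBall z₀ (4 * r)) hU h4U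
  obtain ⟨η, hη, -, -, V', hV', hKV', hVU', hηV⟩ := exists_cutoff (isCompact_closedBall z₀ r)
    (Metric.isOpen_ball (x := z₀) (ε := 2 * r)) (Metric.closedBall_subset_ball (by linarith))
  set W := Metric.ball z₀ (3 * r) with hW
  have hWo : IsOpen W := Metric.isOpen_ball
  have hW4 : W ⊆ Metric.closedBall z₀ (4 * r) :=
    (Metric.ball_subset_ball (by linarith)).trans Metric.ball_subset_closedBall
  have hηW : IsTest W (fun z => (η z : ℂ)) := hη.mono (Metric.ball_subset_ball (by linarith))
  have hF := hχ.compactSobolev.mul hU h.continuousOn h.weak h.memLpLoc_wirt h.memLpLoc_wirtBar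
  set A := eLpNorm (fun z => u z * (χ z : ℂ) + f z * wirt (fun z => (χ z : ℂ)) z) 2 +
    eLpNorm (fun z => v z * (χ z : ℂ) + f z * wirtBar (fun z => (χ z : ℂ)) z) 2 with hA
  have hAt : A ≠ ⊤ := ENNReal.add_ne_top.2 ⟨hF.memLp_wirt.2.ne, hF.memLp_wirtBar.2.ne⟩
  obtain ⟨k, hk⟩ := hη.wirt.continuous.bounded_above_of_compact_support hη.wirt.compact
  have hk0 : 0 ≤ k := (norm_nonneg _).trans (hk 0)
  have hshift : ∀ {s : ℝ} {τ : ℂ}, ‖τ‖ < r → ∀ z ∈ Metric.ball z₀ (s * r),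
      z + τ ∈ Metric.ball z₀ ((s + 1) * r) := fun {s τ} hτ z hz => by
    rw [mem_ball_iff_norm] at hz ⊢
    have := norm_add_le (z - z₀) τ
    rw [show z + τ - z₀ = z - z₀ + τ by ring]
    linarith
  have hest : ∀ τ : ℂ, ‖τ‖ < r →
      eLpNorm (fun z => (u (z + τ) - u z) * η z) 2 ≤
        ENNReal.ofReal 10 * (ENNReal.ofReal k * (‖τ‖ₑ * A)) ∧
      eLpNorm (fun z => (v (z + τ) - v z) * η z) 2 ≤
        ENNReal.ofReal 10 * (ENNReal.ofReal k * (‖τ‖ₑ * A)) := fun τ hτ => by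
    have hsh : ∀ z ∈ W, z + τ ∈ Metric.closedBall z₀ (4 * r) := fun z hz => by
      have := hshift hτ z hz
      norm_num at this
      exact Metric.ball_subset_closedBall this
    have h' := (h.comp_add_right τ).mono hWo fun z hz => h4U (hsh z hz)
    have hh := h.mono hWo (hW4.trans h4U)
    have cac := hh.caccioppoli h' (f₀ := f z₀) (ε := ε) (Λ := Λ) (M := M)
      (fun z hz => hfε z (hW4 hz)) (fun z hz => hfε _ (hsh z hz)) (fun z hz => hΛ z (h4U (hW4 hz)))
      (fun z hz => hΛ _ (h4U (hsh z hz))) (fun z hz => hL z (h4U (hW4 hz)) _ (h4U (hsh z hz)))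
      hM hΛ0 hεΛ hsmall hηW
    have Lq : MemLp (fun z => (f (z + τ) - f z) * wirt (fun z => (η z : ℂ)) z) 2 :=
      (MemLpLoc.of_continuousOn (h'.continuousOn.sub hh.continuousOn)).memLp_mul_test hηW.wirt
    have Lu : MemLp (fun z => (u (z + τ) - u z) * (η z : ℂ)) 2 :=
      (h'.memLpLoc_wirt.sub hh.memLpLoc_wirt).memLp_mul_test hηW
    have Lv : MemLp (fun z => (v (z + τ) - v z) * (η z : ℂ)) 2 :=
      (h'.memLpLoc_wirtBar.sub hh.memLpLoc_wirtBar).memLp_mul_test hηW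
    have hZ0 : 0 ≤ ∫ z, ‖(f (z + τ) - f z) * wirt (fun z => (η z : ℂ)) z‖ ^ 2 :=
      integral_nonneg fun z => by positivity
    have hq : eLpNorm (fun z => (f (z + τ) - f z) * wirt (fun z => (η z : ℂ)) z) 2 ≤
        ENNReal.ofReal k * (‖τ‖ₑ * A) := by
      refine (eLpNorm_le_mul_eLpNorm_of_ae_le_mul (c := k) (g := fun z => f (z + τ) * (χ (z + τ) : ℂ) -
        f z * (χ z : ℂ)) (Eventually.of_forall fun z => ?_) 2).trans
        (mul_le_mul_right (hF.eLpNorm_translate_sub_le τ) _)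
      by_cases hz : z ∈ Metric.ball z₀ (2 * r)
      · have hzW : z ∈ W := Metric.ball_subset_ball (by linarith) hz
        rw [hχV z (hKV (hW4 hzW)), hχV _ (hKV (hsh z hzW)), norm_mul, mul_comm]
        simp only [Complex.ofReal_one, mul_one]
        gcongr
        exact hk z
      · rw [hη.wirt.eq_zero hz]
        simp only [mul_zero, norm_zero]
        positivity
    exact ⟨(eLpNorm_two_le_of_integral_sq_le Lu Lq (by norm_num) (by linarith [cac.1])).trans
      (mul_le_mul_right hq _), (eLpNorm_two_le_of_integral_sq_le Lv Lq (by norm_num)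
      (by linarith [cac.2])).trans (mul_le_mul_right hq _)⟩
  have fin : ∀ {w : ℂ → ℂ}, MemLpLoc 2 U w → (∀ τ : ℂ, ‖τ‖ < r →
      eLpNorm (fun z => (w (z + τ) - w z) * η z) 2 ≤
        ENNReal.ofReal 10 * (ENNReal.ofReal k * (‖τ‖ₑ * A))) →
      ∃ a b, HasWeakWirt (Metric.ball z₀ r) w a b ∧ MemLp a 2 ∧ MemLp b 2 := fun {w} hw hest => by
    have hKm : MeasurableSet (Metric.closedBall z₀ (4 * r)) := Metric.isClosed_closedBall.measurableSet
    set w0 := (Metric.closedBall z₀ (4 * r)).indicator w with hw0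
    have hi : LocallyIntegrable w0 := by
      refine Integrable.locallyIntegrable ?_
      rw [integrable_indicator_iff hKm]
      exact memLp_one_iff_integrable.1 (((hw.mono_exponent (p := 1) (by norm_num)) _ h4U
        (isCompact_closedBall _ _)))
    set t : ℕ → ℝ := fun n => r / (n + 2) with ht
    have ht0 : ∀ n, 0 < t n := fun n => by positivity
    have htr : ∀ n, t n < r := fun n => by
      rw [ht]
      refine div_lt_self hr0 ?_
      linarith [(Nat.cast_nonneg n : (0 : ℝ) ≤ n)]
    have htend : Tendsto t atTop (𝓝[≠] 0) := by
      refine tendsto_nhdsWithin_iff.2 ⟨?_, Eventually.of_forall fun n => (ht0 n).ne'⟩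
      have h1 : Tendsto (fun n : ℕ => (n : ℝ) + 2) atTop atTop :=
        tendsto_atTop_add_const_right _ _ tendsto_natCast_atTop_atTop
      exact h1.const_div_atTop r
    obtain ⟨a, b, hab, ha, hb⟩ := exists_hasWeakWirt_of_difference_quotient hi
      (Metric.isOpen_ball (x := z₀) (ε := r)) (C := 10 * k * A.toReal) htend fun e he n => by
        have hte : ‖(t n * e : ℂ)‖ = t n := by
          rw [norm_mul, he, mul_one, Complex.norm_real, Real.norm_of_nonneg (ht0 n).le]
        have hte' : ‖(t n * e : ℂ)‖ < r := by rw [hte]; exact htr n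
        have h1 := hest _ hte'
        calc _ ≤ ENNReal.ofReal (1 / t n) *
              eLpNorm (fun z => (w (z + t n * e) - w z) * η z) 2
                (volume.restrict (Metric.ball z₀ r)) := by
              refine eLpNorm_le_mul_eLpNorm_of_ae_le_mul ((ae_restrict_iff'
                Metric.isOpen_ball.measurableSet).2 (Eventually.of_forall fun z hz => ?_)) 2
              have z1 : z ∈ Metric.closedBall z₀ (4 * r) :=
                Metric.ball_subset_closedBall (Metric.ball_subset_ball (by linarith) hz)
              have z2 : z + t n * e ∈ Metric.closedBall z₀ (4 * r) := by
                have := hshift (s := 1) hte' z (by rwa [one_mul])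
                exact Metric.ball_subset_closedBall (Metric.ball_subset_ball (by linarith) this)
              rw [hw0, indicator_of_mem z1, indicator_of_mem z2,
                hηV z (hKV' (Metric.ball_subset_closedBall hz)), norm_div, Complex.norm_real,
                Real.norm_of_nonneg (ht0 n).le]
              simp [div_eq_inv_mul]
          _ ≤ ENNReal.ofReal (1 / t n) * (ENNReal.ofReal 10 * (ENNReal.ofReal k *
              (‖(t n * e : ℂ)‖ₑ * A))) := by
              gcongr
              exact (eLpNorm_mono_measure _ Measure.restrict_le_self).trans h1
          _ = ENNReal.ofReal (10 * k * A.toReal) := by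
              rw [← ofReal_norm, hte]
              nth_rw 1 [← ENNReal.ofReal_toReal hAt]
              rw [← ENNReal.ofReal_mul (ht0 n).le, ← ENNReal.ofReal_mul hk0,
                ← ENNReal.ofReal_mul (by norm_num), ← ENNReal.ofReal_mul (by positivity)]
              congr 1
              have := (ht0 n).ne'
              field_simp
    refine ⟨a, b, hab.congr Metric.isOpen_ball ?_ (ae_eq_refl _) (ae_eq_refl _), ha, hb⟩
    refine (ae_restrict_iff' Metric.isOpen_ball.measurableSet).2 (Eventually.of_forall fun z hz => ?_)
    exact indicator_of_mem (Metric.ball_subset_closedBall (Metric.ball_subset_ball (by linarith) hz)) _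
  refine ⟨r, hr0, fun z hz => h4U (Metric.ball_subset_closedBall
    (Metric.ball_subset_ball (by linarith) hz)), fin h.memLpLoc_wirt fun τ hτ => (hest τ hτ).1,
    fin h.memLpLoc_wirtBar fun τ hτ => (hest τ hτ).2⟩

end WeakHarmonic
end

noncomputable section

open MeasureTheory Set Filter Topology
open scoped ContDiff ComplexConjugate ENNReal

theorem contDiffOn_succ_of_hasFDerivAt_wirtL {U : Set ℂ} (hU : IsOpen U) {f a b : ℂ → ℂ} {n : ℕ}
    (h : ∀ z ∈ U, HasFDerivAt f (wirtL (a z) (b z)) z) (ha : ContDiffOn ℝ n a U)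
    (hb : ContDiffOn ℝ n b U) : ContDiffOn ℝ (n + 1) f U := by
  rw [contDiffOn_succ_iff_fderiv_of_isOpen hU]
  refine ⟨fun z hz => (h z hz).differentiableAt.differentiableWithinAt, by simp, ?_⟩
  have h1 : ContDiffOn ℝ n (fun z => wirtL (a z) (b z)) U :=
    ((ContinuousLinearMap.mul ℝ ℂ).contDiff.comp_contDiffOn ha).add
      (((ContinuousLinearMap.mul ℝ ℂ).contDiff.comp_contDiffOn hb).clm_comp contDiffOn_const)
  exact h1.congr fun z hz => (h z hz).fderiv

instance holderTriple_eight_eight : ENNReal.HolderTriple 8 8 4 := by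
  refine ⟨?_⟩
  rw [← two_mul, show (8 : ℝ≥0∞) = 2 * 4 by norm_num, ENNReal.mul_inv (by simp) (by simp),
    ← mul_assoc, ENNReal.mul_inv_cancel (by simp) (by simp), one_mul]

/-- Interchange of weak derivatives. -/
theorem HasWeakWirt.hasWeakBar_wirt {U : Set ℂ} {u a b c d : ℂ → ℂ} (h : HasWeakWirt U u a b)
    (hb : HasWeakWirt U b c d) : HasWeakBar U a c := by
  refine ⟨h.memLpLoc_wirt, hb.memLpLoc_wirt, fun φ hφ => ?_⟩
  have e1 := h.integral_wirt _ hφ.wirtBar.contDiff hφ.wirtBar.compact hφ.wirtBar.subset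
  have e2 := h.integral_wirtBar _ hφ.wirt.contDiff hφ.wirt.compact hφ.wirt.subset
  have e3 := hb.integral_wirt φ hφ.contDiff hφ.compact hφ.subset
  simp_rw [wirtBar_wirt_comm isOpen_univ (contDiff_infty.1 hφ.contDiff 2).contDiffOn
    (mem_univ _)] at e2
  rw [e1] at e2
  rw [neg_injective e2, e3]

namespace WeakHarmonic
variable {U V : Set ℂ} {f u v L : ℂ → ℂ}

theorem hasWeakBar_wirt (h : WeakHarmonic U f u v L) :
    HasWeakBar U u (fun z => -(L z * u z * v z)) :=
  ⟨h.weak.memLpLoc_wirt, h.memLpLoc_tension.neg, fun φ hφ => by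
    rw [h.integral_eq φ hφ, ← integral_neg]; simp⟩

theorem hasWeakBar_star_wirtBar (h : WeakHarmonic U f u v L) :
    HasWeakBar U (fun z => conj (v z)) (fun z => conj (-(L z * u z * v z))) := by
  refine ⟨h.weak.memLpLoc_wirtBar.star, h.memLpLoc_tension.neg.star, fun φ hφ => ?_⟩
  have e1 := h.weak.integral_wirt _ hφ.star.wirtBar.contDiff hφ.star.wirtBar.compact
    hφ.star.wirtBar.subset
  have e2 := h.weak.integral_wirtBar _ hφ.star.wirt.contDiff hφ.star.wirt.compact
    hφ.star.wirt.subset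
  simp_rw [wirtBar_wirt_comm isOpen_univ (contDiff_infty.1 hφ.star.contDiff 2).contDiffOn
    (mem_univ _)] at e2
  rw [e1, h.integral_eq _ hφ.star] at e2
  have e3 := congrArg conj (neg_injective e2)
  rw [← integral_conj, ← integral_conj] at e3
  simp_rw [hφ.wirt_star, map_mul, Complex.conj_conj] at e3
  rw [← e3, ← integral_neg]
  simp

/-- Weak solutions with derivatives in `W^{1,2}` are classical. -/
theorem regularity (h : WeakHarmonic U f u v L) {u₁ u₂ v₁ v₂ p q : ℂ → ℂ}
    (hu : HasWeakWirt U u u₁ u₂) (hv : HasWeakWirt U v v₁ v₂) (hu₁ : MemLpLoc 2 U u₁)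
    (hu₂ : MemLpLoc 2 U u₂) (hv₂ : MemLpLoc 2 U v₂)
    (hL : HasWeakWirt U L (fun z => p z * u z + q z * conj (v z))
      (fun z => p z * v z + q z * conj (u z)))
    (hp : ContinuousOn p U) (hq : ContinuousOn q U) {z₀ : ℂ} (hz₀ : z₀ ∈ U) :
    ∃ r, 0 < r ∧ Metric.ball z₀ r ⊆ U ∧ ContDiffOn ℝ 2 f (Metric.ball z₀ r) ∧
      ∀ z ∈ Metric.ball z₀ r, wirtBar (wirt f) z + L z * wirt f z * wirtBar f z = 0 := by
  have hU := h.isOpen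
  obtain ⟨R, hR, hRU⟩ := Metric.nhds_basis_closedBall.mem_iff.1 (hU.mem_nhds hz₀)
  have hB := Metric.isOpen_ball (x := z₀) (ε := R)
  have hBR : Metric.ball z₀ R ⊆ Metric.closedBall z₀ R := Metric.ball_subset_closedBall
  have hBU := hBR.trans hRU
  -- continuity of the first derivatives
  have hH : MemLpLoc 2 U (fun z => -(L z * u z * v z)) :=
    hu₂.congr (hu.bar.unique hU h.hasWeakBar_wirt)
  have hu8 := h.hasWeakBar_wirt.memLpLoc_eight hU h.memLpLoc_wirt hH
  have hv8 := h.hasWeakBar_star_wirtBar.memLpLoc_eight hU h.memLpLoc_wirtBar.star hH.star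
  have hv8' : MemLpLoc 8 U v := by simpa using hv8.star
  have hH4 : MemLpLoc 4 U (fun z => -(L z * u z * v z)) := by
    have h1 : MemLpLoc 8 U (fun z => L z * u z) :=
      (MemLpLoc.of_continuousOn (p := ⊤) h.continuousOn_coeff).mul hu8
    exact (h1.mul hv8').neg
  have h48 : (4 : ℝ≥0∞) ≤ 8 := by norm_num
  obtain ⟨u', hu'c, hu'⟩ := h.hasWeakBar_wirt.exists_continuous_on hU (hu8.mono_exponent h48) hH4
    (isCompact_closedBall z₀ R) hRU
  obtain ⟨v', hv'c, hv'⟩ := h.hasWeakBar_star_wirtBar.exists_continuous_on hU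
    (hv8.mono_exponent h48) hH4.star (isCompact_closedBall z₀ R) hRU
  replace hu' := ae_restrict_of_ae_restrict_of_subset hBR hu'
  replace hv' : v =ᵐ[volume.restrict (Metric.ball z₀ R)] fun z => conj (v' z) := by
    filter_upwards [ae_restrict_of_ae_restrict_of_subset hBR hv'] with z hz
    rw [← hz, Complex.conj_conj]
  obtain ⟨w, hwc, hw⟩ : ∃ w : ℂ → ℂ, Continuous w ∧ v =ᵐ[volume.restrict (Metric.ball z₀ R)] w :=
    ⟨_, Complex.continuous_conj.comp hv'c, hv'⟩
  clear hv' hv'c v'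
  have hLc := h.continuousOn_coeff.mono hBU
  have hpc := hp.mono hBU
  have hqc := hq.mono hBU
  have hHe : (fun z => -(L z * u z * v z)) =ᵐ[volume.restrict (Metric.ball z₀ R)]
      fun z => -(L z * u' z * w z) := by
    filter_upwards [hu', hw] with z h1 h2
    rw [h1, h2]
  have hHc : ContinuousOn (fun z => -(L z * u' z * w z)) (Metric.ball z₀ R) :=
    ((hLc.mul hu'c.continuousOn).mul hwc.continuousOn).neg
  have hf' : HasWeakWirt (Metric.ball z₀ R) f u' w :=
    (h.weak.mono hBU).congr hB (ae_eq_refl _) hu' hw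
  have huw : HasWeakWirt (Metric.ball z₀ R) u' u₁ (fun z => -(L z * u' z * w z)) :=
    (hu.mono hBU).congr hB hu' (ae_eq_refl _)
      (((hu.bar.unique hU h.hasWeakBar_wirt).filter_mono
        (ae_mono (Measure.restrict_mono hBU le_rfl))).trans hHe)
  have hvw : HasWeakWirt (Metric.ball z₀ R) w (fun z => -(L z * u' z * w z)) v₂ := by
    refine (hv.mono hBU).congr hB hw ?_ (ae_eq_refl _)
    refine EventuallyEq.trans ?_ hHe
    filter_upwards [ae_restrict_of_ae_restrict_of_subset hBU
      (hv.star.bar.unique hU h.hasWeakBar_star_wirtBar)] with z hz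
    exact (starRingEnd ℂ).injective hz
  -- continuity of the second derivatives
  have hLw : HasWeakWirt (Metric.ball z₀ R) L (fun z => p z * u' z + q z * conj (w z))
      (fun z => p z * w z + q z * conj (u' z)) := by
    refine (hL.mono hBU).congr hB (ae_eq_refl _) ?_ ?_ <;>
      filter_upwards [hu', hw] with z h1 h2 <;> rw [h1, h2]
  have hu'T : MemLpLoc ⊤ (Metric.ball z₀ R) u' := .of_continuousOn hu'c.continuousOn
  have hwT : MemLpLoc ⊤ (Metric.ball z₀ R) w := .of_continuousOn hwc.continuousOn
  have hLT : MemLpLoc ⊤ (Metric.ball z₀ R) L := .of_continuousOn hLc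
  have hHw := ((hLw.mul huw hB hLT hu'T).mul hvw hB (hLT.mul hu'T) hwT).const_mul (-1)
  have hHw' := hHw.congr hB (v := fun z => -(L z * u' z * w z))
    (a' := fun z => ((-1) * ((p z * u' z + q z * conj (w z)) * u' z * w z +
      L z * u' z * -(L z * u' z * w z))) + (-1 * L z * w z) * u₁ z)
    (b' := fun z => ((-1) * ((p z * w z + q z * conj (u' z)) * u' z * w z +
      L z * -(L z * u' z * w z) * w z)) + (-1 * L z * u' z) * v₂ z)
    (.of_forall fun z => by simp) (.of_forall fun z => by ring) (.of_forall fun z => by ring)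
  have hcc : ∀ {s : ℂ → ℂ}, Continuous s → ContinuousOn (fun z => conj (s z)) (Metric.ball z₀ R) :=
    fun hs => (Complex.continuous_conj.comp hs).continuousOn
  have h1c : ContinuousOn (fun z => (-1) * ((p z * u' z + q z * conj (w z)) * u' z * w z +
      L z * u' z * -(L z * u' z * w z))) (Metric.ball z₀ R) :=
    continuousOn_const.mul ((((((hpc.mul hu'c.continuousOn).add (hqc.mul (hcc hwc))).mul
      hu'c.continuousOn).mul hwc.continuousOn)).add ((hLc.mul hu'c.continuousOn).mul hHc))
  have h2c : ContinuousOn (fun z => (-1) * ((p z * w z + q z * conj (u' z)) * u' z * w z +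
      L z * -(L z * u' z * w z) * w z)) (Metric.ball z₀ R) :=
    continuousOn_const.mul ((((((hpc.mul hwc.continuousOn).add (hqc.mul (hcc hu'c))).mul
      hu'c.continuousOn).mul hwc.continuousOn)).add ((hLc.mul hHc).mul hwc.continuousOn))
  have hT1 : MemLpLoc ⊤ (Metric.ball z₀ R) (fun z => -1 * L z * w z) :=
    .of_continuousOn ((continuousOn_const.mul hLc).mul hwc.continuousOn)
  have hT2 : MemLpLoc ⊤ (Metric.ball z₀ R) (fun z => -1 * L z * u' z) :=
    .of_continuousOn ((continuousOn_const.mul hLc).mul hu'c.continuousOn)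
  have hbu := huw.hasWeakBar_wirt hHw'
  have hbv := hvw.star.hasWeakBar_wirt hHw'.star
  have hu₁' := hu₁.mono_set hBU
  have hv₂' := hv₂.mono_set hBU
  have hu₁8 := (hbu.memLpLoc_eight hB hu₁'
    ((MemLpLoc.of_continuousOn h1c).add (hT1.mul hu₁'))).mono_exponent h48
  have hv₂8 := (hbv.memLpLoc_eight hB hv₂'.star
    ((MemLpLoc.of_continuousOn h2c).add (hT2.mul hv₂')).star).mono_exponent h48
  have hv₂8' : MemLpLoc 4 (Metric.ball z₀ R) v₂ := by simpa using hv₂8.star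
  have hr : 0 < R / 2 := by positivity
  have hrR : Metric.closedBall z₀ (R / 2) ⊆ Metric.ball z₀ R :=
    Metric.closedBall_subset_ball (by linarith)
  obtain ⟨a, hac, ha⟩ := hbu.exists_continuous_on hB hu₁8
    ((MemLpLoc.of_continuousOn h1c).add (hT1.mul hu₁8)) (isCompact_closedBall z₀ (R / 2)) hrR
  obtain ⟨b, hbc, hb⟩ := hbv.exists_continuous_on hB hv₂8
    ((MemLpLoc.of_continuousOn h2c).add (hT2.mul hv₂8')).star (isCompact_closedBall z₀ (R / 2)) hrR
  have hDD : Metric.ball z₀ (R / 2) ⊆ Metric.closedBall z₀ (R / 2) := Metric.ball_subset_closedBall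
  have hD := Metric.isOpen_ball (x := z₀) (ε := R / 2)
  have hDB := hDD.trans hrR
  -- conclusion
  have du : ∀ z ∈ Metric.ball z₀ (R / 2),
      HasFDerivAt u' (wirtL (a z) (-(L z * u' z * w z))) z := fun z hz =>
    ((huw.mono hDB).congr hD (ae_eq_refl _) (ae_restrict_of_ae_restrict_of_subset hDD ha)
      (ae_eq_refl _)).hasFDerivAt_of_continuousOn hD hu'c.continuousOn hac.continuousOn
      (hHc.mono hDB) hz
  have dw : ∀ z ∈ Metric.ball z₀ (R / 2),
      HasFDerivAt w (wirtL (-(L z * u' z * w z)) (conj (b z))) z := fun z hz => by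
    refine ((hvw.mono hDB).congr hD (ae_eq_refl _) (ae_eq_refl _)
      (b' := fun z => conj (b z)) ?_).hasFDerivAt_of_continuousOn hD hwc.continuousOn
      (hHc.mono hDB) (Complex.continuous_conj.comp hbc).continuousOn hz
    filter_upwards [ae_restrict_of_ae_restrict_of_subset hDD hb] with z hz
    rw [← hz, Complex.conj_conj]
  have df : ∀ z ∈ Metric.ball z₀ (R / 2), HasFDerivAt f (wirtL (u' z) (w z)) z := fun z hz =>
    (hf'.mono hDB).hasFDerivAt_of_continuousOn hD (h.continuousOn.mono (hDB.trans hBU))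
      hu'c.continuousOn hwc.continuousOn hz
  have cu : ContDiffOn ℝ ((0 : ℕ) + 1) u' (Metric.ball z₀ (R / 2)) :=
    contDiffOn_succ_of_hasFDerivAt_wirtL hD du (contDiffOn_zero.2 hac.continuousOn)
      (contDiffOn_zero.2 (hHc.mono hDB))
  have cw : ContDiffOn ℝ ((0 : ℕ) + 1) w (Metric.ball z₀ (R / 2)) :=
    contDiffOn_succ_of_hasFDerivAt_wirtL hD dw (contDiffOn_zero.2 (hHc.mono hDB))
      (contDiffOn_zero.2 (Complex.continuous_conj.comp hbc).continuousOn)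
  refine ⟨R / 2, hr, hDB.trans hBU, ?_, fun z hz => ?_⟩
  · have := contDiffOn_succ_of_hasFDerivAt_wirtL (n := 1) hD df (by simpa using cu)
      (by simpa using cw)
    exact this.of_le (by norm_num)
  · have e : wirt f =ᶠ[𝓝 z] u' := by
      filter_upwards [hD.mem_nhds hz] with x hx
      exact (df x hx).wirt_eq
    have e2 : wirtBar (wirt f) z = -(L z * u' z * w z) :=
      ((du z hz).congr_of_eventuallyEq e).wirtBar_eq
    rw [e2, (df z hz).wirt_eq, (df z hz).wirtBar_eq]
    ring

end WeakHarmonic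
end

noncomputable section

open MeasureTheory Set Filter Topology
open scoped ContDiff ComplexConjugate ENNReal

theorem IsQuasiconformal.exists_qcData {g : OpenPartialHomeomorph ℂ ℂ} (hg : IsQuasiconformal g)
    {k₀ : ℝ} (hk₀ : k₀ < 1) : ∃ a b k, k₀ ≤ k ∧ QCData g a b k := by
  obtain ⟨⟨-, a₁, b₁, h1, ha1, hb1⟩, a₂, b₂, h2, k, hk, hle⟩ := hg
  have hU := g.open_source
  obtain ⟨ea, eb⟩ := h1.unique hU h2
  obtain ⟨a, ham, hae⟩ := h1.memLpLoc_wirt.aestronglyMeasurable hU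
  obtain ⟨b, hbm, hbe⟩ := h1.memLpLoc_wirtBar.aestronglyMeasurable hU
  set K := max k (max k₀ 0) with hK
  have hS : MeasurableSet {w | ‖b w‖ ≤ K * ‖a w‖} :=
    measurableSet_le hbm.norm.measurable (ham.norm.measurable.const_mul K)
  have hbS : b₁ =ᵐ[volume.restrict g.source] {w | ‖b w‖ ≤ K * ‖a w‖}.indicator b := by
    filter_upwards [ea, eb, hae, hbe, hle] with w w1 w2 w3 w4 w5
    rw [indicator_of_mem, w4]
    rw [mem_ofPred_eq, ← w4, ← w3, w1, w2]
    exact w5.trans (mul_le_mul_of_nonneg_right (le_max_left _ _) (norm_nonneg _))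
  refine ⟨a, {w | ‖b w‖ ≤ K * ‖a w‖}.indicator b, K, (le_max_left _ _).trans (le_max_right _ _),
    ham.measurable, hbm.measurable.indicator hS, h1.congr hU (ae_eq_refl _) hae hbS,
    ha1.congr hae, hb1.congr hbS, (le_max_right _ _).trans (le_max_right _ _),
    max_lt hk (max_lt hk₀ one_pos), fun w => ?_⟩
  by_cases hw : w ∈ {w | ‖b w‖ ≤ K * ‖a w‖}
  · rw [indicator_of_mem hw]; exact hw
  · rw [indicator_of_notMem hw, norm_zero]
    exact mul_nonneg ((le_max_right _ _).trans (le_max_right _ _)) (norm_nonneg _)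

theorem wirt_comp_add_const (h : ℂ → ℂ) (c z : ℂ) : wirt (fun w => h (w + c)) z = wirt h (z + c) := by
  simp only [wirt, fderiv_comp_add_right]

theorem wirtBar_comp_add_const (h : ℂ → ℂ) (c z : ℂ) :
    wirtBar (fun w => h (w + c)) z = wirtBar h (z + c) := by
  simp only [wirtBar, fderiv_comp_add_right]

theorem WeakHarmonic.exists_regular {U W : Set ℂ} {f u v l : ℂ → ℂ}
    (h : WeakHarmonic U f u v (fun z => l (f z))) (hW : IsOpen W) (hl : ContDiffOn ℝ 1 l W)
    (hf : MapsTo f U W) {z₀ : ℂ} (hz₀ : z₀ ∈ U) :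
    ∃ r, 0 < r ∧ Metric.ball z₀ r ⊆ U ∧ ContDiffOn ℝ 2 f (Metric.ball z₀ r) ∧
      ∀ z ∈ Metric.ball z₀ r, wirtBar (wirt f) z + l (f z) * wirt f z * wirtBar f z = 0 := by
  have hWn := hW.mem_nhds (hf hz₀)
  obtain ⟨K, t, ht, hKt⟩ := (hl.contDiffAt hWn).exists_lipschitzOnWith
  obtain ⟨R, hR, hRt⟩ := Metric.nhds_basis_closedBall.mem_iff.1 (inter_mem ht hWn)
  obtain ⟨s, hs, hsU⟩ := Metric.nhds_basis_ball.mem_iff.1 (inter_mem (h.isOpen.mem_nhds hz₀)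
    ((h.continuousOn.continuousAt (h.isOpen.mem_nhds hz₀)).preimage_mem_nhds
      (Metric.closedBall_mem_nhds (f z₀) hR)))
  have hB := Metric.isOpen_ball (x := z₀) (ε := s)
  have hsR : ∀ z ∈ Metric.ball z₀ s, f z ∈ Metric.closedBall (f z₀) R := fun z hz => (hsU hz).2
  have hst : ∀ z ∈ Metric.ball z₀ s, f z ∈ t := fun z hz => (hRt (hsR z hz)).1
  have hz₀s := Metric.mem_ball_self (x := z₀) hs
  have h1 := h.mono hB fun z hz => (hsU hz).1
  have hlip : ∀ z ∈ Metric.ball z₀ s, ∀ z' ∈ Metric.ball z₀ s,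
      ‖l (f z') - l (f z)‖ ≤ K * ‖f z' - f z‖ := fun z hz z' hz' => by
    simpa only [dist_eq_norm] using hKt.dist_le_mul _ (hst z' hz') _ (hst z hz)
  have hLw := (h1.weak.sub_const hB (f z₀)).comp hB hR.le (β := fun m => l (m + f z₀))
    ((ae_restrict_iff' hB.measurableSet).2 (.of_forall fun z hz => by
      simpa only [Metric.mem_closedBall, dist_eq_norm] using hsR z hz))
    fun m hm => ContDiffAt.comp (g := l) m (hl.contDiffAt (hW.mem_nhds (hRt (by
      simpa [dist_eq_norm] using hm)).2)) (contDiff_id.add contDiff_const).contDiffAt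
  simp only [wirt_comp_add_const, wirtBar_comp_add_const, sub_add_cancel] at hLw
  obtain ⟨r, hr, hrs, ⟨a, b, hu, ha, hb⟩, a', b', hv, ha', hb'⟩ :=
    h1.exists_sobolev (Λ := ‖l (f z₀)‖ + K * R) K.2 (by positivity) (fun z hz => by
      have e1 := hlip z₀ hz₀s z hz
      have e2 : ‖f z - f z₀‖ ≤ R := by
        simpa only [Metric.mem_closedBall, dist_eq_norm] using hsR z hz
      calc ‖l (f z)‖ = ‖l (f z₀) + (l (f z) - l (f z₀))‖ := by congr 1; ring
        _ ≤ ‖l (f z₀)‖ + K * ‖f z - f z₀‖ := (norm_add_le _ _).trans (by gcongr)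
        _ ≤ _ := by gcongr) hlip hz₀s
  have hrW : MapsTo f (Metric.ball z₀ r) W := fun z hz => hf (hsU (hrs hz)).1
  have hfc : ContinuousOn f (Metric.ball z₀ r) := h1.continuousOn.mono hrs
  obtain ⟨r', hr', hrr, h2, h3⟩ := (h1.mono Metric.isOpen_ball hrs).regularity hu hv
    (ha.memLpLoc _) (hb.memLpLoc _) (hb'.memLpLoc _) (hLw.mono hrs)
    (((hl.wirt hW (m := 0) (by simp)).continuousOn).comp hfc hrW)
    (((hl.wirtBar hW (m := 0) (by simp)).continuousOn).comp hfc hrW) (Metric.mem_ball_self hr)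
  exact ⟨r', hr', fun z hz => (hsU (hrs (hrr hz))).1, h2, h3⟩

theorem QCData.weakHarmonic {g : OpenPartialHomeomorph ℂ ℂ} {a b : ℂ → ℂ} {k c r : ℝ} {z₀ : ℂ}
    (h : QCData g a b k) (hc : 0 < c)
    (hBt : Metric.closedBall z₀ r ⊆ g.target) (hs : jacMap g a b (Metric.ball z₀ r) =
    ENNReal.ofReal c • volume.restrict (Metric.ball z₀ r)) {μ μ₁ μ₂ l : ℂ → ℂ}
    (hba : ∀ᵐ w ∂volume.restrict g.source, b w = μ w * a w)
    (hμ : ∀ᵐ w ∂volume.restrict g.source, ‖μ w‖ ≤ k) (hw : HasWeakWirt g.source μ μ₁ μ₂)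
    (heq : ∀ᵐ w ∂volume.restrict g.source, InverseDilatationEq (μ w) (μ₁ w) (μ₂ w) (l w))
    (hl : ContinuousOn l g.source) :
    WeakHarmonic (Metric.ball z₀ r) g.symm (invWirt g a b (Metric.ball z₀ r))
      (invWirtBar g a b (Metric.ball z₀ r)) (fun z => l (g.symm z)) := by
  have hBt' := Metric.ball_subset_closedBall.trans hBt
  have hi := h.inverse hc hBt hs
  have hsrc : (g.symm.restrOpen (Metric.ball z₀ r) Metric.isOpen_ball).source =
      Metric.ball z₀ r := by
    rw [OpenPartialHomeomorph.restrOpen_source]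
    exact inter_eq_right.2 hBt'
  have w1 := hi.weak
  have w2 := hi.memLpLoc_wirt
  have w3 := hi.memLpLoc_wirtBar
  rw [hsrc] at w1 w2 w3
  refine ⟨Metric.isOpen_ball, g.continuousOn_symm.mono hBt', w1, w2, w3, fun z => ?_,
    hl.comp (g.continuousOn_symm.mono hBt') fun z hz => g.map_target (hBt' hz),
    fun φ hφ => h.weak_harmonic hc hBt hs hba hμ hw heq hl hφ⟩
  exact (h.norm_invWirtBar_le _ z).trans (mul_le_of_le_one_left (norm_nonneg _) h.lt_one.le)

theorem contDiffOn_logDensityDeriv {U : Set ℂ} (hU : IsOpen U) {ρ : ℂ → ℝ}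
    (hρ : ContDiffOn ℝ ∞ ρ U) (hpos : ∀ w ∈ U, 0 < ρ w) :
    ContDiffOn ℝ 1 (logDensityDeriv ρ) U := by
  have h1 : ContDiffOn ℝ 2 (fun ζ => (Real.log (ρ ζ) : ℂ)) U :=
    Complex.ofRealCLM.contDiff.comp_contDiffOn
      (((contDiffOn_infty.1 hρ 2).log fun w hw => (hpos w hw).ne'))
  exact h1.wirt hU (by norm_num)

/-- A quasiconformal homeomorphism whose Beltrami coefficient is a weak solution of the first
order equation has a harmonic inverse. -/
theorem isHarmonicInto_symm {ρ : ℂ → ℝ} {g : OpenPartialHomeomorph ℂ ℂ} {μ μ₁ μ₂ : ℂ → ℂ}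
    (hρ : ContDiffOn ℝ ∞ ρ g.source) (hρpos : ∀ w ∈ g.source, 0 < ρ w)
    (hg : IsQuasiconformal g) (hμ : IsBeltramiCoefficient g μ)
    (hlt : eLpNorm μ ⊤ (volume.restrict g.source) < 1) (hw : HasWeakWirt g.source μ μ₁ μ₂)
    (heq : ∀ᵐ w ∂volume.restrict g.source,
      InverseDilatationEq (μ w) (μ₁ w) (μ₂ w) (logDensityDeriv ρ w)) :
    IsHarmonicInto g.target g.source ρ g.symm := by
  obtain ⟨a, b, k, hk, h⟩ := hg.exists_qcData
    (k₀ := (eLpNorm μ ⊤ (volume.restrict g.source)).toReal) (by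
      simpa using (ENNReal.toReal_lt_toReal hlt.ne_top ENNReal.one_ne_top).2 hlt)
  have hμk : ∀ᵐ w ∂volume.restrict g.source, ‖μ w‖ ≤ k := by
    filter_upwards [enorm_ae_le_eLpNormEssSup μ (volume.restrict g.source)] with w hw
    refine le_trans ?_ hk
    rw [← eLpNorm_exponent_top] at hw
    simpa using ENNReal.toReal_mono hlt.ne_top hw
  have hba : ∀ᵐ w ∂volume.restrict g.source, b w = μ w * a w := by
    obtain ⟨-, a', b', h', he⟩ := hμ
    obtain ⟨ea, eb⟩ := h.weak.unique g.open_source h'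
    filter_upwards [ea, eb, he] with w w1 w2 w3
    rw [w1, w2, w3]
  have hl := contDiffOn_logDensityDeriv g.open_source hρ hρpos
  have key : ∀ z₀ ∈ g.target, ∃ r, 0 < r ∧ ContDiffOn ℝ 2 g.symm (Metric.ball z₀ r) ∧
      ∀ z ∈ Metric.ball z₀ r, wirtBar (wirt g.symm) z +
        logDensityDeriv ρ (g.symm z) * wirt g.symm z * wirtBar g.symm z = 0 := fun z₀ hz₀ => by
    obtain ⟨c, r, hc, hr, hBt, hs⟩ := h.exists_scale hz₀
    obtain ⟨r', hr', -, h1, h2⟩ := (h.weakHarmonic hc hBt hs hba hμk hw heq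
      hl.continuousOn).exists_regular g.open_source hl
      (fun z hz => g.map_target (hBt (Metric.ball_subset_closedBall hz))) (Metric.mem_ball_self hr)
    exact ⟨r', hr', h1, h2⟩
  refine ⟨fun z hz => g.map_target hz, fun z hz => ?_, fun z hz => ?_⟩ <;>
    obtain ⟨r, hr, h1, h2⟩ := key z hz
  · exact (h1.contDiffAt (Metric.ball_mem_nhds z hr)).contDiffWithinAt
  · exact h2 z (Metric.mem_ball_self hr)

end

noncomputable section

open MeasureTheory Set Filter Topology
open scoped ContDiff ComplexConjugate ENNReal

section Branch
variable {φ P Q : ℂ → ℂ} {n : ℕ}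

theorem tendsto_branch_quotient
    (hφ : ∀ᶠ ζ in 𝓝 0, HasFDerivAt φ (wirtL (ζ ^ n * P ζ) (conj ζ ^ n * Q ζ)) ζ)
    (hP : ContinuousAt P 0) (hQ : ContinuousAt Q 0) (hP0 : P 0 = 1) (hQ0 : Q 0 = 0)
    (hφ0 : φ 0 = 0) :
    Tendsto (fun ζ => (n + 1) * φ ζ * (ζ ^ (n + 1))⁻¹) (𝓝[≠] 0) (𝓝 1) := by
  have hn1 : (n + 1 : ℂ) ≠ 0 := by exact_mod_cast n.succ_ne_zero
  rw [Metric.tendsto_nhdsWithin_nhds]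
  intro ε hε
  set η := ε / (2 * (n + 1)) with hη
  have hη0 : 0 < η := by positivity
  have hsmall : ∀ᶠ ζ in 𝓝 (0 : ℂ), ‖P ζ - 1‖ + ‖Q ζ‖ < η := by
    have : ContinuousAt (fun ζ => ‖P ζ - 1‖ + ‖Q ζ‖) 0 :=
      (hP.sub continuousAt_const).norm.add hQ.norm
    exact this.eventually_lt_const (by simpa [hP0, hQ0] using hη0)
  obtain ⟨δ, hδ, hb⟩ := Metric.eventually_nhds_iff_ball.1 (hφ.and hsmall)
  refine ⟨δ, hδ, fun {ζ} hζ hζδ => ?_⟩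
  have hζ0 : ζ ≠ 0 := hζ
  have hd : ∀ w ∈ Metric.closedBall (0 : ℂ) ‖ζ‖,
      HasFDerivAt (fun w => φ w + -(n + 1 : ℂ)⁻¹ * w ^ (n + 1))
        (wirtL (w ^ n * (P w - 1)) (conj w ^ n * Q w)) w := fun w hw => by
    have hwδ : w ∈ Metric.ball (0 : ℂ) δ := by
      rw [dist_zero_right] at hζδ
      rw [mem_ball_zero_iff]
      exact (mem_closedBall_zero_iff.1 hw).trans_lt hζδ
    have h1 := (hb w hwδ).1.wirtL_add
      (((hasDerivAt_pow (n + 1) w).const_mul (-(n + 1 : ℂ)⁻¹)).hasFDerivAt_wirtL)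
    convert h1 using 2
    · rw [Nat.add_sub_cancel]; push_cast; field_simp; ring
    · ring
  have hle : ∀ w ∈ Metric.closedBall (0 : ℂ) ‖ζ‖,
      ‖wirtL (w ^ n * (P w - 1)) (conj w ^ n * Q w)‖ ≤ ‖ζ‖ ^ n * η := fun w hw => by
    have hw' := mem_closedBall_zero_iff.1 hw
    have hwδ : w ∈ Metric.ball (0 : ℂ) δ := by
      rw [dist_zero_right] at hζδ
      rw [mem_ball_zero_iff]
      exact hw'.trans_lt hζδ
    refine (norm_wirtL_le _ _).trans ?_
    rw [norm_mul, norm_mul, norm_pow, norm_pow, Complex.norm_conj, ← mul_add]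
    gcongr
    exact (hb w hwδ).2.le
  have hR := (convex_closedBall (0 : ℂ) ‖ζ‖).norm_image_sub_le_of_norm_hasFDerivWithin_le
    (fun w hw => (hd w hw).hasFDerivWithinAt) hle (Metric.mem_closedBall_self (norm_nonneg ζ))
    (mem_closedBall_zero_iff.2 le_rfl : ζ ∈ Metric.closedBall (0 : ℂ) ‖ζ‖)
  simp only [hφ0, sub_zero, zero_add, ne_eq, n.succ_ne_zero, not_false_eq_true, zero_pow,
    mul_zero] at hR
  have hpow : (0 : ℝ) < ‖ζ‖ ^ (n + 1) := by positivity
  have e : (n + 1) * φ ζ * (ζ ^ (n + 1))⁻¹ - 1 =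
      (n + 1) * (φ ζ + -(n + 1 : ℂ)⁻¹ * ζ ^ (n + 1)) * (ζ ^ (n + 1))⁻¹ := by
    field_simp
    ring
  have hn1' : ‖(n + 1 : ℂ)‖ = n + 1 := by exact_mod_cast Complex.norm_natCast (n + 1)
  rw [dist_eq_norm, e, norm_mul, norm_mul, norm_inv, norm_pow, hn1', ← div_eq_mul_inv,
    div_lt_iff₀ hpow]
  calc (n + 1) * ‖φ ζ + -(n + 1 : ℂ)⁻¹ * ζ ^ (n + 1)‖ ≤ (n + 1) * (‖ζ‖ ^ n * η * ‖ζ‖) := by gcongr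
    _ = ε / 2 * ‖ζ‖ ^ (n + 1) := by rw [hη]; field_simp; ring
    _ < ε * ‖ζ‖ ^ (n + 1) := by gcongr; linarith

/-- A map with a branch point is not locally injective. -/
theorem not_injOn_of_branch (hn : n ≠ 0)
    (hφ : ∀ᶠ ζ in 𝓝 0, HasFDerivAt φ (wirtL (ζ ^ n * P ζ) (conj ζ ^ n * Q ζ)) ζ)
    (hP : ContinuousAt P 0) (hQ : ContinuousAt Q 0) (hP0 : P 0 = 1) (hQ0 : Q 0 = 0)
    (hφ0 : φ 0 = 0) {U : Set ℂ} (hU : U ∈ 𝓝 0) : ¬InjOn φ U := by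
  intro hinj
  have hn1 : (n + 1 : ℂ) ≠ 0 := by exact_mod_cast n.succ_ne_zero
  set G : ℂ → ℂ := Function.update (fun ζ => (n + 1) * φ ζ * (ζ ^ (n + 1))⁻¹) 0 1 with hG
  have hG0 : G 0 = 1 := by simp [hG]
  have hGc : ContinuousAt G 0 :=
    continuousAt_update_same.2 (tendsto_branch_quotient hφ hP hQ hP0 hQ0 hφ0)
  have hGne : ∀ {ζ : ℂ}, ζ ≠ 0 → G ζ = (n + 1) * φ ζ * (ζ ^ (n + 1))⁻¹ := fun h => by simp [hG, h]
  set c : ℂ := (n + 1 : ℂ)⁻¹ with hc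
  set ψ : ℂ → ℂ := fun ζ => ζ * G ζ ^ c with hψ
  have hslit : ∀ᶠ ζ in 𝓝 0, G ζ ∈ Complex.slitPlane :=
    hGc.eventually_mem (Complex.isOpen_slitPlane.mem_nhds (by simp [hG0]))
  have hGcpow : ∀ e : ℂ, ContinuousAt (fun ζ => G ζ ^ e) 0 := fun e =>
    hGc.cpow continuousAt_const (by simp [hG0])
  set A : ℂ → ℂ := fun ζ => G ζ ^ (c - 1) * P ζ with hA
  set B : ℂ → ℂ := fun ζ => G ζ ^ (c - 1) * ((conj ζ / ζ) ^ n * Q ζ) with hB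
  have hAc : ContinuousAt A 0 := (hGcpow _).mul hP
  have hBc : ContinuousAt B 0 := by
    refine (hGcpow _).mul ?_
    have h0 : ((conj (0 : ℂ) / 0) ^ n * Q 0) = 0 := by simp [hQ0]
    rw [ContinuousAt, h0, tendsto_zero_iff_norm_tendsto_zero]
    have hQn : Tendsto (fun ζ => ‖Q ζ‖) (𝓝 0) (𝓝 0) := by simpa [hQ0, ContinuousAt] using hQ.norm
    refine squeeze_zero (fun _ => norm_nonneg _) (fun ζ => ?_) hQn
    rw [norm_mul, norm_pow, norm_div, Complex.norm_conj]
    exact mul_le_of_le_one_left (norm_nonneg _) (pow_le_one₀ (by positivity) (div_self_le_one _))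
  have hder : ∀ᶠ ζ in 𝓝 0, HasFDerivAt ψ (wirtL (A ζ) (B ζ)) ζ := by
    filter_upwards [hφ, hslit] with ζ h1 h2
    by_cases hζ : ζ = 0
    · subst hζ
      have hA0 : A 0 = 1 := by simp [hA, hG0, hP0]
      have hB0 : B 0 = 0 := by simp [hB, hQ0]
      rw [hA0, hB0]
      refine HasDerivAt.hasFDerivAt_wirtL ?_
      rw [hasDerivAt_iff_tendsto_slope_zero]
      have : Tendsto (fun t => G t ^ c) (𝓝[≠] 0) (𝓝 1) := by
        have := (hGcpow c).tendsto.mono_left (nhdsWithin_le_nhds (s := {0}ᶜ))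
        simpa [hG0] using this
      refine this.congr' ?_
      filter_upwards [self_mem_nhdsWithin] with t ht
      have ht' : t ≠ 0 := ht
      simp [hψ, ht']
    · have hζn : ζ ^ (n + 1) ≠ 0 := pow_ne_zero _ hζ
      have hinv : HasDerivAt (fun ζ : ℂ => (ζ ^ (n + 1))⁻¹)
          (-(((n + 1 : ℕ) : ℂ) * ζ ^ n) / (ζ ^ (n + 1)) ^ 2) ζ :=
        (hasDerivAt_pow (n + 1) ζ).inv hζn
      have hGd := ((hasFDerivAt_wirtL_const (n + 1) ζ).wirtL_mul h1).wirtL_mul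
        hinv.hasFDerivAt_wirtL
      replace hGd := hGd.congr_of_eventuallyEq (f₁ := G) (by
        filter_upwards [isOpen_ne.mem_nhds hζ] with w hw
        exact hGne hw)
      have hG1 := hGne hζ
      have hGz : G ζ ≠ 0 := Complex.slitPlane_ne_zero h2
      have hpow := ((((hasDerivAt_id (G ζ)).cpow_const (c := c) h2).hasFDerivAt_wirtL).wirtL_comp
        (k := G) hGd)
      have hfin := (hasFDerivAt_wirtL_id ζ).wirtL_mul hpow
      have hGc1 : G ζ ^ c = G ζ ^ (c - 1) * G ζ := by
        rw [Complex.cpow_sub _ _ hGz, Complex.cpow_one, div_mul_cancel₀ _ hGz]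
      have hφG : φ ζ = c * G ζ * ζ ^ (n + 1) := by
        rw [hG1, hc]; field_simp
      refine HasFDerivAt.congr_fderiv hfin ?_
      congr 1
      · simp only [id, hA, hGc1, hφG]
        push_cast
        rw [hc]
        field_simp
        ring
      · simp only [id, hB, div_pow]
        rw [hc]
        field_simp
        ring
  have hstrict : HasStrictFDerivAt ψ (wirtL (A 0) (B 0)) 0 :=
    hasStrictFDerivAt_of_hasFDerivAt_of_continuousAt (f' := fun ζ => wirtL (A ζ) (B ζ)) hder
      (((ContinuousLinearMap.mul ℝ ℂ).continuous.continuousAt.comp hAc).add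
        (((ContinuousLinearMap.mul ℝ ℂ).continuous.continuousAt.comp hBc).clm_comp
          continuousAt_const))
  have hmap := hstrict.map_nhds_eq_of_surj (by
    rw [LinearMap.range_eq_top]
    intro y
    exact ⟨y, by simp [hA, hB, hG0, hP0, hQ0]⟩)
  have hψ0 : ψ 0 = 0 := by simp [hψ]
  rw [hψ0] at hmap
  have himg : ψ '' U ∈ 𝓝 (0 : ℂ) := by rw [← hmap]; exact image_mem_map hU
  obtain ⟨ξ, hξ⟩ : ∃ ξ : ℂ, IsPrimitiveRoot ξ (n + 1) :=
    ⟨_, Complex.isPrimitiveRoot_exp (n + 1) n.succ_ne_zero⟩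
  have himg' : (fun η => ξ * η) ⁻¹' (ψ '' U) ∈ 𝓝 (0 : ℂ) :=
    (continuous_const.mul continuous_id).continuousAt.preimage_mem_nhds (by simpa using himg)
  obtain ⟨η, ⟨⟨ζ, hζ, h1⟩, ζ', hζ', h2⟩, hη⟩ := (Filter.nonempty_of_mem (f := 𝓝[≠] (0 : ℂ))
    (inter_mem (nhdsWithin_le_nhds (inter_mem himg himg')) self_mem_nhdsWithin))
  have hψpow : ∀ ζ, ψ ζ ^ (n + 1) = (n + 1) * φ ζ := fun ζ => by
    by_cases hζ : ζ = 0
    · simp [hζ, hψ0, hφ0]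
    · have : (G ζ ^ c) ^ (n + 1) = G ζ := by
        have := Complex.cpow_nat_inv_pow (G ζ) n.succ_ne_zero
        push_cast at this
        exact this
      rw [hψ, mul_pow, this, hGne hζ]
      field_simp
  have e1 := hψpow ζ
  have e2 := hψpow ζ'
  rw [h2, mul_pow, hξ.pow_eq_one, one_mul, ← h1, e1] at e2
  have hζζ := hinj hζ hζ' (mul_left_cancel₀ hn1 e2)
  rw [← hζζ, h1] at h2
  have hξ1 : ξ = 1 := mul_right_cancel₀ (hη : η ≠ 0) (by rw [one_mul]; exact h2.symm)
  exact hξ.ne_one (by omega) hξ1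

end Branch
end

noncomputable section

open MeasureTheory Set Filter Topology
open scoped ContDiff ComplexConjugate ENNReal

theorem HasFDerivAt.hasDerivAt_of_wirtL {h : ℂ → ℂ} {z a : ℂ} (hd : HasFDerivAt h (wirtL a 0) z) :
    HasDerivAt h a z :=
  hasDerivAt_iff_hasFDerivAt.2 <| hasFDerivAt_of_restrictScalars ℝ hd
    (ContinuousLinearMap.ext fun v => by simp [mul_comm])

/-- The similarity principle. -/
theorem exists_holomorphic_factor {U : Set ℂ} (hU : IsOpen U) {p A : ℂ → ℂ}
    (hp : ContDiffOn ℝ 1 p U) (hA : ContDiffOn ℝ 1 A U) (hpA : ∀ z ∈ U, wirtBar p z = A z * p z)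
    {z₀ : ℂ} (hz₀ : z₀ ∈ U) : ∃ s h : ℂ → ℂ, Continuous s ∧ AnalyticAt ℂ h z₀ ∧
      ∀ z, p z = Complex.exp (s z) * h z := by
  obtain ⟨χ, hχ, -, -, V, hV, hKV, hVU, hχV⟩ := exists_cutoff (isCompact_singleton (x := z₀)) hU
    (singleton_subset_iff.2 hz₀)
  have hsub : tsupport (fun w => (χ w : ℂ) * A w) ⊆ tsupport (fun w => (χ w : ℂ)) :=
    closure_mono fun w hw h0 => hw (by simp [show (χ w : ℂ) = 0 from h0])
  have hc : ContDiff ℝ 1 (fun w => (χ w : ℂ) * A w) := by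
    refine contDiff_iff_contDiffAt.2 fun w => ?_
    by_cases hw : w ∈ U
    · exact (hχ.contDiff.of_le (by simp)).contDiffAt.mul (hA.contDiffAt (hU.mem_nhds hw))
    · exact (contDiffAt_const (c := (0 : ℂ))).congr_of_eventuallyEq
        (notMem_tsupport_iff_eventuallyEq.1 fun h => hw (hχ.subset (hsub h)))
  obtain ⟨s, hs, hsA⟩ := exists_wirtBar_eq hc (hχ.compact.mono' (subset_closure.trans hsub))
  refine ⟨s, fun z => Complex.exp (-s z) * p z, hs.continuous, ?_, fun z => ?_⟩
  · refine DifferentiableOn.analyticAt (s := V) (fun z hz => ?_) (hV.mem_nhds (hKV rfl))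
    have h1 := ((hs.differentiable (by simp)) z).hasFDerivAt_wirtL
    have h2 := ((hp.differentiableOn (by simp)).differentiableAt
      (hU.mem_nhds (hVU hz))).hasFDerivAt_wirtL
    have h3 := (((Complex.hasDerivAt_exp _).hasFDerivAt_wirtL).wirtL_comp
      (k := fun z => (-1) * s z) ((hasFDerivAt_wirtL_const (-1) z).wirtL_mul h1)).wirtL_mul h2
    rw [hsA, hpA z (hVU hz), hχV z hz] at h3
    simp only [neg_one_mul] at h3
    have h4 : HasFDerivAt (fun z => Complex.exp (-s z) * p z)
        (wirtL (Complex.exp (-s z) * (-wirt s z) * p z + Complex.exp (-s z) * wirt p z) 0) z := by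
      refine h3.congr_fderiv ?_
      congr 1
      · simp
      · simp; ring
    exact h4.hasDerivAt_of_wirtL.differentiableAt.differentiableWithinAt
  · rw [← mul_assoc, ← Complex.exp_add, add_neg_cancel, Complex.exp_zero, one_mul]

theorem AnalyticAt.exists_pow_mul_of_norm_le {h κ : ℂ → ℂ} {z₀ : ℂ} {C : ℝ} {n : ℕ}
    (hκ : AnalyticAt ℂ κ z₀) (hh : ContinuousAt h z₀)
    (hle : ∀ᶠ z in 𝓝 z₀, ‖κ z‖ ≤ C * ‖(z - z₀) ^ n * h z‖) :
    ∃ κ₁, AnalyticAt ℂ κ₁ z₀ ∧ ∀ᶠ z in 𝓝 z₀, κ z = (z - z₀) ^ n * κ₁ z := by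
  refine (natCast_le_analyticOrderAt hκ).1 ?_
  by_contra hlt
  push Not at hlt
  obtain ⟨m, hm⟩ := ENat.ne_top_iff_exists.1 hlt.ne_top
  rw [← hm] at hlt
  have hmn : m < n := by exact_mod_cast hlt
  obtain ⟨κ₁, h1, h2, h3⟩ := hκ.analyticOrderAt_eq_natCast.1 hm.symm
  refine h2 (norm_le_zero_iff.1 ?_)
  have l1 : Tendsto (fun z => ‖κ₁ z‖) (𝓝[≠] z₀) (𝓝 ‖κ₁ z₀‖) :=
    (h1.continuousAt.norm.tendsto).mono_left nhdsWithin_le_nhds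
  have l2 : Tendsto (fun z => C * ‖(z - z₀) ^ (n - m) * h z‖) (𝓝[≠] z₀) (𝓝 0) := by
    have : ContinuousAt (fun z => C * ‖(z - z₀) ^ (n - m) * h z‖) z₀ := by fun_prop
    have := this.tendsto.mono_left (nhdsWithin_le_nhds (s := {z₀}ᶜ))
    simpa [Nat.sub_ne_zero_of_lt hmn] using this
  refine le_of_tendsto_of_tendsto l1 l2 ?_
  filter_upwards [nhdsWithin_le_nhds hle, nhdsWithin_le_nhds h3, self_mem_nhdsWithin]
    with z z1 z2 z3
  have hz : 0 < ‖z - z₀‖ ^ m := pow_pos (norm_pos_iff.2 (sub_ne_zero.2 z3)) m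
  rw [z2, smul_eq_mul, norm_mul, norm_mul, norm_pow, norm_pow,
    show n = m + (n - m) by omega, pow_add] at z1
  rw [norm_mul, norm_pow]
  refine le_of_mul_le_mul_left ?_ hz
  calc _ ≤ _ := z1
    _ = _ := by ring

/-- An injective quasiregular solution of the harmonic map equation is an immersion. -/
theorem wirt_ne_zero_of_injOn {U : Set ℂ} (hU : IsOpen U) {f A B : ℂ → ℂ} {k : ℝ}
    (hf : ContDiffOn ℝ 2 f U) (hinj : InjOn f U) (hk : k < 1)
    (hle : ∀ z ∈ U, ‖wirtBar f z‖ ≤ k * ‖wirt f z‖) (hA : ContDiffOn ℝ 1 A U)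
    (hB : ContDiffOn ℝ 1 B U) (hfA : ∀ z ∈ U, wirtBar (wirt f) z = A z * wirt f z)
    (hfB : ∀ z ∈ U, wirtBar (fun z => conj (wirtBar f z)) z = B z * conj (wirtBar f z))
    {z₀ : ℂ} (hz₀ : z₀ ∈ U) : wirt f z₀ ≠ 0 := by
  intro hp0
  have hUn := hU.mem_nhds hz₀
  have hd : ∀ z ∈ U, HasFDerivAt f (wirtL (wirt f z) (wirtBar f z)) z := fun z hz =>
    ((hf.differentiableOn (by simp)).differentiableAt (hU.mem_nhds hz)).hasFDerivAt_wirtL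
  obtain ⟨s, h, hs, hh, hsh⟩ := exists_holomorphic_factor hU
    (hf.wirt hU (m := 1) (by norm_num)) hA hfA hz₀
  obtain ⟨t, κ, ht, hκ, htκ⟩ := exists_holomorphic_factor hU
    (Complex.conjCLE.contDiff.comp_contDiffOn (hf.wirtBar hU (m := 1) (by norm_num))) hB hfB hz₀
  simp only [Function.comp_apply, Complex.conjCLE_apply] at htκ
  have hh0 : h z₀ = 0 := by
    have := hsh z₀
    rw [hp0] at this
    simpa [Complex.exp_ne_zero] using this.symm
  by_cases htop : analyticOrderAt h z₀ = ⊤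
  · obtain ⟨r, hr, hb⟩ := Metric.eventually_nhds_iff_ball.1
      ((analyticOrderAt_eq_top.1 htop).and (hU.eventually_mem hz₀))
    have hc : ∀ z ∈ Metric.ball z₀ r, HasFDerivWithinAt f (0 : ℂ →L[ℝ] ℂ) (Metric.ball z₀ r) z :=
      fun z hz => by
        obtain ⟨h1, h2⟩ := hb z hz
        have e1 : wirt f z = 0 := by rw [hsh z, h1, mul_zero]
        have e2 : wirtBar f z = 0 := by simpa [e1] using hle z h2
        have := (hd z h2).hasFDerivWithinAt (s := Metric.ball z₀ r)
        rw [e1, e2] at this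
        exact this.congr_fderiv (ContinuousLinearMap.ext fun v => by simp)
    have hz₁ : z₀ + (r / 2 : ℝ) ∈ Metric.ball z₀ r := by
      rw [Metric.mem_ball, dist_eq_norm, add_sub_cancel_left, Complex.norm_real, Real.norm_eq_abs,
        abs_of_pos (by positivity)]
      linarith
    have hm := (convex_ball z₀ r).norm_image_sub_le_of_norm_hasFDerivWithin_le (C := 0) hc
      (fun z _ => by simp) (Metric.mem_ball_self hr) hz₁
    rw [zero_mul, norm_le_zero_iff, sub_eq_zero] at hm
    have := hinj (hb _ hz₁).2 hz₀ hm
    rw [add_eq_left, Complex.ofReal_eq_zero] at this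
    linarith
  obtain ⟨h₁, hh₁, hh₁0, hh₁e⟩ := hh.analyticOrderAt_ne_top.1 htop
  set n := analyticOrderNatAt h z₀ with hn
  have hn0 : n ≠ 0 := fun h0 => by
    have := hh₁e.self_of_nhds
    simp only [h0, pow_zero, one_smul] at this
    exact hh₁0 (this.symm.trans hh0)
  have hκle : ∀ᶠ z in 𝓝 z₀, ‖κ z‖ ≤ (‖Complex.exp (s z₀ - t z₀)‖ + 1) * ‖(z - z₀) ^ n * h₁ z‖ := by
    have hcc : ContinuousAt (fun z => ‖Complex.exp (s z - t z)‖) z₀ := by fun_prop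
    filter_upwards [hcc.eventually_lt_const (lt_add_one _), hh₁e, hU.eventually_mem hz₀]
      with z z1 z2 z3
    have e1 : κ z = Complex.exp (-t z) * conj (wirtBar f z) := by
      rw [htκ, ← mul_assoc, ← Complex.exp_add, neg_add_cancel, Complex.exp_zero, one_mul]
    rw [smul_eq_mul] at z2
    rw [← z2, e1, norm_mul, Complex.norm_conj]
    calc ‖Complex.exp (-t z)‖ * ‖wirtBar f z‖ ≤ ‖Complex.exp (-t z)‖ * ‖wirt f z‖ := by
          gcongr
          exact (hle z z3).trans (mul_le_of_le_one_left (norm_nonneg _) hk.le)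
      _ = ‖Complex.exp (s z - t z)‖ * ‖h z‖ := by
          rw [hsh z, norm_mul, ← mul_assoc, ← norm_mul, ← Complex.exp_add]
          congr 3; ring
      _ ≤ _ := by gcongr
  obtain ⟨κ₁, hκ₁, hκ₁e⟩ := hκ.exists_pow_mul_of_norm_le hh₁.continuousAt hκle
  set P : ℂ → ℂ := fun ζ => Complex.exp (s (z₀ + ζ)) * h₁ (z₀ + ζ) with hP
  set Q : ℂ → ℂ := fun ζ => conj (Complex.exp (t (z₀ + ζ)) * κ₁ (z₀ + ζ)) with hQ
  have htr : ContinuousAt (fun ζ : ℂ => z₀ + ζ) 0 := by fun_prop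
  have htr' : Tendsto (fun ζ : ℂ => z₀ + ζ) (𝓝 0) (𝓝 z₀) := by simpa [ContinuousAt] using htr
  have hPc : ContinuousAt P 0 := by
    refine (Complex.continuous_exp.continuousAt.comp (hs.continuousAt.comp htr)).mul ?_
    exact ContinuousAt.comp (g := h₁) (by simpa using hh₁.continuousAt) htr
  have hQc : ContinuousAt Q 0 := by
    refine Complex.continuous_conj.continuousAt.comp
      ((Complex.continuous_exp.continuousAt.comp (ht.continuousAt.comp htr)).mul ?_)
    exact ContinuousAt.comp (g := κ₁) (by simpa using hκ₁.continuousAt) htr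
  have hfP : ∀ᶠ ζ in 𝓝 0, wirt f (z₀ + ζ) = ζ ^ n * P ζ := by
    filter_upwards [htr'.eventually hh₁e] with ζ hζ
    rw [hsh, hζ, smul_eq_mul, add_sub_cancel_left, hP]; ring
  have hfQ : ∀ᶠ ζ in 𝓝 0, wirtBar f (z₀ + ζ) = conj ζ ^ n * Q ζ := by
    filter_upwards [htr'.eventually hκ₁e] with ζ hζ
    rw [← Complex.conj_conj (wirtBar f (z₀ + ζ)), htκ, hζ, add_sub_cancel_left, hQ]
    simp only [map_mul, map_pow]; ring
  have hP0 : P 0 ≠ 0 := by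
    simp only [hP, add_zero]
    exact mul_ne_zero (Complex.exp_ne_zero _) hh₁0
  have hPQ : ‖Q 0‖ ≤ k * ‖P 0‖ := by
    refine le_of_tendsto_of_tendsto (f := fun ζ => ‖Q ζ‖) (g := fun ζ => k * ‖P ζ‖)
      (hQc.norm.tendsto.mono_left nhdsWithin_le_nhds)
      ((hPc.norm.const_mul k).tendsto.mono_left (nhdsWithin_le_nhds (s := {0}ᶜ))) ?_
    filter_upwards [nhdsWithin_le_nhds hfP, nhdsWithin_le_nhds hfQ, self_mem_nhdsWithin,
      nhdsWithin_le_nhds (htr'.eventually (hU.eventually_mem hz₀))] with ζ z1 z2 z3 z4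
    have := hle _ z4
    rw [z1, z2, norm_mul, norm_mul, norm_pow, norm_pow, Complex.norm_conj] at this
    have hz : 0 < ‖ζ‖ ^ n := pow_pos (norm_pos_iff.2 z3) n
    refine le_of_mul_le_mul_left ?_ hz
    linarith
  set D : ℂ := P 0 * conj (P 0) - Q 0 * conj (Q 0) with hD
  have hD0 : D ≠ 0 := by
    have h1 : 0 < ‖P 0‖ := norm_pos_iff.2 hP0
    have h2 : (‖P 0‖ ^ 2 - ‖Q 0‖ ^ 2 : ℝ) ≠ 0 := by
      have : ‖Q 0‖ < ‖P 0‖ := hPQ.trans_lt (mul_lt_of_lt_one_left h1 hk)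
      have := pow_lt_pow_left₀ this (norm_nonneg _) two_ne_zero
      linarith
    rw [hD, Complex.mul_conj, Complex.mul_conj, Complex.normSq_eq_norm_sq,
      Complex.normSq_eq_norm_sq]
    exact_mod_cast h2
  have hDc : conj D = D := by
    rw [hD]; simp only [map_sub, map_mul, Complex.conj_conj]; ring
  refine not_injOn_of_branch hn0 (φ := fun ζ => conj (P 0) / D * (f (z₀ + ζ) + -f z₀) +
    -Q 0 / D * conj (f (z₀ + ζ) + -f z₀)) (P := fun ζ => conj (P 0) / D * P ζ +
    -Q 0 / D * conj (Q ζ)) (Q := fun ζ => conj (P 0) / D * Q ζ + -Q 0 / D * conj (P ζ)) ?_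
    ((continuousAt_const.mul hPc).add (continuousAt_const.mul
      (Complex.continuous_conj.continuousAt.comp hQc)))
    ((continuousAt_const.mul hQc).add (continuousAt_const.mul
      (Complex.continuous_conj.continuousAt.comp hPc))) ?_ ?_ (by simp)
    (htr'.eventually (hU.eventually_mem hz₀)) ?_
  · filter_upwards [hfP, hfQ, htr'.eventually (hU.eventually_mem hz₀)] with ζ z1 z2 z3
    have d0 := hd _ z3
    rw [z1, z2] at d0
    have d1 : HasFDerivAt (fun ζ => f (z₀ + ζ) + -f z₀)
        (wirtL (ζ ^ n * P ζ) (conj ζ ^ n * Q ζ)) ζ := by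
      have := d0.wirtL_comp (k := fun ζ => z₀ + ζ)
        ((hasFDerivAt_wirtL_const z₀ ζ).wirtL_add (hasFDerivAt_wirtL_id ζ))
      simpa using this.wirtL_add (hasFDerivAt_wirtL_const (-f z₀) ζ)
    have d2 := ((hasFDerivAt_wirtL_const (conj (P 0) / D) ζ).wirtL_mul d1).wirtL_add
      ((hasFDerivAt_wirtL_const (-Q 0 / D) ζ).wirtL_mul d1.wirtL_conj)
    refine d2.congr_fderiv ?_
    congr 1 <;> simp only [map_mul, map_pow, Complex.conj_conj] <;> ring
  · field_simp
    rw [hD]; ring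
  · ring
  · intro ζ hζ ζ' hζ' he
    have hinv : ∀ x : ℂ, P 0 * (conj (P 0) / D * x + -Q 0 / D * conj x) +
        Q 0 * conj (conj (P 0) / D * x + -Q 0 / D * conj x) = x := fun x => by
      simp only [map_add, map_mul, map_div₀, map_neg, Complex.conj_conj, hDc]
      field_simp
      rw [hD]; ring
    have h1 := hinv (f (z₀ + ζ) + -f z₀)
    simp only at he
    rw [he, hinv] at h1
    exact add_left_cancel (hinj hζ hζ' (add_right_cancel h1).symm)

end

noncomputable section

open MeasureTheory Set Filter Topology
open scoped ContDiff ComplexConjugate ENNReal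

theorem le_of_ae_le_of_continuousOn {U : Set ℂ} (hU : IsOpen U) {u v : ℂ → ℝ}
    (hu : ContinuousOn u U) (hv : ContinuousOn v U) (h : ∀ᵐ w ∂volume.restrict U, u w ≤ v w)
    {w : ℂ} (hw : w ∈ U) : u w ≤ v w := by
  have := Measure.eqOn_open_of_ae_eq (f := fun w => max (u w) (v w)) (g := v)
    (h.mono fun w hw => max_eq_right hw) hU (hu.sup hv) hv hw
  exact max_eq_right_iff.1 this

section Inverse
variable {g : OpenPartialHomeomorph ℂ ℂ}

theorem contDiffAt_of_symm (hf : ContDiffOn ℝ 2 g.symm g.target) {w : ℂ} (hw : w ∈ g.source)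
    (hD : ‖wirt g.symm (g w)‖ ^ 2 - ‖wirtBar g.symm (g w)‖ ^ 2 ≠ 0) : ContDiffAt ℝ 2 g w := by
  have hc : ContDiffAt ℝ 2 g.symm (g w) := hf.contDiffAt (g.open_target.mem_nhds (g.map_source hw))
  have hd := (hc.differentiableAt (by norm_num)).hasFDerivAt_wirtL
  rw [← det_wirtL] at hD
  have := g.symm.contDiffAt_symm (n := 2) (a := w) (by simpa using hw)
    (f₀' := ContinuousLinearMap.toContinuousLinearEquivOfDetNeZero _ hD) (by simpa using hd)
    (by simpa using hc)
  simpa using this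

theorem wirt_mul_jacobian_symm {w : ℂ} (hw : w ∈ g.source)
    (hf : DifferentiableAt ℝ g.symm (g w)) (hg : DifferentiableAt ℝ g w) :
    wirt g w * (‖wirt g.symm (g w)‖ ^ 2 - ‖wirtBar g.symm (g w)‖ ^ 2 : ℝ) =
        conj (wirt g.symm (g w)) ∧
      wirtBar g w * (‖wirt g.symm (g w)‖ ^ 2 - ‖wirtBar g.symm (g w)‖ ^ 2 : ℝ) =
        -wirtBar g.symm (g w) := by
  have h1 := hg.hasFDerivAt_wirtL
  rw [← g.left_inv hw] at h1
  have h2 := (h1.wirtL_comp (k := g.symm) hf.hasFDerivAt_wirtL).congr_of_eventuallyEq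
    (f₁ := fun z => z) (by
      filter_upwards [g.open_target.mem_nhds (g.map_source hw)] with z hz
      exact (g.right_inv hz).symm)
  rw [g.left_inv hw] at h2
  have e1 := h2.wirt_eq.symm.trans (hasFDerivAt_wirtL_id _).wirt_eq
  have e2 := h2.wirtBar_eq.symm.trans (hasFDerivAt_wirtL_id _).wirtBar_eq
  push_cast
  simp only [← Complex.mul_conj'] 
  constructor
  · linear_combination conj (wirt g.symm (g w)) * e1 - conj (wirtBar g.symm (g w)) * e2
  · linear_combination wirt g.symm (g w) * e2 - wirtBar g.symm (g w) * e1

theorem QCData.norm_wirtBar_symm_le {a b : ℂ → ℂ} {k : ℝ} (h : QCData g a b k)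
    (hf : ContDiffOn ℝ 2 g.symm g.target) {z : ℂ} (hz : z ∈ g.target) :
    ‖wirtBar g.symm z‖ ≤ k * ‖wirt g.symm z‖ := by
  have hp := (hf.wirt g.open_target (m := 1) (by norm_num)).continuousOn
  have hq := (hf.wirtBar g.open_target (m := 1) (by norm_num)).continuousOn
  have hfd : ∀ z ∈ g.target, DifferentiableAt ℝ g.symm z := fun z hz =>
    (hf.differentiableOn (by norm_num)).differentiableAt (g.open_target.mem_nhds hz)
  set S := g.source ∩ {w | ‖wirt g.symm (g w)‖ ^ 2 - ‖wirtBar g.symm (g w)‖ ^ 2 ≠ 0} with hS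
  have hSo : IsOpen S := (((hp.norm.pow 2).sub (hq.norm.pow 2)).comp g.continuousOn
    g.mapsTo).isOpen_inter_preimage g.open_source isOpen_ne
  have hgS : ContDiffOn ℝ 2 g S := fun w hw =>
    (contDiffAt_of_symm hf hw.1 hw.2).contDiffWithinAt
  have hreg : ∀ z ∈ g.target, ‖wirt g.symm z‖ ^ 2 - ‖wirtBar g.symm z‖ ^ 2 ≠ 0 →
      ‖wirtBar g.symm z‖ ≤ k * ‖wirt g.symm z‖ := fun z hz hD => by
    have hw : g.symm z ∈ S := ⟨g.map_target hz, by simpa [g.right_inv hz] using hD⟩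
    have hw1 := (HasWeakWirt.of_contDiffOn hSo (hgS.of_le (by norm_num))).unique hSo
      (h.weak.mono inter_subset_left)
    have hle : ‖wirtBar g (g.symm z)‖ ≤ k * ‖wirt g (g.symm z)‖ := by
      refine le_of_ae_le_of_continuousOn hSo (u := fun w => ‖wirtBar g w‖)
        (v := fun w => k * ‖wirt g w‖)
        (hgS.wirtBar hSo (m := 1) (by norm_num)).continuousOn.norm
        (continuousOn_const.mul (hgS.wirt hSo (m := 1) (by norm_num)).continuousOn.norm) ?_ hw
      filter_upwards [hw1.1, hw1.2] with w w1 w2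
      rw [w1, w2]
      exact h.norm_le w
    obtain ⟨e1, e2⟩ := wirt_mul_jacobian_symm hw.1 (by rw [g.right_inv hz]; exact hfd z hz)
      ((contDiffAt_of_symm hf hw.1 hw.2).differentiableAt (by norm_num))
    rw [g.right_inv hz] at e1 e2
    have n1 := congrArg norm e1
    have n2 := congrArg norm e2
    rw [norm_mul, Complex.norm_conj] at n1
    rw [norm_mul, norm_neg] at n2
    calc _ = _ := n2.symm
      _ ≤ _ := mul_le_mul_of_nonneg_right hle (norm_nonneg _)
      _ = _ := by rw [mul_assoc, n1]
  by_contra hlt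
  push Not at hlt
  have hat : ∀ {u : ℂ → ℂ}, ContinuousOn u g.target → ContinuousAt u z := fun hu =>
    hu.continuousAt (g.open_target.mem_nhds hz)
  obtain ⟨r, hr, hb⟩ := Metric.eventually_nhds_iff_ball.1 ((((continuousAt_const.mul
    (hat hp).norm)).eventually_lt (hat hq).norm hlt).and (g.open_target.eventually_mem hz))
  have hzero := addHaar_image_eq_zero_of_det_fderivWithin_eq_zero volume (s := Metric.ball z r)
    (f := g.symm) (fun x hx => (hfd x (hb x hx).2).hasFDerivAt_wirtL.hasFDerivWithinAt)
    fun x hx => by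
      rw [det_wirtL]
      by_contra hD
      exact absurd (hreg x (hb x hx).2 hD) (not_le.2 (hb x hx).1)
  have hopen : IsOpen (g.symm '' Metric.ball z r) :=
    g.symm.isOpen_image_of_subset_source Metric.isOpen_ball fun x hx => (hb x hx).2
  exact (hopen.measure_pos volume ⟨_, mem_image_of_mem _ (Metric.mem_ball_self hr)⟩).ne' hzero

/-- The Beltrami coefficient of a quasiconformal homeomorphism with harmonic inverse. -/
theorem exists_contDiffOn_beltrami {ρ : ℂ → ℝ} {μ : ℂ → ℂ}
    (hρ : ContDiffOn ℝ ∞ ρ g.source) (hρpos : ∀ w ∈ g.source, 0 < ρ w)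
    (hg : IsQuasiconformal g) (hμ : IsBeltramiCoefficient g μ)
    (h : IsHarmonicInto g.target g.source ρ g.symm) :
    ∃ m : ℂ → ℂ, ContDiffOn ℝ 1 m g.source ∧ m =ᵐ[volume.restrict g.source] μ ∧
      ∀ w ∈ g.source,
        InverseDilatationEq (m w) (wirt m w) (wirtBar m w) (logDensityDeriv ρ w) := by
  obtain ⟨a, b, k, -, hQ⟩ := hg.exists_qcData one_pos
  have hf := h.contDiffOn
  have hT := g.open_target
  have hl := contDiffOn_logDensityDeriv g.open_source hρ hρpos
  have hp := hf.wirt hT (m := 1) (by norm_num)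
  have hq := hf.wirtBar hT (m := 1) (by norm_num)
  have hlf : ContDiffOn ℝ 1 (fun z => logDensityDeriv ρ (g.symm z)) g.target :=
    hl.comp (hf.of_le (by norm_num)) h.mapsTo
  have hstar : ∀ {u : ℂ → ℂ} {U : Set ℂ}, ContDiffOn ℝ 1 u U →
      ContDiffOn ℝ 1 (fun z => conj (u z)) U := fun hu =>
    Complex.conjCLE.contDiff.comp_contDiffOn hu
  have hd : ∀ {u : ℂ → ℂ}, ContDiffOn ℝ 1 u g.target → ∀ z ∈ g.target,
      HasFDerivAt u (wirtL (wirt u z) (wirtBar u z)) z := fun hu z hz =>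
    ((hu.differentiableOn (by simp)).differentiableAt (hT.mem_nhds hz)).hasFDerivAt_wirtL
  have hle : ∀ z ∈ g.target, ‖wirtBar g.symm z‖ ≤ k * ‖wirt g.symm z‖ := fun z hz =>
    hQ.norm_wirtBar_symm_le hf hz
  have hpne : ∀ z ∈ g.target, wirt g.symm z ≠ 0 := fun z hz => by
    refine wirt_ne_zero_of_injOn hT hf g.symm.injOn hQ.lt_one hle
      (A := fun z => -(logDensityDeriv ρ (g.symm z) * wirtBar g.symm z))
      (B := fun z => conj (-(logDensityDeriv ρ (g.symm z) * wirt g.symm z)))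
      (hlf.mul hq).neg (hstar (hlf.mul hp).neg) (fun z hz => ?_) (fun z hz => ?_) hz
    · linear_combination h.tension z hz
    · rw [(hd hq z hz).wirtL_conj.wirtBar_eq, ← wirtBar_wirt_comm hT hf hz, ← map_mul]
      congr 1
      linear_combination h.tension z hz
  have hDne : ∀ z ∈ g.target, ‖wirt g.symm z‖ ^ 2 - ‖wirtBar g.symm z‖ ^ 2 ≠ 0 := fun z hz => by
    have h1 : ‖wirtBar g.symm z‖ < ‖wirt g.symm z‖ :=
      (hle z hz).trans_lt (mul_lt_of_lt_one_left (norm_pos_iff.2 (hpne z hz)) hQ.lt_one)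
    have := pow_lt_pow_left₀ h1 (norm_nonneg _) two_ne_zero
    linarith
  have hgc : ContDiffOn ℝ 2 g g.source := fun w hw =>
    (contDiffAt_of_symm hf hw (hDne _ (g.map_source hw))).contDiffWithinAt
  have hnc : ∀ z ∈ g.target, conj (wirt g.symm z) ≠ 0 := fun z hz => by simpa using hpne z hz
  set m : ℂ → ℂ := fun w => -wirtBar g.symm (g w) * (conj (wirt g.symm (g w)))⁻¹ with hm
  have hmc : ContDiffOn ℝ 1 m g.source :=
    (hq.neg.mul ((hstar hp).inv hnc)).comp (hgc.of_le (by norm_num)) g.mapsTo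
  refine ⟨m, hmc, ?_, fun w hw => ?_⟩
  · obtain ⟨-, a', b', h', he⟩ := hμ
    obtain ⟨ea, eb⟩ := h'.unique g.open_source
      (HasWeakWirt.of_contDiffOn g.open_source (hgc.of_le (by norm_num)))
    filter_upwards [ea, eb, he, ae_restrict_mem g.open_source.measurableSet] with w w1 w2 w3 hw
    have hz := g.map_source hw
    obtain ⟨e1, e2⟩ := wirt_mul_jacobian_symm hw
      ((hf.differentiableOn (by norm_num)).differentiableAt (hT.mem_nhds hz))
      ((hgc.differentiableOn (by norm_num)).differentiableAt (g.open_source.mem_nhds hw))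
    rw [hm]
    simp only
    rw [← div_eq_mul_inv, div_eq_iff (hnc _ hz), ← e1, ← e2, ← w1, ← w2, w3, mul_assoc]
  · have hz := g.map_source hw
    have hmd := ((hmc.differentiableOn (by simp)).differentiableAt
      (g.open_source.mem_nhds hw)).hasFDerivAt_wirtL
    have hgw := g.left_inv hw
    have hmd' : HasFDerivAt m (wirtL (wirt m w) (wirtBar m w)) (g.symm (g w)) := by rwa [hgw]
    have hN := (hd hq _ hz).wirtL_add ((hmd'.wirtL_comp (k := g.symm)
      (hd (hf.of_le (by norm_num)) _ hz)).wirtL_mul (hd hp _ hz).wirtL_conj)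
    have hN0 := hN.congr_of_eventuallyEq (f₁ := fun _ => 0) (by
      filter_upwards [hT.mem_nhds hz] with z hz
      rw [hm]
      simp only [g.right_inv hz]
      rw [inv_mul_cancel_right₀ (hnc z hz), add_neg_cancel])
    have e := hN0.wirt_eq.symm.trans (hasFDerivAt_wirtL_const 0 (g w)).wirt_eq
    have ht := h.tension _ hz
    rw [hgw] at e ht
    have hq' : wirtBar g.symm (g w) = -m w * conj (wirt g.symm (g w)) := by
      simp only [hm]
      rw [neg_mul, neg_mul, neg_mul, neg_neg, inv_mul_cancel_right₀ (hnc _ hz)]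
    have hp' := hnc _ hz
    rw [← wirtBar_wirt_comm hT hf hz] at e
    have hH : wirtBar (wirt g.symm) (g w) =
        logDensityDeriv ρ w * wirt g.symm (g w) * m w * conj (wirt g.symm (g w)) := by
      rw [hq'] at ht
      linear_combination ht
    rw [hH, hq'] at e
    simp only [map_mul, map_neg, Complex.conj_conj] at e
    rw [InverseDilatationEq]
    refine mul_right_cancel₀ (mul_ne_zero (hpne _ hz) hp') ?_
    linear_combination e

end Inverse
end

theorem mainTheorem4 (ρ : ℂ → ℝ) (g : OpenPartialHomeomorph ℂ ℂ) (μ : ℂ → ℂ)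
    (hdomain : IsConnected g.source)
    (hρ : ContDiffOn ℝ ∞ ρ g.source) (hρpos : ∀ w ∈ g.source, 0 < ρ w)
    (hg : IsQuasiconformal g) (hμ : IsBeltramiCoefficient g μ) :
    (IsHarmonicInto g.target g.source ρ g.symm →
      ∃ m : ℂ → ℂ, ContDiffOn ℝ 1 m g.source ∧ m =ᵐ[volume.restrict g.source] μ ∧
        ∀ w ∈ g.source,
          InverseDilatationEq (m w) (wirt m w) (wirtBar m w) (logDensityDeriv ρ w)) ∧
    (MemSobolevLoc 1 g.source μ →
      eLpNorm μ ⊤ (volume.restrict g.source) < 1 →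
      (∃ a b : ℂ → ℂ, HasWeakWirt g.source μ a b ∧
        ∀ᵐ w ∂(volume.restrict g.source),
          InverseDilatationEq (μ w) (a w) (b w) (logDensityDeriv ρ w)) →
      IsHarmonicInto g.target g.source ρ g.symm) :=
  ⟨exists_contDiffOn_beltrami hρ hρpos hg hμ, fun _ hlt ⟨_, _, hw, heq⟩ =>
    isHarmonicInto_symm hρ hρpos hg hμ hlt hw heq⟩
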